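/- **Setting.** Let $A=(a_{ij})_{i,j\in I}$ be the Cartan matrix of a simple Lie algebra $\mathfrak g$, $a_{ij}=2(\alpha_i,\alpha_j)/(\alpha_i,\alpha_i)$, with multipliers $d_i=\frac12(\alpha_i,\alpha_i)$ normalized so that long roots have $d_i=1$. Let $\mathbf i=(i_1,\dots,i_N)$ be a reduced word of the longest element $w_0$ of the Weyl group, let $n_i$ be the number of letters $i$ in $\mathbf i$, and let $\eta$ be the Dynkin involution, $w_0\alpha_i=-\alpha_{\eta(i)}$. *Quivers.* A quiver is a finite set of labelled vertices, some of them frozen, with multipliers $d_v>0$ and skew-symmetric weights $w_{uv}\in\mathbb Q$ (an arrow $u\to v$ if $w_{uv}>0$). Mutation at a non-frozen vertex $k$ replaces $w_{uv}$ by $-w_{uv}$ if $k\in\{u,v\}$ and by $w_{uv}+\frac{w_{uk}|w_{kv}|+|w_{uk}|w_{kv}}{2d_k}$ otherwise. Amalgamation glues vertices with equal labels, adds the weights, and unfreezes the glued vertices. *The $\mathcal D_{\mathfrak g}$-quiver.* Its vertices are $f_i^k$ ($-n_i\le k\le n_i$) and $e_i^0$ ($i\in I$), with multiplier $d_i$;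 the frozen ones are $f_i^{\pm n_i}$. The arrows among the $f_i^k$ are the sum of the elementary quivers of the letters of $\mathbf i$, placed on $f_i^0,\dots,f_i^{n_i}$, and of those of the reversed word, placed on $f_i^{-n_i},\dots,f_i^0$. Here the elementary quiver of a letter $i$ leading from node $u$ to the next node $v$ of row $i$ has an arrow $u\to v$ of weight $d_i$, and for each $j\ne i$, with current node $x$ of row $j$, arrows $v\to x\to u$ of weight $\frac12|d_ia_{ij}|$. The arrows at $e_i^0$ have weight $d_i$: if the initial term of $\mathbf e_i$ is the $k$-th letter $j$ of $\mathbf i$, they are $f_j^k\to e_i^0\to f_j^{-k}$ and, if $k\neq1$, also $f_j^{-(k-1)}\to e_i^0\to f_j^{k-1}$. The initial term of $\mathbf e_i$ is the last letter if the word ends in $i$; in general it is obtained by tracing it through changes of words (swaps of commuting letters and Coxeter moves), each of which exchanges the first and the last of the changed positions and leaves the positions outside fixed. *Mutation sequences.* A change of words acts on quivers as follows, where $k-1$ and $l-1$ are the numbers of letters $i$ and $j$ to the left of the change. Swaps act trivially. The move $iji\to jij$ is mutation at $f_i^k$ followed by renaming: $\hat f_i^t=f_i^{t+1}$ for $t\ge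 k$, $\hat f_j^l=f_i^k$, $\hat f_j^t=f_j^{t-1}$ for $t\ge l+1$. The moves $ijij\leftrightarrow jiji$ ($i$ long, $j$ short) are the mutations at $f_j^l,f_i^k,f_j^l$. In type $G_2$ ($1$ long, $2$ short) the move $212121\to121212$ is the sequence of mutations at $f_1^2,f_1^1,f_2^2,f_1^2,f_2^2,f_2^1,f_2^2,f_1^2,f_1^1,f_2^2,f_1^2$ followed by exchanging the names $f_2^1,f_2^2$, and the opposite move is the inverse of this. *Basic quivers.* Let $\mathcal M$ be a sequence of changes of words from $\mathbf i$ to $(i_N,\dots,i_1)$, and $\mathcal M_\eta$ one from $\mathbf i$ to $(\eta(i_1),\dots,\eta(i_N))$. For a quiver $Q$, its flipped mirror $\widetilde Q$ is obtained by renaming each $f_i^k$ to $f_i^{-k}$ and reversing all arrows. A *basic quiver* for $\mathbf i$ is a quiver $Q$ attached to a triangle, that is, with vertices $f_i^k$ ($0\le k\le n_i$) and $e_i^0$, of which $e_i^0,f_i^0,f_i^{n_i}$ are frozen, such that 1. the amalgamation of $Q$ and $\widetilde Q$ along $\{e_i^0,f_i^0\}_{i\in I}$ is the $\mathcal D_{\mathfrak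 g}$-quiver; 2. $\mathcal M(Q)$ is identical to $\widetilde Q$, where $f_i^k,\,e_i^0$ of $\mathcal M(Q)$ are identified with $f_i^{k-n_i},\,e_{\eta(i)}^0$ of $\widetilde Q$; 3. $Q$ is identical to $\mathcal M_\eta(Q)$, where $f_i^k,\,e_i^0$ of $Q$ are identified with $f_{\eta(i)}^k,\,e_{\eta(i)}^0$ of $\mathcal M_\eta(Q)$. **Theorem.** For every simple $\mathfrak g$ and every reduced word $\mathbf i$ of $w_0$, sequences $\mathcal M$ and $\mathcal M_\eta$ exist, and there is a quiver $Q$ that, for every choice of $\mathcal M$ and $\mathcal M_\eta$, is a basic quiver for $\mathbf i$ and is the only one. -/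

import Mathlib

namespace BasicQuiver

/-! ### Simple types, the Weyl group and reduced words -/

/-- A simple type with Dynkin nodes `I`: an indecomposable Cartan matrix `a` of finite type,
`a i j = 2 (α_i, α_j) / (α_i, α_i)`, together with its multipliers `d i = (α_i, α_i) / 2`,
normalised so that long roots have multiplier `1` (hence short roots have multiplier `1/2` in the
types `B`, `C`, `F` and `1/3` in type `G₂`, and all multipliers are `1` in simply-laced types). -/
structure SimpleCartanDatum (I : Type*) [Fintype I] where
  a : Matrix I I ℤ
  d : I → ℚ
  diag : ∀ i, a i i = 2
  off_diag : ∀ i j, i ≠ j → a i j ≤ 0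
  d_pos : ∀ i, 0 < d i
  symm : ∀ i j, d i * a i j = d j * a j i
  posDef : ∀ x : I → ℚ, x ≠ 0 → 0 < ∑ i, ∑ j, d i * a i j * x i * x j
  indecomposable : ∀ s : Set I, s.Nonempty → sᶜ.Nonempty → ∃ i ∈ s, ∃ j ∈ sᶜ, a i j ≠ 0
  d_le_one : ∀ i, d i ≤ 1
  exists_long : ∃ i, d i = 1

namespace SimpleCartanDatum

variable {I : Type*} [Fintype I] [DecidableEq I]

/-- The simple reflection `s_i` on the root lattice: `s_i α_j = α_j - a_{ij} α_i`. -/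
def reflection (C : SimpleCartanDatum I) (i : I) : Module.End ℤ (I → ℤ) where
  toFun v := v - (∑ j, C.a i j * v j) • Pi.single i 1
  map_add' u v := by
    simp only [Pi.add_apply, mul_add, Finset.sum_add_distrib, add_smul]
    abel
  map_smul' c v := by
    have h : ∑ j, C.a i j * (c * v j) = c * ∑ j, C.a i j * v j := by
      rw [Finset.mul_sum]
      exact Finset.sum_congr rfl fun j _ => by ring
    simp only [Pi.smul_apply, smul_eq_mul, h, RingHom.id_apply, smul_sub, mul_smul]

/-- The Weyl group element `s_{i_1} ⋯ s_{i_m}` of a word `(i_1, …, i_m)`. -/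
def wordProd (C : SimpleCartanDatum I) (w : List I) : Module.End ℤ (I → ℤ) :=
  (w.map C.reflection).prod

/-- `w` is a shortest word for its Weyl group element. -/
def IsReduced (C : SimpleCartanDatum I) (w : List I) : Prop :=
  ∀ u : List I, C.wordProd u = C.wordProd w → w.length ≤ u.length

/-- `w` is a reduced word of the longest element `w₀` of the Weyl group. -/
def IsLongestWord (C : SimpleCartanDatum I) (w : List I) : Prop :=
  C.IsReduced w ∧ ∀ u : List I, C.IsReduced u → u.length ≤ w.length

end SimpleCartanDatum

/-! ### Weighted quivers, mutation, relabelling, amalgamation -/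

/-- A weighted quiver whose vertices carry labels in `V`: the vertex set, the frozen vertices, the
multipliers `d_v > 0`, and the skew-symmetric weights `w_{uv} = d_u b_{uv}`, where `b` is the
exchange matrix.  A positive weight `w_{uv}` is an arrow `u → v`.  Multipliers and weights are set
to `0` at labels that are not vertices, so that equality is equality of labelled quivers. -/
@[ext]
structure WeightedQuiver (V : Type*) where
  verts : Set V
  frozen : Set V
  mult : V → ℚ
  weight : V → V → ℚ
  frozen_subset : frozen ⊆ verts
  mult_pos : ∀ v ∈ verts, 0 < mult v
  mult_off : ∀ v ∉ verts, mult v = 0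
  weight_skew : ∀ u v, weight u v = -weight v u
  weight_off : ∀ u v, u ∉ verts → weight u v = 0

namespace WeightedQuiver

variable {V : Type*}

open Classical in
/-- Quiver mutation at the vertex `k`.  In terms of `b_{uv} = w_{uv} / d_u` this is the rule
`b'_{uv} = -b_{uv}` if `k ∈ {u, v}`, and `b_{uv} + (b_{uk} |b_{kv}| + |b_{uk}| b_{kv}) / 2`
otherwise. -/
noncomputable def mutate (k : V) (Q : WeightedQuiver V) : WeightedQuiver V where
  verts := Q.verts
  frozen := Q.frozen
  mult := Q.mult
  weight u v :=
    if u = k ∨ v = k then -Q.weight u v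
    else Q.weight u v
      + (Q.weight u k * |Q.weight k v| + |Q.weight u k| * Q.weight k v) / (2 * Q.mult k)
  frozen_subset := Q.frozen_subset
  mult_pos := Q.mult_pos
  mult_off := Q.mult_off
  weight_skew u v := by
    by_cases h : u = k ∨ v = k
    · rw [if_pos h, if_pos h.symm, Q.weight_skew u v]
    · rw [if_neg h, if_neg fun h' => h h'.symm, Q.weight_skew u v, Q.weight_skew u k,
        Q.weight_skew k v, abs_neg, abs_neg]
      ring
  weight_off u v hu := by
    simp [Q.weight_off u _ hu]

/-- Renaming of the vertices: the vertex named `v` in the new quiver is the vertex named `σ v` in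
the old one. -/
def relabel (σ : Equiv.Perm V) (Q : WeightedQuiver V) : WeightedQuiver V where
  verts := σ ⁻¹' Q.verts
  frozen := σ ⁻¹' Q.frozen
  mult v := Q.mult (σ v)
  weight u v := Q.weight (σ u) (σ v)
  frozen_subset _ hv := Q.frozen_subset hv
  mult_pos v hv := Q.mult_pos (σ v) hv
  mult_off v hv := Q.mult_off (σ v) hv
  weight_skew u v := Q.weight_skew (σ u) (σ v)
  weight_off u v hu := Q.weight_off (σ u) (σ v) hu

/-- All arrows are reversed. -/
def flip (Q : WeightedQuiver V) : WeightedQuiver V where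
  verts := Q.verts
  frozen := Q.frozen
  mult := Q.mult
  weight u v := -Q.weight u v
  frozen_subset := Q.frozen_subset
  mult_pos := Q.mult_pos
  mult_off := Q.mult_off
  weight_skew u v := by rw [Q.weight_skew u v]
  weight_off u v hu := by rw [Q.weight_off u v hu, neg_zero]

open Classical in
/-- Amalgamation of two quivers along the vertices with the same label: the weights are added, and
the glued vertices are no longer frozen. -/
noncomputable def amalgamate (Q R : WeightedQuiver V) : WeightedQuiver V where
  verts := Q.verts ∪ R.verts
  frozen := (Q.frozen ∪ R.frozen) \ (Q.verts ∩ R.verts)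
  mult v := if v ∈ Q.verts then Q.mult v else R.mult v
  weight u v := Q.weight u v + R.weight u v
  frozen_subset v hv := hv.1.imp (fun h => Q.frozen_subset h) (fun h => R.frozen_subset h)
  mult_pos v hv := by
    by_cases h : v ∈ Q.verts
    · simpa [h] using Q.mult_pos v h
    · simpa [h] using R.mult_pos v (hv.resolve_left h)
  mult_off v hv := by
    have h := not_or.mp hv
    rw [if_neg h.1, R.mult_off v h.2]
  weight_skew u v := by rw [Q.weight_skew u v, R.weight_skew u v]; ring
  weight_off u v hu := by
    have h := not_or.mp hu
    rw [Q.weight_off u v h.1, R.weight_off u v h.2, add_zero]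

end WeightedQuiver

/-! ### The nodes `f_i^k`, `e_i^0` and some renamings of them -/

/-- The labels `f_i^k` (`k` an integer) and `e_i^0`. -/
inductive Node (I : Type*) where
  | f (i : I) (k : ℤ) : Node I
  | e (i : I) : Node I

namespace Node

variable {I : Type*}

/-- The reflection `f_i^k ↔ f_i^{-k}`, fixing every `e_i^0`. -/
def reflect : Equiv.Perm (Node I) where
  toFun
    | f i k => f i (-k)
    | e i => e i
  invFun
    | f i k => f i (-k)
    | e i => e i
  left_inv v := by cases v <;> simp
  right_inv v := by cases v <;> simp

/-- `f_i^k ↦ f_i^{k - n_i}` and `e_i^0 ↦ e_{η(i)}^0`. -/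
def reversal (η : Equiv.Perm I) (n : I → ℤ) : Equiv.Perm (Node I) where
  toFun
    | f i k => f i (k - n i)
    | e i => e (η i)
  invFun
    | f i k => f i (k + n i)
    | e i => e (η.symm i)
  left_inv v := by cases v <;> simp
  right_inv v := by cases v <;> simp

/-- `f_i^k ↦ f_{η(i)}^k` and `e_i^0 ↦ e_{η(i)}^0`. -/
def involution (η : Equiv.Perm I) : Equiv.Perm (Node I) where
  toFun
    | f i k => f (η i) k
    | e i => e (η i)
  invFun
    | f i k => f (η.symm i) k
    | e i => e (η.symm i)
  left_inv v := by cases v <;> simp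
  right_inv v := by cases v <;> simp

open Classical in
/-- The interchange of the two labels `f_j^l` and `f_j^{l+1}`. -/
noncomputable def exchange (j : I) (l : ℤ) : Equiv.Perm (Node I) :=
  Equiv.swap (f j l) (f j (l + 1))

open Classical in
/-- The renaming after the mutation at `f_i^k` for a change of words `i j i → j i j`: the new
`f_i^t` with `t ≥ k` is the old `f_i^{t+1}`, the new `f_j^l` is the old `f_i^k`, the new `f_j^t`
with `t ≥ l + 1` is the old `f_j^{t-1}`, and all other nodes keep their names. -/
noncomputable def shift (i j : I) (hij : i ≠ j) (k l : ℤ) : Equiv.Perm (Node I) where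
  toFun
    | f c t =>
      if c = i then (if k ≤ t then f i (t + 1) else f i t)
      else if c = j then (if t = l then f i k else if l + 1 ≤ t then f j (t - 1) else f j t)
      else f c t
    | e c => e c
  invFun
    | f c t =>
      if c = i then (if t = k then f j l else if k + 1 ≤ t then f i (t - 1) else f i t)
      else if c = j then (if l ≤ t then f j (t + 1) else f j t)
      else f c t
    | e c => e c
  left_inv v := by
    cases v with
    | e c => rfl
    | f c t => grind
  right_inv v := by
    cases v with
    | e c => rfl
    | f c t => grind

/-! ### Single arrows -/

open Classical in
/-- The weights of a single arrow `u → v` of weight `c`. -/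
noncomputable def arrow (u v : Node I) (c : ℚ) (s t : Node I) : ℚ :=
  (if s = u ∧ t = v then c else 0) - (if s = v ∧ t = u then c else 0)

theorem arrow_skew (u v : Node I) (c : ℚ) (s t : Node I) : arrow u v c s t = -arrow u v c t s := by
  classical
  unfold arrow
  rw [neg_sub]
  congr 1 <;> exact if_congr and_comm rfl rfl

theorem arrow_off {u v : Node I} {c : ℚ} {s : Node I} (t : Node I) (hu : s ≠ u) (hv : s ≠ v) :
    arrow u v c s t = 0 := by
  simp [arrow, hu, hv]

end Node

namespace SimpleCartanDatum

open Node

variable {I : Type*} [Fintype I] [DecidableEq I]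

/-! ### Changes of words and their mutation sequences -/

/-- The elementary changes of words: the swap of commuting letters and the Coxeter moves.  In
`doubly`, `doublyInv`, `triply`, `triplyInv`, the root `i` is long and the root `j` is short. -/
inductive Move (C : SimpleCartanDatum I) : List I → List I → Type _ where
  | swap (x y : List I) (i j : I) (hij : i ≠ j) (h : C.a i j = 0) :
      Move C (x ++ [i, j] ++ y) (x ++ [j, i] ++ y)
  | simply (x y : List I) (i j : I) (hij : i ≠ j) (h : C.a i j = -1) (h' : C.a j i = -1) :
      Move C (x ++ [i, j, i] ++ y) (x ++ [j, i, j] ++ y)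
  | doubly (x y : List I) (i j : I) (hij : i ≠ j) (h : C.a i j = -1) (h' : C.a j i = -2) :
      Move C (x ++ [i, j, i, j] ++ y) (x ++ [j, i, j, i] ++ y)
  | doublyInv (x y : List I) (i j : I) (hij : i ≠ j) (h : C.a i j = -1) (h' : C.a j i = -2) :
      Move C (x ++ [j, i, j, i] ++ y) (x ++ [i, j, i, j] ++ y)
  | triply (x y : List I) (i j : I) (hij : i ≠ j) (h : C.a i j = -1) (h' : C.a j i = -3) :
      Move C (x ++ [j, i, j, i, j, i] ++ y) (x ++ [i, j, i, j, i, j] ++ y)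
  | triplyInv (x y : List I) (i j : I) (hij : i ≠ j) (h : C.a i j = -1) (h' : C.a j i = -3) :
      Move C (x ++ [i, j, i, j, i, j] ++ y) (x ++ [j, i, j, i, j, i] ++ y)

/-- Mutation at a list of nodes, from left to right. -/
noncomputable def mutateAt (l : List (Node I)) (Q : WeightedQuiver (Node I)) :
    WeightedQuiver (Node I) :=
  l.foldl (fun R k => R.mutate k) Q

/-- The `11` mutations of the change of words `j i j i j i → i j i j i j` (`i` long, `j` short),
where `p` and `q` are the numbers of letters `i` and `j` to the left of it. -/
def triplySequence (i j : I) (p q : ℤ) : List (Node I) :=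
  [f i (p + 2), f i (p + 1), f j (q + 2), f i (p + 2), f j (q + 2), f j (q + 1), f j (q + 2),
    f i (p + 2), f i (p + 1), f j (q + 2), f i (p + 2)]

/-- The quiver mutations, followed by the renaming of the nodes, of an elementary change of words.
With `k - 1` and `l - 1` letters `i` and `j` to the left of the changed letters: nothing for a
swap; mutation at `f_i^k` and the renaming `Node.shift` for `i j i → j i j`; mutations at
`f_j^l, f_i^k, f_j^l` (long `i`, short `j`) for `i j i j ↔ j i j i`; the `11` mutations above and
the exchange of the names `f_j^l` and `f_j^{l+1}` for `j i j i j i → i j i j i j`, and the inverse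
of this for the inverse change. All mutated nodes lie strictly between two occurrences of the same
letter, so they are not frozen. -/
noncomputable def Move.act {C : SimpleCartanDatum I} {w w' : List I} :
    C.Move w w' → WeightedQuiver (Node I) → WeightedQuiver (Node I)
  | .swap _ _ _ _ _ _, Q => Q
  | .simply x _ i j hij _ _, Q =>
      (Q.mutate (f i (x.count i + 1))).relabel (shift i j hij (x.count i + 1) (x.count j + 1))
  | .doubly x _ i j _ _ _, Q =>
      mutateAt [f j (x.count j + 1), f i (x.count i + 1), f j (x.count j + 1)] Q
  | .doublyInv x _ i j _ _ _, Q =>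
      mutateAt [f j (x.count j + 1), f i (x.count i + 1), f j (x.count j + 1)] Q
  | .triply x _ i j _ _ _, Q =>
      (mutateAt (triplySequence i j (x.count i) (x.count j)) Q).relabel
        (exchange j (x.count j + 1))
  | .triplyInv x _ i j _ _ _, Q =>
      mutateAt (triplySequence i j (x.count i) (x.count j)).reverse
        (Q.relabel (exchange j (x.count j + 1)))

/-- Reflection of the interval `[s, s + m - 1]`; all other positions are fixed. -/
def reflectWindow (s m p : ℕ) : ℕ := if s ≤ p ∧ p < s + m then 2 * s + m - 1 - p else p

/-- How an elementary change of words moves the position (counted from `0`) of an initial term: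
positions outside the changed letters are kept, the first and the last changed position are
interchanged (an initial term never sits strictly between them). -/
def Move.trace {C : SimpleCartanDatum I} {w w' : List I} : C.Move w w' → ℕ → ℕ
  | .swap x _ _ _ _ _ => reflectWindow x.length 2
  | .simply x _ _ _ _ _ _ => reflectWindow x.length 3
  | .doubly x _ _ _ _ _ _ => reflectWindow x.length 4
  | .doublyInv x _ _ _ _ _ _ => reflectWindow x.length 4
  | .triply x _ _ _ _ _ _ => reflectWindow x.length 6
  | .triplyInv x _ _ _ _ _ _ => reflectWindow x.length 6

/-- A sequence of elementary changes of words from `w` to `w'`. -/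
inductive WordChange (C : SimpleCartanDatum I) : List I → List I → Type _ where
  | nil (w : List I) : WordChange C w w
  | cons {w w' w'' : List I} (m : C.Move w w') (M : WordChange C w' w'') : WordChange C w w''

/-- The mutation sequence of a sequence of changes of words. -/
noncomputable def WordChange.act {C : SimpleCartanDatum I} {w w' : List I} :
    C.WordChange w w' → WeightedQuiver (Node I) → WeightedQuiver (Node I)
  | .nil _, Q => Q
  | .cons m M, Q => M.act (m.act Q)

/-! ### The `𝒟_𝔤`-quiver -/

/-- `C.InitialPos w i p`: the variable at position `p` (counted from `0`) of the word `w` is the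
initial term of the generator `𝐞_i`.  It is the last variable if the last letter is `i`, and it is
traced through changes of words. -/
inductive InitialPos (C : SimpleCartanDatum I) : List I → I → ℕ → Prop where
  | last (x : List I) (i : I) : InitialPos C (x ++ [i]) i x.length
  | move {w w' : List I} (m : C.Move w w') (i : I) (p : ℕ) :
      InitialPos C w i p → InitialPos C w' i (m.trace p)

/-- The variable `u_j^k`, belonging to the `k`-th letter `j` of `w`, is the initial term of the
generator `𝐞_i`. -/
def IsInitialTerm (C : SimpleCartanDatum I) (w : List I) (i j : I) (k : ℤ) : Prop :=
  ∃ x y : List I, w = x ++ j :: y ∧ k = x.count j + 1 ∧ C.InitialPos w i x.length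

/-- The weights of the elementary quiver of a simple reflection `s_i`: an arrow `u → v` of weight
`d_i`, and for every other `j` two arrows `v → nb j → u` of weight `|d_i a_{ij}| / 2`
(there is no arrow if `j` is not adjacent to `i`). Here `u = f_i^{k-1}`, `v = f_i^k`, `nb j = f_j^l`. -/
noncomputable def elementary (C : SimpleCartanDatum I) (i : I) (u v : Node I) (nb : I → Node I)
    (s t : Node I) : ℚ :=
  arrow u v (C.d i) s t + ∑ j ∈ Finset.univ.erase i,
    (arrow v (nb j) (|C.d i * C.a i j| / 2) s t + arrow (nb j) u (|C.d i * C.a i j| / 2) s t)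

/-- The weights of the amalgamation, along vertices with the same label, of the elementary quivers
of the letters of a word, where the `i`-th row of nodes starts at `f_i^{r i}`: each letter `i` uses
the current node `f_i^{r i}`, the next node `f_i^{r i + 1}`, and the current nodes `f_j^{r j}`. -/
noncomputable def wordWeight (C : SimpleCartanDatum I) :
    List I → (I → ℤ) → Node I → Node I → ℚ
  | [], _, _, _ => 0
  | i :: w, r, s, t =>
      C.elementary i (f i (r i)) (f i (r i + 1)) (fun j => f j (r j)) s t
        + C.wordWeight w (Function.update r i (r i + 1)) s t

open Classical in
/-- The weights of the arrows at the nodes `e_i^0`: if `u_j^k` is the initial term of `𝐞_i`, there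
are arrows `f_j^k → e_i^0 → f_j^{-k}`, and, unless `k = 1`, arrows
`f_j^{-(k-1)} → e_i^0 → f_j^{k-1}`, all of weight `d_i`. -/
noncomputable def initialWeight (C : SimpleCartanDatum I) (w : List I) (s t : Node I) : ℚ :=
  ∑ i, ∑ j, ∑ k ∈ Finset.Icc (1 : ℤ) (w.count j), if C.IsInitialTerm w i j k then
    arrow (f j k) (e i) (C.d i) s t + arrow (e i) (f j (-k)) (C.d i) s t
      + (if k = 1 then 0 else
          arrow (f j (-(k - 1))) (e i) (C.d i) s t + arrow (e i) (f j (k - 1)) (C.d i) s t)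
    else 0

/-- The nodes `f_i^k` with `-n_i ≤ k ≤ n_i`, and `e_i^0`, where `n_i` is the number of letters `i`
in `w`. -/
def dVerts (w : List I) : Set (Node I) :=
  {v | match v with
    | f i k => -(w.count i : ℤ) ≤ k ∧ k ≤ w.count i
    | e _ => True}

/-- The multipliers: `d_i` at the vertices `f_i^k` and `e_i^0`. -/
noncomputable def nodeMult (C : SimpleCartanDatum I) (w : List I) : Node I → ℚ
  | f i k => if -(w.count i : ℤ) ≤ k ∧ k ≤ w.count i then C.d i else 0
  | e i => C.d i

theorem wordWeight_skew (C : SimpleCartanDatum I) (w : List I) (r : I → ℤ) (s t : Node I) :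
    C.wordWeight w r s t = -C.wordWeight w r t s := by
  induction w generalizing r with
  | nil => simp [wordWeight]
  | cons i w ih =>
    simp only [wordWeight, elementary]
    rw [ih, arrow_skew _ _ _ s t,
      Finset.sum_congr rfl fun j _ => by rw [arrow_skew _ _ _ s t, arrow_skew _ _ _ s t, ← neg_add],
      Finset.sum_neg_distrib]
    ring

theorem wordWeight_off (C : SimpleCartanDatum I) (w : List I) (r : I → ℤ) (s t : Node I)
    (h : ∀ i k, r i ≤ k → k ≤ r i + w.count i → s ≠ f i k) : C.wordWeight w r s t = 0 := by
  induction w generalizing r with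
  | nil => simp [wordWeight]
  | cons i w ih =>
    have hc : (i :: w).count i = w.count i + 1 := List.count_cons_self
    have h0 : ∀ j, s ≠ f j (r j) := fun j => h j _ le_rfl (by omega)
    have h1 : s ≠ f i (r i + 1) := h i _ (by omega) (by omega)
    have h2 : C.wordWeight w (Function.update r i (r i + 1)) s t = 0 := by
      refine ih _ fun j k hj hk => ?_
      by_cases hji : j = i
      · subst hji
        rw [Function.update_self] at hj hk
        exact h j k (by omega) (by omega)
      · rw [Function.update_of_ne hji] at hj hk
        refine h j k hj ?_
        rwa [List.count_cons_of_ne (Ne.symm hji)]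
    simp only [wordWeight, elementary]
    rw [h2, arrow_off t (h0 i) h1, Finset.sum_eq_zero fun j _ => by
      rw [arrow_off t h1 (h0 j), arrow_off t (h0 j) (h0 i), add_zero]]
    simp

theorem initialWeight_skew (C : SimpleCartanDatum I) (w : List I) (s t : Node I) :
    C.initialWeight w s t = -C.initialWeight w t s := by
  simp only [initialWeight, ← Finset.sum_neg_distrib]
  refine Finset.sum_congr rfl fun i _ => Finset.sum_congr rfl fun j _ =>
    Finset.sum_congr rfl fun k _ => ?_
  simp only [arrow_skew _ _ _ s t]
  split_ifs <;> ring

theorem initialWeight_off (C : SimpleCartanDatum I) (w : List I) (s t : Node I)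
    (hs : s ∉ dVerts w) : C.initialWeight w s t = 0 := by
  have he : ∀ i, s ≠ e i := fun i h => hs (h ▸ trivial)
  have hf : ∀ i k, -(w.count i : ℤ) ≤ k → k ≤ w.count i → s ≠ f i k :=
    fun i k h1 h2 h => hs (h ▸ ⟨h1, h2⟩)
  refine Finset.sum_eq_zero fun i _ => Finset.sum_eq_zero fun j _ =>
    Finset.sum_eq_zero fun k hk => ?_
  rw [Finset.mem_Icc] at hk
  rw [arrow_off t (hf j k (by omega) (by omega)) (he i),
    arrow_off t (he i) (hf j (-k) (by omega) (by omega)),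
    arrow_off t (hf j (-(k - 1)) (by omega) (by omega)) (he i),
    arrow_off t (he i) (hf j (k - 1) (by omega) (by omega))]
  simp

/-- The `𝒟_𝔤`-quiver of the word `w`: the amalgamation of the elementary quivers of `w`, placed on
the nodes `f_i^0, …, f_i^{n_i}`, and of those of the opposite word, placed on the nodes
`f_i^{-n_i}, …, f_i^0`, together with the arrows at the nodes `e_i^0`. The frozen nodes are the
`f_i^{-n_i}` and the `f_i^{n_i}`. -/
noncomputable def dQuiver (C : SimpleCartanDatum I) (w : List I) : WeightedQuiver (Node I) where
  verts := dVerts w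
  frozen := {v | ∃ i, v = f i (-(w.count i : ℤ)) ∨ v = f i (w.count i)}
  mult := C.nodeMult w
  weight s t := C.wordWeight w (fun _ => 0) s t
    + C.wordWeight w.reverse (fun i => -(w.count i : ℤ)) s t + C.initialWeight w s t
  frozen_subset := by
    rintro v ⟨i, rfl | rfl⟩
    · exact ⟨by omega, by omega⟩
    · exact ⟨by omega, by omega⟩
  mult_pos v hv := by
    cases v with
    | f i k =>
      have h : C.nodeMult w (f i k) = C.d i := if_pos hv
      exact h ▸ C.d_pos i
    | e i => exact C.d_pos i
  mult_off v hv := by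
    cases v with
    | f i k => exact if_neg hv
    | e i => exact absurd trivial hv
  weight_skew s t := by
    rw [wordWeight_skew, C.wordWeight_skew w.reverse, initialWeight_skew]
    ring
  weight_off s t hs := by
    have hf : ∀ i k, -(w.count i : ℤ) ≤ k → k ≤ w.count i → s ≠ f i k :=
      fun i k h1 h2 h => hs (h ▸ ⟨h1, h2⟩)
    rw [C.wordWeight_off w _ s t fun i k h1 h2 => hf i k (by omega) (by omega),
      C.wordWeight_off w.reverse _ s t fun i k h1 h2 => hf i k h1 (by
        rw [List.count_reverse] at h2
        omega),
      C.initialWeight_off w s t hs]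
    simp

/-! ### Basic quivers -/

/-- `η` is the Dynkin involution: `w₀ α_i = -α_{η(i)}`, where `w` is a word of `w₀`. -/
def IsDynkinInvolution (C : SimpleCartanDatum I) (w : List I) (η : Equiv.Perm I) : Prop :=
  ∀ i, C.wordProd w (Pi.single i 1) = -Pi.single (η i) 1

/-- The mirror image `Q̃` of `Q`, with all arrows flipped: `f_i^k` becomes `f_i^{-k}`, while `e_i^0`
keeps its label. -/
def mirror (Q : WeightedQuiver (Node I)) : WeightedQuiver (Node I) :=
  (Q.relabel reflect).flip

/-- `Q` is a basic quiver for the reduced word `w` of the longest element, where `η` is the Dynkin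
involution, `M` is a sequence of changes of words reversing `w`, and `N` is one applying `η` to all
letters of `w`. -/
structure IsBasicQuiver (C : SimpleCartanDatum I) (w : List I) (η : Equiv.Perm I)
    (M : C.WordChange w w.reverse) (N : C.WordChange w (w.map η))
    (Q : WeightedQuiver (Node I)) : Prop where
  /-- The vertices are the `f_i^k` with `0 ≤ k ≤ n_i` and the `e_i^0`. -/
  verts_eq : Q.verts = {v | (∃ i k, v = f i k ∧ 0 ≤ k ∧ k ≤ w.count i) ∨ ∃ i, v = e i}
  /-- The frozen vertices, on the sides of the triangle, are `e_i^0`, `f_i^0` and `f_i^{n_i}`. -/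
  frozen_eq : Q.frozen = {v | ∃ i, v = e i ∨ v = f i 0 ∨ v = f i (w.count i)}
  /-- The amalgamation of `Q` and its mirror along the `e_i^0` and `f_i^0` is the
  `𝒟_𝔤`-quiver. -/
  amalgam : Q.amalgamate (mirror Q) = C.dQuiver w
  /-- The mutated quiver is identical to the mirror, where `f_i^k`, `e_i^0` of the former are
  `f_i^{k - n_i}`, `e_{η(i)}^0` of the latter. -/
  reversal : M.act Q = (mirror Q).relabel (Node.reversal η fun i => w.count i)
  /-- `Q` is identical to the mutated quiver, where `f_i^k`, `e_i^0` of the former are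
  `f_{η(i)}^k`, `e_{η(i)}^0` of the latter. -/
  involution : Q = (N.act Q).relabel (Node.involution η)

end SimpleCartanDatum

end BasicQuiver

set_option linter.unusedSectionVars false
set_option linter.unusedSimpArgs false

/-!
The basic quiver is written down for every word `w`, not only for words of the longest element. Its
weights (`triangleWeight`) are a sum over the letters of `w` of three contributions: the elementary
quiver of the letter; the arrows at `e_i^0`, placed at the letter `j` of `w = x j y` for which
`y α_i = α_j`; and arrows of weight `|d_i a_{ik}| / 2` between `e_i^0` and `e_k^0`, directed by the
order of their letters in `w`. The letter with `y α_i = α_j` is the one at which the simple root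
`α_i` appears among the positive roots made negative by `w`; it is the initial term of `𝐞_i`, since
changes of words move both in the same way (`initialPos_iff`).

These quivers are compatible with changes of reduced words: the mutations of a change of words carry
the quiver of `w` to the quiver of `w'` (`WordChange.act_triangleQuiver`). A change of words
only affects a window of letters `i` and `j`. In the window, only the last and the first letter can
give simple roots, and a change of words interchanges these two (`IsWindow`). The mutated nodes are
joined to nodes of the window only, so that everything takes place in a finite quiver with nodes
`f_i^k`, `f_j^k` and two further nodes for the `e_c^0` of the window (`triangleWeight_eq`,
`HasLocalWeight.mutate`), where the mutations are computed.

Since reduced words of the same element are connected by changes of words (`nonempty_wordChange`, by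
the exchange condition), the three conditions are now symmetries of the explicit weights. In the
amalgamation with the mirror image the arrows between the `e_i^0` cancel
(`amalgamate_triangleQuiver`). Reversal holds because the two parts `x` and `y` of a word `x j y` of
the longest element determine each other up to `η`: `s_j y α_{η(i)} = - x⁻¹ α_i`
(`triangleQuiver_reverse`). The Dynkin involution acts on all data (`triangleQuiver_map_relabel`).

For uniqueness, the amalgamation determines all weights except those between the nodes `e_i^0` and
`f_i^0`. No mutation touches these nodes, so the difference `δ` of two basic quivers is preserved
(`DiffersBy.wordChange`). Reversal moves `f_i^0` to `f_i^{n_i}`, where `δ` vanishes, and gives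
`δ(e_i, e_k) = -δ(e_{η(i)}, e_{η(k)})`; the condition on `η` gives the same with the
opposite sign (`IsBasicQuiver.unique`).
-/

namespace BasicQuiver

namespace SimpleCartanDatum

variable {I : Type*} [Fintype I] [DecidableEq I]

/-! ### Simple roots and simple reflections -/

/-- The simple root `α_i`, as a vector of the root lattice. -/
abbrev simpleRoot (i : I) : I → ℤ := Pi.single i 1

/-- The pairing `⟨α_i^∨, v⟩` of a simple coroot with a vector of the root lattice. -/
def pairing (C : SimpleCartanDatum I) (i : I) (v : I → ℤ) : ℤ := ∑ j, C.a i j * v j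

/-- The invariant bilinear form, normalised by `(α_i, α_i) = 2 d_i`. -/
def form (C : SimpleCartanDatum I) (u v : I → ℤ) : ℚ := ∑ i, ∑ j, C.d i * C.a i j * u i * v j

theorem pairing_add (C : SimpleCartanDatum I) (i : I) (u v : I → ℤ) :
    C.pairing i (u + v) = C.pairing i u + C.pairing i v := by
  simp [pairing, mul_add, Finset.sum_add_distrib]

theorem pairing_smul (C : SimpleCartanDatum I) (i : I) (c : ℤ) (v : I → ℤ) :
    C.pairing i (c • v) = c * C.pairing i v := by
  simp only [pairing, Pi.smul_apply, smul_eq_mul, Finset.mul_sum]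
  exact Finset.sum_congr rfl fun j _ => by ring

theorem pairing_simpleRoot (C : SimpleCartanDatum I) (i j : I) :
    C.pairing i (simpleRoot j) = C.a i j := by
  simp [pairing, simpleRoot, Pi.single_apply]

theorem reflection_apply (C : SimpleCartanDatum I) (i : I) (v : I → ℤ) :
    C.reflection i v = v - C.pairing i v • simpleRoot i := rfl

theorem reflection_apply_of_ne (C : SimpleCartanDatum I) {i k : I} (h : k ≠ i) (v : I → ℤ) :
    C.reflection i v k = v k := by
  simp [reflection_apply, h]

theorem reflection_simpleRoot (C : SimpleCartanDatum I) (i : I) :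
    C.reflection i (simpleRoot i) = -simpleRoot i := by
  rw [reflection_apply, pairing_simpleRoot, C.diag, two_smul]
  abel

theorem reflection_reflection (C : SimpleCartanDatum I) (i : I) (v : I → ℤ) :
    C.reflection i (C.reflection i v) = v := by
  rw [C.reflection_apply i v, map_sub, map_smul, reflection_simpleRoot, reflection_apply]
  simp

/-! ### The invariant form -/

theorem form_comm (C : SimpleCartanDatum I) (u v : I → ℤ) : C.form u v = C.form v u := by
  unfold form
  rw [Finset.sum_comm]
  refine Finset.sum_congr rfl fun i _ => Finset.sum_congr rfl fun j _ => ?_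
  rw [C.symm j i]
  ring

theorem form_add_right (C : SimpleCartanDatum I) (u v w : I → ℤ) :
    C.form u (v + w) = C.form u v + C.form u w := by
  simp [form, mul_add, Finset.sum_add_distrib]

theorem form_smul_right (C : SimpleCartanDatum I) (c : ℤ) (u v : I → ℤ) :
    C.form u (c • v) = c * C.form u v := by
  simp only [form, Pi.smul_apply, smul_eq_mul, Finset.mul_sum, Int.cast_mul]
  exact Finset.sum_congr rfl fun i _ => Finset.sum_congr rfl fun j _ => by ring

theorem form_neg_right (C : SimpleCartanDatum I) (u v : I → ℤ) :
    C.form u (-v) = -C.form u v := by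
  simpa using C.form_smul_right (-1) u v

theorem form_sub_right (C : SimpleCartanDatum I) (u v w : I → ℤ) :
    C.form u (v - w) = C.form u v - C.form u w := by
  rw [sub_eq_add_neg, form_add_right, form_neg_right, sub_eq_add_neg]

theorem form_sub_left (C : SimpleCartanDatum I) (u v w : I → ℤ) :
    C.form (u - v) w = C.form u w - C.form v w := by
  rw [form_comm, form_sub_right, C.form_comm w, C.form_comm w]

theorem form_smul_left (C : SimpleCartanDatum I) (c : ℤ) (u v : I → ℤ) :
    C.form (c • u) v = c * C.form u v := by
  rw [form_comm, form_smul_right, form_comm]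

theorem form_neg_left (C : SimpleCartanDatum I) (u v : I → ℤ) :
    C.form (-u) v = -C.form u v := by
  simpa using C.form_smul_left (-1) u v

theorem form_simpleRoot_left (C : SimpleCartanDatum I) (i : I) (v : I → ℤ) :
    C.form (simpleRoot i) v = C.d i * C.pairing i v := by
  unfold form pairing
  rw [Finset.sum_eq_single i (fun b _ hb => by simp [simpleRoot, hb]) (by simp)]
  simp [simpleRoot, Finset.mul_sum, mul_assoc]

theorem form_simpleRoot (C : SimpleCartanDatum I) (i j : I) :
    C.form (simpleRoot i) (simpleRoot j) = C.d i * C.a i j := by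
  rw [form_simpleRoot_left, pairing_simpleRoot]

theorem form_pos (C : SimpleCartanDatum I) {v : I → ℤ} (hv : v ≠ 0) : 0 < C.form v v := by
  refine C.posDef (fun i => (v i : ℚ)) fun h => hv ?_
  ext i
  simpa using congrFun h i

theorem form_reflection (C : SimpleCartanDatum I) (i : I) (u v : I → ℤ) :
    C.form (C.reflection i u) (C.reflection i v) = C.form u v := by
  simp only [reflection_apply, form_sub_left, form_sub_right, form_smul_left, form_smul_right,
    form_simpleRoot_left, C.form_comm u (simpleRoot i), pairing_simpleRoot, C.diag]
  push_cast
  ring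

/-! ### Elements of the Weyl group given by words -/

@[simp]
theorem wordProd_nil_apply (C : SimpleCartanDatum I) (v : I → ℤ) : C.wordProd [] v = v := rfl

@[simp]
theorem wordProd_cons_apply (C : SimpleCartanDatum I) (i : I) (w : List I) (v : I → ℤ) :
    C.wordProd (i :: w) v = C.reflection i (C.wordProd w v) := by
  simp [wordProd]

theorem wordProd_append (C : SimpleCartanDatum I) (x y : List I) :
    C.wordProd (x ++ y) = C.wordProd x * C.wordProd y := by
  simp [wordProd]

theorem wordProd_append_apply (C : SimpleCartanDatum I) (x y : List I) (v : I → ℤ) :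
    C.wordProd (x ++ y) v = C.wordProd x (C.wordProd y v) := by
  rw [wordProd_append]; rfl

theorem wordProd_reverse_mul (C : SimpleCartanDatum I) (w : List I) (v : I → ℤ) :
    C.wordProd w.reverse (C.wordProd w v) = v := by
  induction w generalizing v with
  | nil => rfl
  | cons i w ih =>
    rw [List.reverse_cons, wordProd_append_apply, wordProd_cons_apply, wordProd_cons_apply,
      wordProd_nil_apply, reflection_reflection, ih]

theorem wordProd_mul_reverse (C : SimpleCartanDatum I) (w : List I) (v : I → ℤ) :
    C.wordProd w (C.wordProd w.reverse v) = v := by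
  simpa using C.wordProd_reverse_mul w.reverse v

theorem wordProd_injective (C : SimpleCartanDatum I) (w : List I) :
    Function.Injective (C.wordProd w) :=
  Function.LeftInverse.injective (C.wordProd_reverse_mul w)

theorem form_wordProd (C : SimpleCartanDatum I) (w : List I) (u v : I → ℤ) :
    C.form (C.wordProd w u) (C.wordProd w v) = C.form u v := by
  induction w with
  | nil => rfl
  | cons i w ih => rw [wordProd_cons_apply, wordProd_cons_apply, form_reflection, ih]

/-! ### Roots are positive or negative -/

/-- A root: an image of a simple root under the Weyl group. -/
def IsRoot (C : SimpleCartanDatum I) (v : I → ℤ) : Prop :=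
  ∃ (w : List I) (i : I), v = C.wordProd w (simpleRoot i)

theorem IsRoot.wordProd {C : SimpleCartanDatum I} {v : I → ℤ} (hv : C.IsRoot v) (u : List I) :
    C.IsRoot (C.wordProd u v) := by
  obtain ⟨w, i, rfl⟩ := hv
  exact ⟨u ++ w, i, (C.wordProd_append_apply u w _).symm⟩

theorem isRoot_simpleRoot (C : SimpleCartanDatum I) (i : I) : C.IsRoot (simpleRoot i) :=
  ⟨[], i, rfl⟩

theorem isRoot_wordProd (C : SimpleCartanDatum I) (w : List I) (i : I) :
    C.IsRoot (C.wordProd w (simpleRoot i)) := ⟨w, i, rfl⟩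

/-- For `v = ∑ v_k α_k`, the numbers `v_k d_k / d` are integers.  A root `v` of length
`(v, v) = 2 d` has this property, since `2 v / (v, v) = ∑ (v_k d_k / d) α_k^∨` is a coroot. -/
def IsScaled (C : SimpleCartanDatum I) (d : ℚ) (v : I → ℤ) : Prop :=
  ∀ k, ∃ z : ℤ, C.d k * v k = d * z

theorem IsScaled.reflection {C : SimpleCartanDatum I} {d : ℚ} {v : I → ℤ} (hv : C.IsScaled d v)
    (i : I) : C.IsScaled d (C.reflection i v) := by
  intro k
  obtain ⟨z, hz⟩ := hv k
  by_cases hk : k = i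
  · subst hk
    choose f hf using hv
    refine ⟨z - ∑ j, C.a j k * f j, ?_⟩
    have h : C.d k * C.pairing k v = d * ∑ j, (C.a j k : ℚ) * f j := by
      simp only [pairing, Int.cast_sum, Finset.mul_sum, Int.cast_mul]
      refine Finset.sum_congr rfl fun j _ => ?_
      rw [← mul_assoc, C.symm k j, mul_left_comm, ← hf j]
      ring
    rw [reflection_apply]
    simp only [Pi.sub_apply, Pi.smul_apply, simpleRoot, Pi.single_eq_same, smul_eq_mul, mul_one]
    push_cast
    rw [mul_sub, hz, h]
    ring
  · exact ⟨z, by rw [reflection_apply_of_ne C hk, hz]⟩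

theorem isScaled_wordProd (C : SimpleCartanDatum I) (w : List I) (i : I) :
    C.IsScaled (C.d i) (C.wordProd w (simpleRoot i)) := by
  induction w with
  | nil =>
    intro k
    by_cases hk : k = i
    · exact ⟨1, by simp [hk, simpleRoot]⟩
    · exact ⟨0, by simp [hk, simpleRoot]⟩
  | cons j w ih => exact ih.reflection j

/-- A symmetric integer matrix with even diagonal has an even sum of entries. -/
theorem even_sum_of_symm (m : I → I → ℤ) (hs : ∀ k l, m k l = m l k) (hd : ∀ k, Even (m k k)) :
    Even (∑ k, ∑ l, m k l) := by
  rw [← Finset.sum_product', ← ZMod.intCast_eq_zero_iff_even, Int.cast_sum]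
  refine Finset.sum_involution (fun p _ => p.swap) (fun p _ => ?_) (fun p _ hp h => hp ?_)
    (fun p _ => by simp) (fun p _ => by simp)
  · rw [Prod.fst_swap, Prod.snd_swap, hs p.2 p.1]
    exact CharTwo.add_self_eq_zero _
  · have : p.1 = p.2 := (congrArg Prod.snd h)
    rw [this, ZMod.intCast_eq_zero_iff_even]
    exact hd _

theorem IsScaled.exists_form_eq {C : SimpleCartanDatum I} {d : ℚ} (hd : 0 < d) {v : I → ℤ}
    (hv : C.IsScaled d v) : ∃ z : ℤ, C.form v v = 2 * d * z := by
  choose f hf using hv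
  obtain ⟨z, hz⟩ := even_sum_of_symm (fun k l => f k * C.a k l * v l) (fun k l => by
    have h : d * (f k * C.a k l * v l : ℚ) = d * (f l * C.a l k * v k) := by
      rw [← mul_assoc, ← mul_assoc, ← hf k, ← mul_assoc, ← mul_assoc, ← hf l]
      have := C.symm k l
      linear_combination (v k * v l : ℚ) * this
    exact_mod_cast mul_left_cancel₀ hd.ne' h) (fun k => by
    rw [C.diag]
    exact ⟨f k * v k, by ring⟩)
  refine ⟨z, ?_⟩
  have hz' : (∑ k, ∑ l, (f k * C.a k l * v l : ℚ)) = z + z := by exact_mod_cast hz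
  have h2 : C.form v v = d * ∑ k, ∑ l, (f k * C.a k l * v l : ℚ) := by
    simp only [form, Finset.mul_sum]
    refine Finset.sum_congr rfl fun k _ => Finset.sum_congr rfl fun l _ => ?_
    rw [← mul_assoc, ← mul_assoc, ← hf k]
    ring
  rw [h2, hz']
  ring

theorem IsScaled.le_form {C : SimpleCartanDatum I} {d : ℚ} (hd : 0 < d) {v : I → ℤ}
    (hv : C.IsScaled d v) (h0 : v ≠ 0) : 2 * d ≤ C.form v v := by
  obtain ⟨z, hz⟩ := hv.exists_form_eq hd
  have hp := C.form_pos h0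
  rw [hz] at hp ⊢
  have hz0 : 0 < (z : ℚ) := by
    by_contra h
    push Not at h
    nlinarith
  have hz1 : (1 : ℚ) ≤ z := by exact_mod_cast (by exact_mod_cast hz0 : 0 < z)
  nlinarith

/-- A root is positive or negative: if both the positive part `P` and the negative part `N` of a
root `v = P - N` of length `2 d` were nonzero, then `(P, N) ≤ 0` would give
`(v, v) ≥ (P, P) + (N, N) ≥ 2 d + 2 d`. -/
theorem IsRoot.nonneg_or_nonpos {C : SimpleCartanDatum I} {v : I → ℤ} (hv : C.IsRoot v) :
    0 ≤ v ∨ v ≤ 0 := by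
  obtain ⟨w, i, hw⟩ := hv
  have hs : C.IsScaled (C.d i) v := hw ▸ C.isScaled_wordProd w i
  have hn : C.form v v = 2 * C.d i := by
    rw [hw, form_wordProd, form_simpleRoot, C.diag]
    push_cast
    ring
  have hd := C.d_pos i
  set p : I → ℤ := fun k => max (v k) 0 with hp
  set n : I → ℤ := fun k => max (-v k) 0 with hn'
  have hvpn : v = p - n := by
    ext k
    simp only [hp, hn', Pi.sub_apply]
    rcases le_total (v k) 0 with h | h
    · rw [max_eq_right h, max_eq_left (by omega)]; ring
    · rw [max_eq_left h, max_eq_right (by omega)]; ring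
  have hps : C.IsScaled (C.d i) p := by
    intro k
    obtain ⟨z, hz⟩ := hs k
    rcases le_total (v k) 0 with h | h
    · exact ⟨0, by simp [hp, h]⟩
    · exact ⟨z, by simp only [hp, max_eq_left h, hz]⟩
  have hns : C.IsScaled (C.d i) n := by
    intro k
    obtain ⟨z, hz⟩ := hs k
    rcases le_total (v k) 0 with h | h
    · refine ⟨-z, ?_⟩
      simp only [hn', max_eq_left (by omega : 0 ≤ -v k)]
      push_cast
      linarith
    · exact ⟨0, by simp [hn', h]⟩
  have hpn : C.form p n ≤ 0 := by
    refine Finset.sum_nonpos fun k _ => Finset.sum_nonpos fun l _ => ?_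
    have h1 : 0 ≤ p k := le_max_right _ _
    have h2 : 0 ≤ n l := le_max_right _ _
    by_cases hkl : k = l
    · subst hkl
      have : p k = 0 ∨ n k = 0 := by
        simp only [hp, hn']
        omega
      rcases this with h | h <;> simp [h]
    · have h3 : (C.a k l : ℚ) ≤ 0 := by exact_mod_cast C.off_diag k l hkl
      have h4 : (0 : ℚ) ≤ p k := by exact_mod_cast h1
      have h5 : (0 : ℚ) ≤ n l := by exact_mod_cast h2
      have h6 : C.d k * C.a k l ≤ 0 := mul_nonpos_of_nonneg_of_nonpos (C.d_pos k).le h3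
      exact mul_nonpos_of_nonpos_of_nonneg (mul_nonpos_of_nonpos_of_nonneg h6 h4) h5
  have key : C.form v v = C.form p p + C.form n n - 2 * C.form p n := by
    rw [hvpn, form_sub_left, form_sub_right, form_sub_right, C.form_comm n p]
    ring
  by_cases hp0 : p = 0
  · right
    intro k
    have := congrFun hp0 k
    simp only [hp, Pi.zero_apply] at this ⊢
    omega
  by_cases hn0 : n = 0
  · left
    intro k
    have := congrFun hn0 k
    simp only [hn', Pi.zero_apply] at this ⊢
    omega
  have h1 := hps.le_form hd hp0
  have h2 := hns.le_form hd hn0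
  linarith

theorem IsRoot.ne_zero {C : SimpleCartanDatum I} {v : I → ℤ} (hv : C.IsRoot v) : v ≠ 0 := by
  obtain ⟨w, i, rfl⟩ := hv
  intro h
  have h2 := C.form_wordProd w (simpleRoot i) (simpleRoot i)
  rw [h, form_simpleRoot, C.diag] at h2
  have := C.d_pos i
  simp [form] at h2
  linarith

theorem IsRoot.nonpos {C : SimpleCartanDatum I} {v : I → ℤ} (hv : C.IsRoot v) (h : ¬ 0 ≤ v) :
    v ≤ 0 := hv.nonneg_or_nonpos.resolve_left h

theorem IsRoot.not_nonneg_of_nonpos {C : SimpleCartanDatum I} {v : I → ℤ} (hv : C.IsRoot v)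
    (h : v ≤ 0) : ¬ 0 ≤ v := fun h' => hv.ne_zero (le_antisymm h h')

theorem IsRoot.neg {C : SimpleCartanDatum I} {v : I → ℤ} (hv : C.IsRoot v) : C.IsRoot (-v) := by
  obtain ⟨w, i, rfl⟩ := hv
  refine ⟨w ++ [i], i, ?_⟩
  rw [wordProd_append_apply, wordProd_cons_apply, wordProd_nil_apply, reflection_simpleRoot, map_neg]

theorem simpleRoot_nonneg (i : I) : 0 ≤ simpleRoot i := by
  simp [simpleRoot, Pi.single_nonneg]

/-- A simple reflection makes no positive root negative, except its own simple root: such a root is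
a multiple `c α_i`, and `c = 1` since both the root and its coroot have integral coordinates. -/
theorem IsRoot.eq_simpleRoot {C : SimpleCartanDatum I} {v : I → ℤ} (hv : C.IsRoot v) (i : I)
    (h : 0 ≤ v) (h' : ¬ 0 ≤ C.reflection i v) : v = simpleRoot i := by
  have hr : C.IsRoot (C.reflection i v) := hv.wordProd [i]
  have hle := hr.nonpos h'
  have h0 : ∀ k, k ≠ i → v k = 0 := by
    intro k hk
    have h1 := hle k
    rw [reflection_apply_of_ne C hk] at h1
    exact le_antisymm h1 (h k)
  have hvi : v = v i • simpleRoot i := by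
    ext k
    by_cases hk : k = i
    · simp [hk, simpleRoot]
    · simp [hk, simpleRoot, h0 k hk]
  obtain ⟨w, j, hw⟩ := hv
  have hn : C.form v v = 2 * C.d j := by
    rw [hw, form_wordProd, form_simpleRoot, C.diag]
    push_cast
    ring
  obtain ⟨z, hz⟩ := hw ▸ C.isScaled_wordProd w j i
  rw [hvi, form_smul_left, form_smul_right, form_simpleRoot, C.diag] at hn
  have hd := C.d_pos i
  have h1 : (v i * z : ℚ) = 1 := by
    have h2 : C.d i * (v i * z : ℚ) * v i = C.d i * v i := by
      push_cast at hn
      rw [hz]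
      linear_combination (z : ℚ) / 2 * hn
    have hvi0 : (v i : ℚ) ≠ 0 := by
      intro h3
      have : C.d j = 0 := by rw [h3] at hn; linarith
      exact (C.d_pos j).ne' this
    have h3 := mul_right_cancel₀ hvi0 (h2.trans (mul_comm _ _) |>.trans (mul_comm _ _))
    exact mul_left_cancel₀ hd.ne' (h3.trans (mul_one _).symm)
  have h2 : v i * z = 1 := by exact_mod_cast h1
  have h3 := Int.eq_one_or_neg_one_of_mul_eq_one h2
  have h4 := h i
  have : v i = 1 := by
    rcases h3 with h3 | h3
    · exact h3
    · rw [h3] at h4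
      simp at h4
  rw [hvi, this, one_smul]

/-! ### The exchange condition -/

theorem d_eq_of_wordProd (C : SimpleCartanDatum I) {y : List I} {i j : I}
    (h : C.wordProd y (simpleRoot i) = simpleRoot j) : C.d i = C.d j := by
  have h2 := C.form_wordProd y (simpleRoot i) (simpleRoot i)
  rw [h, form_simpleRoot, form_simpleRoot, C.diag, C.diag] at h2
  push_cast at h2
  linarith

/-- If `y` maps `α_i` to `α_j`, then it conjugates `s_i` to `s_j`. -/
theorem wordProd_reflection (C : SimpleCartanDatum I) {y : List I} {i j : I}
    (h : C.wordProd y (simpleRoot i) = simpleRoot j) (v : I → ℤ) :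
    C.wordProd y (C.reflection i v) = C.reflection j (C.wordProd y v) := by
  have h2 := C.form_wordProd y (simpleRoot i) v
  rw [h, form_simpleRoot_left, form_simpleRoot_left, C.d_eq_of_wordProd h] at h2
  have h3 : C.pairing j (C.wordProd y v) = C.pairing i v := by
    exact_mod_cast mul_left_cancel₀ (C.d_pos j).ne' h2
  rw [reflection_apply, reflection_apply, map_sub, map_smul, h, h3]

/-- A positive root which `w` makes negative has to become the simple root of some letter of `w`
just before that letter is applied. -/
theorem exists_split_of_not_nonneg (C : SimpleCartanDatum I) (w : List I) {v : I → ℤ}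
    (hv : C.IsRoot v) (h0 : 0 ≤ v) (h : ¬ 0 ≤ C.wordProd w v) :
    ∃ (x y : List I) (j : I), w = x ++ j :: y ∧ C.wordProd y v = simpleRoot j := by
  induction w with
  | nil => exact absurd h0 h
  | cons k w ih =>
    by_cases h1 : 0 ≤ C.wordProd w v
    · exact ⟨[], w, k, rfl, (hv.wordProd w).eq_simpleRoot k h1 h⟩
    · obtain ⟨x, y, j, rfl, hj⟩ := ih h1
      exact ⟨k :: x, y, j, rfl, hj⟩

/-- The exchange of a letter for one at the end of the word. -/
theorem wordProd_delete (C : SimpleCartanDatum I) {x y : List I} {i j : I}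
    (h : C.wordProd y (simpleRoot i) = simpleRoot j) :
    C.wordProd (x ++ j :: y ++ [i]) = C.wordProd (x ++ y) := by
  refine LinearMap.ext fun v => ?_
  rw [wordProd_append_apply, wordProd_append_apply, wordProd_append_apply, wordProd_cons_apply,
    wordProd_cons_apply, wordProd_nil_apply, C.wordProd_reflection h, reflection_reflection]

theorem wordProd_append_twice (C : SimpleCartanDatum I) (x : List I) (i : I) :
    C.wordProd (x ++ [i] ++ [i]) = C.wordProd x := by
  refine LinearMap.ext fun v => ?_
  simp only [wordProd_append_apply, wordProd_cons_apply, wordProd_nil_apply,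
    reflection_reflection]

/-! ### Reduced words -/

theorem wordProd_reverse_congr (C : SimpleCartanDatum I) {u w : List I}
    (h : C.wordProd u = C.wordProd w) : C.wordProd u.reverse = C.wordProd w.reverse := by
  refine LinearMap.ext fun v => C.wordProd_injective u ?_
  rw [wordProd_mul_reverse, h, wordProd_mul_reverse]

theorem IsReduced.reverse {C : SimpleCartanDatum I} {w : List I} (hw : C.IsReduced w) :
    C.IsReduced w.reverse := by
  intro u hu
  have h := C.wordProd_reverse_congr hu
  rw [List.reverse_reverse] at h
  have := hw _ h
  simpa using this

theorem IsReduced.left {C : SimpleCartanDatum I} {x y : List I} (hw : C.IsReduced (x ++ y)) :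
    C.IsReduced x := by
  intro u hu
  have := hw (u ++ y) (by rw [wordProd_append, hu, wordProd_append])
  simpa using this

theorem IsReduced.right {C : SimpleCartanDatum I} {x y : List I} (hw : C.IsReduced (x ++ y)) :
    C.IsReduced y := by
  intro u hu
  have := hw (x ++ u) (by rw [wordProd_append, hu, wordProd_append])
  simpa using this

theorem IsReduced.congr {C : SimpleCartanDatum I} {w u : List I} (hw : C.IsReduced w)
    (h : C.wordProd u = C.wordProd w) (hl : u.length = w.length) : C.IsReduced u :=
  fun z hz => hl ▸ hw z (hz.trans h)

/-- Otherwise deleting a letter of `x` together with `i` would give a shorter word. -/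
theorem IsReduced.nonneg {C : SimpleCartanDatum I} {x : List I} {i : I}
    (hw : C.IsReduced (x ++ [i])) : 0 ≤ C.wordProd x (simpleRoot i) := by
  by_contra h
  obtain ⟨u, y, j, rfl, hj⟩ :=
    C.exists_split_of_not_nonneg x (C.isRoot_simpleRoot i) (simpleRoot_nonneg i) h
  have h2 := hw (u ++ y) (C.wordProd_delete hj).symm
  simp at h2

theorem IsReduced.nonneg_reverse {C : SimpleCartanDatum I} {y : List I} {i : I}
    (hw : C.IsReduced (i :: y)) : 0 ≤ C.wordProd y.reverse (simpleRoot i) := by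
  have := hw.reverse
  rw [List.reverse_cons] at this
  exact this.nonneg

/-- A right descent can be moved to the end of a reduced word. -/
theorem IsReduced.exists_descent {C : SimpleCartanDatum I} {w : List I} (hw : C.IsReduced w)
    {i : I} (h : ¬ 0 ≤ C.wordProd w (simpleRoot i)) :
    ∃ u : List I, C.IsReduced (u ++ [i]) ∧ C.wordProd (u ++ [i]) = C.wordProd w ∧
      (u ++ [i]).length = w.length := by
  obtain ⟨x, y, j, rfl, hj⟩ :=
    C.exists_split_of_not_nonneg w (C.isRoot_simpleRoot i) (simpleRoot_nonneg i) h
  have h1 : C.wordProd (x ++ y ++ [i]) = C.wordProd (x ++ j :: y) := by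
    rw [wordProd_append, ← C.wordProd_delete hj, ← wordProd_append, wordProd_append_twice]
  have h2 : (x ++ y ++ [i]).length = (x ++ j :: y).length := by
    simp only [List.length_append, List.length_cons, List.length_nil]
    omega
  exact ⟨x ++ y, hw.congr h1 h2, h1, h2⟩

theorem IsReduced.length_eq {C : SimpleCartanDatum I} {w u : List I} (hw : C.IsReduced w)
    (hu : C.IsReduced u) (h : C.wordProd u = C.wordProd w) : u.length = w.length :=
  le_antisymm (hu _ h.symm) (hw _ h)

/-! ### Rank two -/

/-- The vector `p α_i + q α_j`. -/
def comb (i j : I) (p q : ℤ) : I → ℤ := p • simpleRoot i + q • simpleRoot j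

theorem simpleRoot_eq_comb_left (i j : I) : simpleRoot i = comb i j 1 0 := by simp [comb]

theorem simpleRoot_eq_comb_right (i j : I) : simpleRoot j = comb i j 0 1 := by simp [comb]

theorem comb_apply_left {i j : I} (hij : i ≠ j) (p q : ℤ) : comb i j p q i = p := by
  simp [comb, simpleRoot, hij]

theorem comb_apply_right {i j : I} (hij : i ≠ j) (p q : ℤ) : comb i j p q j = q := by
  simp [comb, simpleRoot, hij.symm]

theorem comb_apply_of_ne {i j k : I} (hi : k ≠ i) (hj : k ≠ j) (p q : ℤ) :
    comb i j p q k = 0 := by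
  simp [comb, simpleRoot, hi, hj]

theorem reflection_add_comb_left (C : SimpleCartanDatum I) (i j : I) (v : I → ℤ) (p q : ℤ) :
    C.reflection i (v + comb i j p q) = v + comb i j (-p - C.a i j * q - C.pairing i v) q := by
  rw [reflection_apply, pairing_add, comb, pairing_add, pairing_smul, pairing_smul,
    pairing_simpleRoot, pairing_simpleRoot, C.diag, comb]
  module

theorem reflection_add_comb_right (C : SimpleCartanDatum I) (i j : I) (v : I → ℤ) (p q : ℤ) :
    C.reflection j (v + comb i j p q) = v + comb i j p (-q - C.a j i * p - C.pairing j v) := by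
  rw [reflection_apply, pairing_add, comb, pairing_add, pairing_smul, pairing_smul,
    pairing_simpleRoot, pairing_simpleRoot, C.diag, comb]
  module

theorem reflection_comb_left (C : SimpleCartanDatum I) (i j : I) (p q : ℤ) :
    C.reflection i (comb i j p q) = comb i j (-p - C.a i j * q) q := by
  simpa [pairing] using C.reflection_add_comb_left i j 0 p q

theorem reflection_comb_right (C : SimpleCartanDatum I) (i j : I) (p q : ℤ) :
    C.reflection j (comb i j p q) = comb i j p (-q - C.a j i * p) := by
  simpa [pairing] using C.reflection_add_comb_right i j 0 p q

theorem eq_add_comb_zero (i j : I) (v : I → ℤ) : v = v + comb i j 0 0 := by simp [comb]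

theorem a_eq_zero_comm (C : SimpleCartanDatum I) {i j : I} (h : C.a i j = 0) : C.a j i = 0 := by
  have h1 := C.symm i j
  rw [h] at h1
  have h2 : C.d j * C.a j i = 0 := by rw [← h1]; simp
  exact_mod_cast (mul_eq_zero.mp h2).resolve_left (C.d_pos j).ne'

/-- The possible pairs of Cartan integers of two distinct simple roots. -/
theorem cartan_cases (C : SimpleCartanDatum I) {i j : I} (hij : i ≠ j) :
    (C.a i j = 0 ∧ C.a j i = 0) ∨ (C.a i j = -1 ∧ C.a j i = -1) ∨
      (C.a i j = -1 ∧ C.a j i = -2) ∨ (C.a i j = -2 ∧ C.a j i = -1) ∨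
      (C.a i j = -1 ∧ C.a j i = -3) ∨ (C.a i j = -3 ∧ C.a j i = -1) := by
  by_cases h0 : C.a i j = 0
  · exact Or.inl ⟨h0, C.a_eq_zero_comm h0⟩
  have h0' : C.a j i ≠ 0 := fun h => h0 (C.a_eq_zero_comm h)
  have h1 := C.off_diag i j hij
  have h2 := C.off_diag j i hij.symm
  -- the form is positive at `-a_{ij} α_i + 2 α_j`, which gives `a_{ij} a_{ji} < 4`
  have hne : comb i j (-C.a i j) 2 ≠ 0 := by
    intro h
    have := congrFun h j
    rw [comb_apply_right hij] at this
    simp at this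
  have hp := C.form_pos hne
  rw [comb, form_add_right, C.form_comm _ (_ • simpleRoot i), C.form_comm _ (_ • simpleRoot j),
    form_add_right, form_add_right] at hp
  simp only [form_smul_left, form_smul_right, form_simpleRoot, C.diag] at hp
  have hs := C.symm i j
  have hd := C.d_pos j
  push_cast at hp
  have h3 : 0 < C.d j * (4 - C.a i j * C.a j i) := by
    have e : C.d i * C.a i j * C.a i j = C.d j * C.a j i * C.a i j := by rw [hs]
    rw [← hs] at hp
    nlinarith
  have h4 : (0 : ℚ) < 4 - C.a i j * C.a j i := pos_of_mul_pos_right h3 hd.le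
  have h5 : C.a i j * C.a j i < 4 := by
    have : ((C.a i j * C.a j i : ℤ) : ℚ) < 4 := by push_cast; linarith
    exact_mod_cast this
  generalize C.a i j = a at *
  generalize C.a j i = b at *
  have ha : -4 < a := by nlinarith [show b ≤ -1 by omega]
  have hb : -4 < b := by nlinarith [show a ≤ -1 by omega]
  interval_cases a <;> interval_cases b <;> simp_all

/-- In rank two the claim is a computation of `u v`, with the unknown integers `⟨α_i^∨, v⟩` and
`⟨α_j^∨, v⟩`. -/
theorem Move.wordProd_eq {C : SimpleCartanDatum I} {w w' : List I} (m : C.Move w w') :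
    C.wordProd w = C.wordProd w' := by
  have key : ∀ {x y u u' : List I} {i j : I}, (∀ v : I → ℤ, C.wordProd u (v + comb i j 0 0) =
      C.wordProd u' (v + comb i j 0 0)) → C.wordProd (x ++ u ++ y) = C.wordProd (x ++ u' ++ y) := by
    intro x y u u' i j h
    refine LinearMap.ext fun v => ?_
    have h2 := h (C.wordProd y v)
    rw [← eq_add_comb_zero] at h2
    simp only [wordProd_append_apply, h2]
  cases m with
  | swap x y i j hij h =>
    refine key (i := i) (j := j) fun v => ?_
    simp only [wordProd_cons_apply, wordProd_nil_apply, reflection_add_comb_left,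
      reflection_add_comb_right, h, C.a_eq_zero_comm h]
    congr 2 <;> ring
  | simply x y i j hij h h' =>
    refine key (i := i) (j := j) fun v => ?_
    simp only [wordProd_cons_apply, wordProd_nil_apply, reflection_add_comb_left,
      reflection_add_comb_right, h, h']
    congr 2 <;> ring
  | doubly x y i j hij h h' =>
    refine key (i := i) (j := j) fun v => ?_
    simp only [wordProd_cons_apply, wordProd_nil_apply, reflection_add_comb_left,
      reflection_add_comb_right, h, h']
    congr 2 <;> ring
  | doublyInv x y i j hij h h' =>
    refine key (i := i) (j := j) fun v => ?_
    simp only [wordProd_cons_apply, wordProd_nil_apply, reflection_add_comb_left,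
      reflection_add_comb_right, h, h']
    congr 2 <;> ring
  | triply x y i j hij h h' =>
    refine key (i := i) (j := j) fun v => ?_
    simp only [wordProd_cons_apply, wordProd_nil_apply, reflection_add_comb_left,
      reflection_add_comb_right, h, h']
    congr 2 <;> ring
  | triplyInv x y i j hij h h' =>
    refine key (i := i) (j := j) fun v => ?_
    simp only [wordProd_cons_apply, wordProd_nil_apply, reflection_add_comb_left,
      reflection_add_comb_right, h, h']
    congr 2 <;> ring

theorem Move.length_eq {C : SimpleCartanDatum I} {w w' : List I} (m : C.Move w w') :
    w.length = w'.length := by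
  cases m <;> simp

theorem Move.isReduced {C : SimpleCartanDatum I} {w w' : List I} (m : C.Move w w')
    (hw : C.IsReduced w) : C.IsReduced w' :=
  hw.congr m.wordProd_eq.symm m.length_eq.symm

theorem Move.isReduced_left {C : SimpleCartanDatum I} {w w' : List I} (m : C.Move w w')
    (hw : C.IsReduced w') : C.IsReduced w :=
  hw.congr m.wordProd_eq m.length_eq

/-! ### Reduced words of an element are connected by changes of words -/

theorem nonempty_move_append {C : SimpleCartanDatum I} {w w' : List I} (m : C.Move w w')
    (z : List I) : Nonempty (C.Move (w ++ z) (w' ++ z)) := by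
  cases m with
  | swap x y i j hij h => exact ⟨by simpa using Move.swap x (y ++ z) i j hij h⟩
  | simply x y i j hij h h' => exact ⟨by simpa using Move.simply x (y ++ z) i j hij h h'⟩
  | doubly x y i j hij h h' => exact ⟨by simpa using Move.doubly x (y ++ z) i j hij h h'⟩
  | doublyInv x y i j hij h h' => exact ⟨by simpa using Move.doublyInv x (y ++ z) i j hij h h'⟩
  | triply x y i j hij h h' => exact ⟨by simpa using Move.triply x (y ++ z) i j hij h h'⟩
  | triplyInv x y i j hij h h' => exact ⟨by simpa using Move.triplyInv x (y ++ z) i j hij h h'⟩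

theorem nonempty_wordChange_append {C : SimpleCartanDatum I} {w w' : List I}
    (M : C.WordChange w w') (z : List I) : Nonempty (C.WordChange (w ++ z) (w' ++ z)) := by
  induction M with
  | nil w => exact ⟨.nil _⟩
  | cons m M ih =>
    obtain ⟨m'⟩ := nonempty_move_append m z
    obtain ⟨M'⟩ := ih
    exact ⟨.cons m' M'⟩

theorem nonempty_wordChange_trans {C : SimpleCartanDatum I} {w w' w'' : List I}
    (M : C.WordChange w w') (N : C.WordChange w' w'') : Nonempty (C.WordChange w w'') := by
  induction M with
  | nil w => exact ⟨N⟩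
  | cons m M ih =>
    obtain ⟨M'⟩ := ih N
    exact ⟨.cons m M'⟩

/-- If `α_i` and `α_j` are made negative by `w`, and `w` has a reduced word ending in `b`, then it
has one ending in `l :: b` as long as `b⁻¹ α_l` is a positive combination of `α_i` and `α_j`. -/
theorem exists_reduced_append_cons {C : SimpleCartanDatum I} {w b : List I} {i j l : I}
    (hi : ¬ 0 ≤ C.wordProd w (simpleRoot i)) (hj : ¬ 0 ≤ C.wordProd w (simpleRoot j))
    (hb : ∃ x, C.IsReduced (x ++ b) ∧ C.wordProd (x ++ b) = C.wordProd w) {p q : ℤ}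
    (hp : 0 ≤ p) (hq : 0 ≤ q) (h : C.wordProd b.reverse (simpleRoot l) = comb i j p q) :
    ∃ x, C.IsReduced (x ++ l :: b) ∧ C.wordProd (x ++ l :: b) = C.wordProd w := by
  obtain ⟨x, hx, hxw⟩ := hb
  have h1 : C.wordProd x (simpleRoot l) =
      p • C.wordProd w (simpleRoot i) + q • C.wordProd w (simpleRoot j) := by
    rw [← map_zsmul, ← map_zsmul, ← map_add, ← comb, ← h, ← hxw, wordProd_append_apply,
      wordProd_mul_reverse]
  have h2 : ¬ 0 ≤ C.wordProd x (simpleRoot l) := by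
    refine (C.isRoot_wordProd x l).not_nonneg_of_nonpos ?_
    rw [h1]
    exact add_nonpos (smul_nonpos_of_nonneg_of_nonpos hp ((C.isRoot_wordProd w i).nonpos hi))
      (smul_nonpos_of_nonneg_of_nonpos hq ((C.isRoot_wordProd w j).nonpos hj))
  obtain ⟨u, -, hu, hl⟩ := hx.left.exists_descent h2
  have h3 : C.wordProd (u ++ l :: b) = C.wordProd (x ++ b) := by
    rw [List.append_cons, wordProd_append, hu, wordProd_append]
  refine ⟨u, hx.congr h3 ?_, h3.trans hxw⟩
  simp at hl ⊢
  omega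

/-- Two right descents `i`, `j` of an element give reduced words of it that end in the two
alternating words in `i` and `j` which a change of words connects. -/
theorem exists_move_of_descents (C : SimpleCartanDatum I) {i j : I} (hij : i ≠ j) :
    ∃ u v : List I, (∀ x, Nonempty (C.Move (x ++ u ++ [i]) (x ++ v ++ [j]))) ∧
      ∀ w, C.IsReduced w → ¬ 0 ≤ C.wordProd w (simpleRoot i) →
        ¬ 0 ≤ C.wordProd w (simpleRoot j) →
        ∃ x, C.IsReduced (x ++ u ++ [i]) ∧ C.wordProd (x ++ u ++ [i]) = C.wordProd w := by
  have h0 : ∀ w, C.IsReduced w →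
      ∃ x, C.IsReduced (x ++ []) ∧ C.wordProd (x ++ []) = C.wordProd w :=
    fun w hw => ⟨w, by simpa using hw, by simp⟩
  have e1 : ∀ {w}, ¬ 0 ≤ C.wordProd w (simpleRoot i) → ¬ 0 ≤ C.wordProd w (simpleRoot j) →
      ∀ {b}, (∃ x, C.IsReduced (x ++ b) ∧ C.wordProd (x ++ b) = C.wordProd w) →
      ∀ l p q, 0 ≤ p ∧ 0 ≤ q → C.wordProd b.reverse (simpleRoot l) = comb i j p q →
      ∃ x, C.IsReduced (x ++ l :: b) ∧ C.wordProd (x ++ l :: b) = C.wordProd w :=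
    fun hi hj _ hb l p q hpq h => exists_reduced_append_cons hi hj hb hpq.1 hpq.2 h
  have hji := hij.symm
  -- the coefficients `p`, `q` run through the positive roots `p α_i + q α_j`
  rcases C.cartan_cases hij with ⟨h, h'⟩ | ⟨h, h'⟩ | ⟨h, h'⟩ | ⟨h, h'⟩ | ⟨h, h'⟩ | ⟨h, h'⟩
  · refine ⟨[j], [i], fun x => ⟨by simpa using Move.swap x [] j i hji h'⟩, fun w hw hi hj => ?_⟩
    simp only [List.append_assoc, List.cons_append, List.nil_append]
    have s1 := e1 hi hj (h0 w hw) i 1 0 (by decide) (by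
      simp [simpleRoot_eq_comb_left i j, simpleRoot_eq_comb_right i j, reflection_comb_left,
        reflection_comb_right, h, h'])
    exact e1 hi hj s1 j 0 1 (by decide) (by
      simp [simpleRoot_eq_comb_left i j, simpleRoot_eq_comb_right i j, reflection_comb_left,
        reflection_comb_right, h, h'])
  · refine ⟨[i, j], [j, i], fun x => ⟨by simpa using Move.simply x [] i j hij h h'⟩,
      fun w hw hi hj => ?_⟩
    simp only [List.append_assoc, List.cons_append, List.nil_append]
    have s1 := e1 hi hj (h0 w hw) i 1 0 (by decide) (by
      simp [simpleRoot_eq_comb_left i j, simpleRoot_eq_comb_right i j, reflection_comb_left,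
        reflection_comb_right, h, h'])
    have s2 := e1 hi hj s1 j 1 1 (by decide) (by
      simp [simpleRoot_eq_comb_left i j, simpleRoot_eq_comb_right i j, reflection_comb_left,
        reflection_comb_right, h, h'])
    exact e1 hi hj s2 i 0 1 (by decide) (by
      simp [simpleRoot_eq_comb_left i j, simpleRoot_eq_comb_right i j, reflection_comb_left,
        reflection_comb_right, h, h'])
  · refine ⟨[j, i, j], [i, j, i], fun x => ⟨by simpa using Move.doublyInv x [] i j hij h h'⟩,
      fun w hw hi hj => ?_⟩
    simp only [List.append_assoc, List.cons_append, List.nil_append]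
    have s1 := e1 hi hj (h0 w hw) i 1 0 (by decide) (by
      simp [simpleRoot_eq_comb_left i j, simpleRoot_eq_comb_right i j, reflection_comb_left,
        reflection_comb_right, h, h'])
    have s2 := e1 hi hj s1 j 1 1 (by decide) (by
      simp [simpleRoot_eq_comb_left i j, simpleRoot_eq_comb_right i j, reflection_comb_left,
        reflection_comb_right, h, h'])
    have s3 := e1 hi hj s2 i 1 2 (by decide) (by
      simp [simpleRoot_eq_comb_left i j, simpleRoot_eq_comb_right i j, reflection_comb_left,
        reflection_comb_right, h, h'])
    exact e1 hi hj s3 j 0 1 (by decide) (by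
      simp [simpleRoot_eq_comb_left i j, simpleRoot_eq_comb_right i j, reflection_comb_left,
        reflection_comb_right, h, h'])
  · refine ⟨[j, i, j], [i, j, i], fun x => ⟨by simpa using Move.doubly x [] j i hji h' h⟩,
      fun w hw hi hj => ?_⟩
    simp only [List.append_assoc, List.cons_append, List.nil_append]
    have s1 := e1 hi hj (h0 w hw) i 1 0 (by decide) (by
      simp [simpleRoot_eq_comb_left i j, simpleRoot_eq_comb_right i j, reflection_comb_left,
        reflection_comb_right, h, h'])
    have s2 := e1 hi hj s1 j 2 1 (by decide) (by
      simp [simpleRoot_eq_comb_left i j, simpleRoot_eq_comb_right i j, reflection_comb_left,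
        reflection_comb_right, h, h'])
    have s3 := e1 hi hj s2 i 1 1 (by decide) (by
      simp [simpleRoot_eq_comb_left i j, simpleRoot_eq_comb_right i j, reflection_comb_left,
        reflection_comb_right, h, h'])
    exact e1 hi hj s3 j 0 1 (by decide) (by
      simp [simpleRoot_eq_comb_left i j, simpleRoot_eq_comb_right i j, reflection_comb_left,
        reflection_comb_right, h, h'])
  · refine ⟨[j, i, j, i, j], [i, j, i, j, i], fun x => ⟨by simpa using Move.triply x [] i j hij h h'⟩,
      fun w hw hi hj => ?_⟩
    simp only [List.append_assoc, List.cons_append, List.nil_append]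
    have s1 := e1 hi hj (h0 w hw) i 1 0 (by decide) (by
      simp [simpleRoot_eq_comb_left i j, simpleRoot_eq_comb_right i j, reflection_comb_left,
        reflection_comb_right, h, h'])
    have s2 := e1 hi hj s1 j 1 1 (by decide) (by
      simp [simpleRoot_eq_comb_left i j, simpleRoot_eq_comb_right i j, reflection_comb_left,
        reflection_comb_right, h, h'])
    have s3 := e1 hi hj s2 i 2 3 (by decide) (by
      simp [simpleRoot_eq_comb_left i j, simpleRoot_eq_comb_right i j, reflection_comb_left,
        reflection_comb_right, h, h'])
    have s4 := e1 hi hj s3 j 1 2 (by decide) (by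
      simp [simpleRoot_eq_comb_left i j, simpleRoot_eq_comb_right i j, reflection_comb_left,
        reflection_comb_right, h, h'])
    have s5 := e1 hi hj s4 i 1 3 (by decide) (by
      simp [simpleRoot_eq_comb_left i j, simpleRoot_eq_comb_right i j, reflection_comb_left,
        reflection_comb_right, h, h'])
    exact e1 hi hj s5 j 0 1 (by decide) (by
      simp [simpleRoot_eq_comb_left i j, simpleRoot_eq_comb_right i j, reflection_comb_left,
        reflection_comb_right, h, h'])
  · refine ⟨[j, i, j, i, j], [i, j, i, j, i], fun x => ⟨by simpa using Move.triplyInv x [] j i hji h' h⟩,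
      fun w hw hi hj => ?_⟩
    simp only [List.append_assoc, List.cons_append, List.nil_append]
    have s1 := e1 hi hj (h0 w hw) i 1 0 (by decide) (by
      simp [simpleRoot_eq_comb_left i j, simpleRoot_eq_comb_right i j, reflection_comb_left,
        reflection_comb_right, h, h'])
    have s2 := e1 hi hj s1 j 3 1 (by decide) (by
      simp [simpleRoot_eq_comb_left i j, simpleRoot_eq_comb_right i j, reflection_comb_left,
        reflection_comb_right, h, h'])
    have s3 := e1 hi hj s2 i 2 1 (by decide) (by
      simp [simpleRoot_eq_comb_left i j, simpleRoot_eq_comb_right i j, reflection_comb_left,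
        reflection_comb_right, h, h'])
    have s4 := e1 hi hj s3 j 3 2 (by decide) (by
      simp [simpleRoot_eq_comb_left i j, simpleRoot_eq_comb_right i j, reflection_comb_left,
        reflection_comb_right, h, h'])
    have s5 := e1 hi hj s4 i 1 1 (by decide) (by
      simp [simpleRoot_eq_comb_left i j, simpleRoot_eq_comb_right i j, reflection_comb_left,
        reflection_comb_right, h, h'])
    exact e1 hi hj s5 j 0 1 (by decide) (by
      simp [simpleRoot_eq_comb_left i j, simpleRoot_eq_comb_right i j, reflection_comb_left,
        reflection_comb_right, h, h'])

/-- Two reduced words of the same element of the Weyl group are connected by changes of words. By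
induction, words with the same last letter are connected; for last letters `i ≠ j`, one passes
through two words that end in alternating words in `i` and `j`. -/
theorem nonempty_wordChange (C : SimpleCartanDatum I) {w w' : List I} (hw : C.IsReduced w)
    (hw' : C.IsReduced w') (h : C.wordProd w = C.wordProd w') :
    Nonempty (C.WordChange w w') := by
  induction hn : w.length generalizing w w' with
  | zero =>
    have h1 := hw.length_eq hw' h.symm
    rw [List.length_eq_zero_iff.mp hn, List.length_eq_zero_iff.mp (h1.trans hn)]
    exact ⟨.nil _⟩
  | succ n ih =>
    have step : ∀ {x x' : List I} {i : I}, C.IsReduced (x ++ [i]) → C.IsReduced (x' ++ [i]) →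
        C.wordProd (x ++ [i]) = C.wordProd (x' ++ [i]) → (x ++ [i]).length = n + 1 →
        Nonempty (C.WordChange (x ++ [i]) (x' ++ [i])) := by
      intro x x' i hx hx' hp hl
      have h1 : C.wordProd x = C.wordProd x' := by
        rw [← C.wordProd_append_twice x i, wordProd_append, hp, ← wordProd_append,
          wordProd_append_twice]
      obtain ⟨M⟩ := ih hx.left hx'.left h1 (by simpa using hl)
      exact nonempty_wordChange_append M [i]
    have hn' := (hw.length_eq hw' h.symm).trans hn
    obtain ⟨x, i, rfl⟩ := (List.eq_nil_or_concat' w).resolve_left (by rintro rfl; simp at hn)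
    obtain ⟨x', j, rfl⟩ := (List.eq_nil_or_concat' w').resolve_left (by rintro rfl; simp at hn')
    have neg : ∀ (z : List I) (k : I), C.IsReduced (z ++ [k]) →
        ¬ 0 ≤ C.wordProd (z ++ [k]) (simpleRoot k) := by
      intro z k hz h0
      rw [wordProd_append_apply, wordProd_cons_apply, wordProd_nil_apply, reflection_simpleRoot,
        map_neg] at h0
      exact (C.isRoot_wordProd z k).ne_zero (le_antisymm (neg_nonneg.mp h0) hz.nonneg)
    by_cases hij : i = j
    · subst hij
      exact step hw hw' h hn
    · obtain ⟨u, v, hm, hd⟩ := C.exists_move_of_descents hij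
      obtain ⟨z, hz, hzp⟩ := hd _ hw (neg x i hw) (by rw [h]; exact neg x' j hw')
      obtain ⟨m⟩ := hm z
      obtain ⟨M⟩ := step hw hz hzp.symm hn
      have hz' := m.isReduced hz
      have hzp' : C.wordProd (z ++ v ++ [j]) = C.wordProd (x' ++ [j]) :=
        (m.wordProd_eq.symm.trans hzp).trans h
      obtain ⟨N⟩ := step hz' hw' hzp' ((hw'.length_eq hz' hzp').trans hn')
      exact nonempty_wordChange_trans M (.cons m N)

end SimpleCartanDatum

/-! ### Sums over the letters of a word -/

section SplitSum

variable {I : Type*}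

/-- The sum of `F x j y` over all decompositions `w = x ++ j :: y` of a word `w`. -/
def splitSum (F : List I → I → List I → ℚ) : List I → ℚ
  | [] => 0
  | j :: y => F [] j y + splitSum (fun x => F (j :: x)) y

theorem splitSum_append (F : List I → I → List I → ℚ) (u v : List I) :
    splitSum F (u ++ v) =
      splitSum (fun x j y => F x j (y ++ v)) u + splitSum (fun x => F (u ++ x)) v := by
  induction u generalizing F with
  | nil => simp [splitSum]
  | cons j u ih =>
    simp only [List.cons_append, splitSum, ih]
    ring

theorem splitSum_reverse (F : List I → I → List I → ℚ) (w : List I) :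
    splitSum F w.reverse = splitSum (fun x j y => F y.reverse j x.reverse) w := by
  induction w generalizing F with
  | nil => rfl
  | cons j w ih =>
    rw [List.reverse_cons, splitSum_append, ih]
    simp [splitSum, add_comm]

theorem splitSum_map {J : Type*} (g : I → J) (F : List J → J → List J → ℚ) (w : List I) :
    splitSum F (w.map g) = splitSum (fun x j y => F (x.map g) (g j) (y.map g)) w := by
  induction w generalizing F with
  | nil => rfl
  | cons j w ih => simp only [List.map_cons, splitSum, ih, List.map_nil]

theorem splitSum_congr {F G : List I → I → List I → ℚ} {w : List I}
    (h : ∀ x j y, w = x ++ j :: y → F x j y = G x j y) : splitSum F w = splitSum G w := by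
  induction w generalizing F G with
  | nil => rfl
  | cons j w ih =>
    simp only [splitSum]
    rw [h [] j w rfl, ih fun x k y hw => h (j :: x) k y (by rw [hw]; rfl)]

theorem splitSum_zero (w : List I) : splitSum (fun _ _ _ => 0) w = 0 := by
  induction w with
  | nil => rfl
  | cons j w ih => simp [splitSum, ih]

theorem splitSum_eq_zero {F : List I → I → List I → ℚ} {w : List I}
    (h : ∀ x j y, w = x ++ j :: y → F x j y = 0) : splitSum F w = 0 :=
  (splitSum_congr h).trans (splitSum_zero w)

theorem splitSum_add (F G : List I → I → List I → ℚ) (w : List I) :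
    splitSum (fun x j y => F x j y + G x j y) w = splitSum F w + splitSum G w := by
  induction w generalizing F G with
  | nil => simp [splitSum]
  | cons j w ih =>
    simp only [splitSum, ih]
    ring

theorem splitSum_neg (F : List I → I → List I → ℚ) (w : List I) :
    splitSum (fun x j y => -F x j y) w = -splitSum F w := by
  induction w generalizing F with
  | nil => simp [splitSum]
  | cons j w ih =>
    simp only [splitSum, ih]
    ring

theorem splitSum_sum {J : Type*} (s : Finset J) (F : J → List I → I → List I → ℚ) (w : List I) :
    splitSum (fun x j y => ∑ i ∈ s, F i x j y) w = ∑ i ∈ s, splitSum (F i) w := by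
  induction w generalizing F with
  | nil => simp [splitSum]
  | cons j w ih => simp only [splitSum, ih, Finset.sum_add_distrib]

theorem splitSum_eq_single {F : List I → I → List I → ℚ} {x y : List I} {j : I}
    (h : ∀ x' j' y', x ++ j :: y = x' ++ j' :: y' → x'.length ≠ x.length → F x' j' y' = 0) :
    splitSum F (x ++ j :: y) = F x j y := by
  rw [splitSum_append, splitSum]
  rw [splitSum_eq_zero, splitSum_eq_zero]
  · simp
  · rintro x' j' y' rfl
    refine h _ j' y' (by simp) ?_
    simp
  · rintro x' j' y' rfl
    refine h _ j' _ (by simp) ?_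
    simp

theorem splitSum_ite_left_nil (F : List I → I → List I → ℚ) [∀ x : List I, Decidable (x = [])]
    (g : I) (t : List I) :
    splitSum (fun x j y => if x = [] then F x j y else 0) (g :: t) = F [] g t := by
  simp [splitSum, splitSum_zero]

theorem splitSum_ite_right_nil (F : List I → I → List I → ℚ) [∀ x : List I, Decidable (x = [])]
    (v : List I) (l : I) :
    splitSum (fun x j y => if y = [] then F x j y else 0) (v ++ [l]) = F v l [] := by
  simp [splitSum_append, splitSum, splitSum_zero]

end SplitSum

namespace SimpleCartanDatum

variable {I : Type*} [Fintype I] [DecidableEq I]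

/-! ### Initial terms and simple roots -/

/-- The letter at position `p` of the word `w = x ++ j :: y` gives the simple root `α_i`, that is,
`y⁻¹ α_j = α_i` in the sequence of positive roots made negative by `w`. -/
def SimplePos (C : SimpleCartanDatum I) (w : List I) (i : I) (p : ℕ) : Prop :=
  ∃ (x y : List I) (j : I), w = x ++ j :: y ∧ x.length = p ∧
    C.wordProd y (simpleRoot i) = simpleRoot j

/-- In a reduced word, a simple root that is negated by a letter does not become simple again. -/
theorem not_wordProd_of_reduced {C : SimpleCartanDatum I} {m y : List I} {i j k : I}
    (hm : C.IsReduced (m ++ [k])) (hy : C.wordProd y (simpleRoot i) = simpleRoot k)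
    (h : C.wordProd (m ++ k :: y) (simpleRoot i) = simpleRoot j) : False := by
  rw [wordProd_append_apply, wordProd_cons_apply, hy, reflection_simpleRoot, map_neg] at h
  have h1 := simpleRoot_nonneg j
  rw [← h] at h1
  exact (C.isRoot_wordProd m k).ne_zero (le_antisymm (neg_nonneg.mp h1) hm.nonneg)

/-- A simple root appears at most once among the roots made negative by a reduced word. -/
theorem split_length_unique {C : SimpleCartanDatum I} {x y x' y' : List I} {i j j' : I}
    (hw : C.IsReduced (x ++ j :: y)) (h : x ++ j :: y = x' ++ j' :: y')
    (hy : C.wordProd y (simpleRoot i) = simpleRoot j)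
    (hy' : C.wordProd y' (simpleRoot i) = simpleRoot j') : x.length = x'.length := by
  have key : ∀ {x y x' y' : List I} {j j' : I}, C.IsReduced (x ++ j :: y) →
      x ++ j :: y = x' ++ j' :: y' → C.wordProd y (simpleRoot i) = simpleRoot j →
      C.wordProd y' (simpleRoot i) = simpleRoot j' → ¬ x.length < x'.length := by
    intro x y x' y' j j' hw h hy hy' hl
    rcases List.append_eq_append_iff.mp h with ⟨a, ha, hb⟩ | ⟨a, ha, hb⟩
    · cases a with
      | nil => simp [ha] at hl
      | cons b m =>
        rw [List.cons_append, List.cons.injEq] at hb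
        obtain ⟨rfl, rfl⟩ := hb
        have h1 : C.IsReduced (m ++ [j']) := by
          have h2 : C.IsReduced (x ++ ([j] ++ ((m ++ [j']) ++ y'))) := by simpa using hw
          exact h2.right.right.left
        exact not_wordProd_of_reduced h1 hy' hy
    · rw [ha] at hl
      simp at hl
  exact le_antisymm (not_lt.mp (key (h ▸ hw) h.symm hy' hy)) (not_lt.mp (key hw h hy hy'))

theorem SimplePos.unique {C : SimpleCartanDatum I} {w : List I} (hw : C.IsReduced w) {i : I}
    {p q : ℕ} (hp : C.SimplePos w i p) (hq : C.SimplePos w i q) : p = q := by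
  obtain ⟨x, y, j, rfl, rfl, hy⟩ := hp
  obtain ⟨x', y', j', h, rfl, hy'⟩ := hq
  exact split_length_unique hw h hy hy'

/-! ### Simple roots in the window of a change of words -/

/-- The data of a window `u` of a change of words, to the left of `y`: the letters of `u` are `l`
and `o`, the last one is `l`, the first one is `g`, and the first letter of the window, followed by
the rest `t`, gives the simple root `α_o`. -/
structure IsWindow (C : SimpleCartanDatum I) (u v t y : List I) (g l o : I) : Prop where
  ne : l ≠ o
  mem : ∀ k ∈ u, k = l ∨ k = o
  eq_append : u = v ++ [l]
  eq_cons : u = g :: t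
  two_le : 2 ≤ u.length
  wordProd_tail : C.wordProd t (simpleRoot o) = simpleRoot g
  reduced : C.IsReduced (u ++ y)
  nonneg : 0 ≤ C.wordProd y.reverse (simpleRoot o)

theorem wordProd_apply_of_forall_ne (C : SimpleCartanDatum I) {u : List I} {k : I}
    (h : ∀ l ∈ u, l ≠ k) (v : I → ℤ) : C.wordProd u v k = v k := by
  induction u with
  | nil => rfl
  | cons l u ih =>
    rw [wordProd_cons_apply, reflection_apply_of_ne C (h l (by simp)).symm,
      ih fun l' hl' => h l' (by simp [hl'])]

/-- If a simple root is a sum `p X + q Y` of nonzero vectors `X, Y ≥ 0`, then one of the summands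
vanishes and the other one has coefficient `1`. -/
theorem coeff_of_simpleRoot_eq {X Y : I → ℤ} (hX : 0 ≤ X) (hY : 0 ≤ Y) (hX0 : X ≠ 0)
    (hY0 : Y ≠ 0) {p q : ℤ} (hp : 0 ≤ p) (hq : 0 ≤ q) {c : I}
    (h : simpleRoot c = p • X + q • Y) : (p = 1 ∧ q = 0) ∨ (p = 0 ∧ q = 1) := by
  have h1 : (1 : ℤ) = p * ∑ k, X k + q * ∑ k, Y k := by
    have := congrArg (fun v : I → ℤ => ∑ k, v k) h
    simpa [simpleRoot, Finset.sum_add_distrib, Finset.mul_sum] using this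
  have pos : ∀ {Z : I → ℤ}, 0 ≤ Z → Z ≠ 0 → 1 ≤ ∑ k, Z k := by
    intro Z hZ hZ0
    obtain ⟨k, hk⟩ := Function.ne_iff.mp hZ0
    have : 0 < Z k := lt_of_le_of_ne (hZ k) (Ne.symm hk)
    exact (by omega : 1 ≤ Z k).trans
      (Finset.single_le_sum (f := Z) (fun i _ => hZ i) (Finset.mem_univ k))
  have hx := pos hX hX0
  have hy := pos hY hY0
  generalize ∑ k, X k = a at *
  generalize ∑ k, Y k = b at *
  have h2 : 0 ≤ p * a := by positivity
  have h3 : 0 ≤ q * b := by positivity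
  rcases Int.lt_or_le 0 p with hp' | hp'
  · have : 1 ≤ p * a := by nlinarith
    have h4 : q * b = 0 := by omega
    have h5 : q = 0 := by
      rcases mul_eq_zero.mp h4 with h | h
      · exact h
      · omega
    have h6 : p * a = 1 := by omega
    left
    refine ⟨?_, h5⟩
    nlinarith
  · have hp0 : p = 0 := by omega
    subst hp0
    right
    refine ⟨rfl, ?_⟩
    have h6 : q * b = 1 := by omega
    nlinarith [show 1 ≤ q by by_contra h; have : q = 0 := by omega
                             subst this; omega]

/-- The image of a simple root to the right of a window is `α_l`, or `α_o`, or has a coefficient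
outside of `l` and `o`, which no letter of the window can change. -/
theorem IsWindow.trichotomy {C : SimpleCartanDatum I} {u v t y : List I} {g l o : I}
    (h : C.IsWindow u v t y g l o) (c : I) :
    C.wordProd y (simpleRoot c) = simpleRoot l ∨ C.wordProd y (simpleRoot c) = simpleRoot o ∨
      ∃ k, k ≠ l ∧ k ≠ o ∧ C.wordProd y (simpleRoot c) k ≠ 0 := by
  by_contra! hc
  obtain ⟨h1, h2, h3⟩ := hc
  have hl : 0 ≤ C.wordProd y.reverse (simpleRoot l) := by
    have hr := h.reduced
    rw [h.eq_append, List.append_assoc] at hr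
    exact IsReduced.nonneg_reverse hr.right
  set γ := C.wordProd y (simpleRoot c) with hγ
  have hg : γ = comb l o (γ l) (γ o) := by
    ext k
    by_cases hk : k = l
    · rw [hk, comb_apply_left h.ne]
    by_cases hk' : k = o
    · rw [hk', comb_apply_right h.ne]
    rw [comb_apply_of_ne hk hk', h3 k hk hk']
  have hroot : C.IsRoot γ := C.isRoot_wordProd y c
  have hX0 := (C.isRoot_wordProd y.reverse l).ne_zero
  have hY0 := (C.isRoot_wordProd y.reverse o).ne_zero
  have hs : simpleRoot c = γ l • C.wordProd y.reverse (simpleRoot l) +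
      γ o • C.wordProd y.reverse (simpleRoot o) := by
    rw [← map_zsmul, ← map_zsmul, ← map_add, ← comb, ← hg, hγ, wordProd_reverse_mul]
  rcases hroot.nonneg_or_nonpos with h0 | h0
  · rcases coeff_of_simpleRoot_eq hl h.nonneg hX0 hY0 (h0 l) (h0 o) hs with ⟨e1, e2⟩ | ⟨e1, e2⟩
    · exact h1 (by rw [hg, e1, e2, ← simpleRoot_eq_comb_left])
    · exact h2 (by rw [hg, e1, e2, ← simpleRoot_eq_comb_right])
  · have : simpleRoot c ≤ 0 := by
      rw [hs]
      exact add_nonpos (smul_nonpos_of_nonpos_of_nonneg (h0 l) hl)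
        (smul_nonpos_of_nonpos_of_nonneg (h0 o) h.nonneg)
    have := this c
    simp [simpleRoot] at this

theorem simpleRoot_injective : Function.Injective (simpleRoot : I → I → ℤ) := by
  intro i j h
  by_contra hij
  have := congrFun h i
  simp [simpleRoot, hij] at this

/-- In the window of a change of words, only the last and the first letter can give a simple root.
-/
theorem IsWindow.wordProd_eq_iff {C : SimpleCartanDatum I} {u v t y : List I} {g l o : I}
    (h : C.IsWindow u v t y g l o) {a b : List I} {k : I} (hu : u = a ++ k :: b) (c : I) :
    C.wordProd (b ++ y) (simpleRoot c) = simpleRoot k ↔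
      (b = [] ∧ C.wordProd y (simpleRoot c) = simpleRoot l) ∨
        (a = [] ∧ C.wordProd y (simpleRoot c) = simpleRoot o) := by
  have hru : C.IsReduced u := h.reduced.left
  rw [wordProd_append_apply]
  rcases h.trichotomy c with hc | hc | ⟨m, hml, hmo, hm⟩
  · rw [hc]
    constructor
    · intro hb
      left
      refine ⟨?_, rfl⟩
      have e1 := h.eq_append
      have h0 : C.wordProd [] (simpleRoot l) = simpleRoot l := rfl
      have h2 := split_length_unique (hu ▸ hru) (hu.symm.trans e1) hb h0
      have h3 := congrArg List.length (hu.symm.trans e1)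
      simp only [List.length_append, List.length_cons, List.length_nil] at h3
      exact List.length_eq_zero_iff.mp (by omega)
    · rintro (⟨rfl, -⟩ | ⟨-, hlo⟩)
      · have := List.append_inj_right' (hu.symm.trans h.eq_append) rfl
        simp only [List.cons.injEq, and_true] at this
        rw [this]
        rfl
      · exact absurd (simpleRoot_injective hlo) h.ne
  · rw [hc]
    constructor
    · intro hb
      right
      refine ⟨?_, rfl⟩
      have e1 := h.eq_cons
      have h2 := split_length_unique (x' := []) (hu ▸ hru) (hu.symm.trans e1) hb h.wordProd_tail
      exact List.length_eq_zero_iff.mp h2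
    · rintro (⟨-, hlo⟩ | ⟨rfl, -⟩)
      · exact absurd (simpleRoot_injective hlo) h.ne.symm
      · have e1 := hu.symm.trans h.eq_cons
        rw [List.nil_append, List.cons.injEq] at e1
        rw [e1.1, e1.2, h.wordProd_tail]
  · have hmu : ∀ l' ∈ u, l' ≠ m := by
      intro l' hl'
      rcases h.mem l' hl' with rfl | rfl
      · exact hml.symm
      · exact hmo.symm
    have hb : ∀ l' ∈ b, l' ≠ m := fun l' hl' => hmu l' (by rw [hu]; simp [hl'])
    have hk : k ≠ m := hmu k (by rw [hu]; simp)
    constructor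
    · intro hbk
      have := congrFun hbk m
      rw [wordProd_apply_of_forall_ne C hb] at this
      simp [simpleRoot, hk.symm] at this
      exact absurd this hm
    · rintro (⟨-, hlo⟩ | ⟨-, hlo⟩)
      · rw [hlo] at hm
        simp [simpleRoot, hml] at hm
      · rw [hlo] at hm
        simp [simpleRoot, hmo] at hm

theorem IsRoot.nonneg_iff_of_ne_zero {C : SimpleCartanDatum I} {v : I → ℤ} (hv : C.IsRoot v)
    {k : I} (hk : v k ≠ 0) : 0 ≤ v ↔ 0 ≤ v k := by
  constructor
  · intro h
    exact h k
  · intro h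
    rcases hv.nonneg_or_nonpos with h' | h'
    · exact h'
    · exact absurd (le_antisymm (h' k) h) hk

/-- The rest `t` of a window after its first letter makes `α_l` negative, and changes no other sign
of the roots `y α_c`: those that involve other simple roots keep their coefficients there. -/
theorem IsWindow.nonneg_tail_iff {C : SimpleCartanDatum I} {u v t y : List I} {g l o : I}
    (h : C.IsWindow u v t y g l o) (c : I) :
    0 ≤ C.wordProd (t ++ y) (simpleRoot c) ↔
      0 ≤ C.wordProd y (simpleRoot c) ∧ C.wordProd y (simpleRoot c) ≠ simpleRoot l := by
  rw [wordProd_append_apply]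
  rcases h.trichotomy c with hc | hc | ⟨m, hml, hmo, hm⟩
  · simp only [hc, ne_eq, not_true_eq_false, and_false, iff_false]
    obtain ⟨t', rfl⟩ : ∃ t', t = t' ++ [l] := by
      have h1 := h.eq_cons.symm.trans h.eq_append
      have h2 := h.two_le
      cases v with
      | nil => rw [h.eq_append] at h2; simp at h2
      | cons a v => exact ⟨v, by simpa using (List.cons.inj h1).2⟩
    have hr := h.reduced
    rw [h.eq_cons, List.cons_append] at hr
    have hr2 : C.IsReduced (t' ++ [l]) := (IsReduced.right (x := [g]) hr).left
    intro h0
    rw [wordProd_append_apply, wordProd_cons_apply, wordProd_nil_apply, reflection_simpleRoot,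
      map_neg] at h0
    exact (C.isRoot_wordProd t' l).ne_zero (le_antisymm (neg_nonneg.mp h0) hr2.nonneg)
  · rw [hc, h.wordProd_tail]
    simp only [simpleRoot_nonneg, true_and, true_iff]
    exact fun h' => h.ne (simpleRoot_injective h').symm
  · have ht : ∀ l' ∈ t, l' ≠ m := by
      intro l' hl'
      rcases h.mem l' (by rw [h.eq_cons]; simp [hl']) with rfl | rfl
      · exact hml.symm
      · exact hmo.symm
    have hroot := C.isRoot_wordProd y c
    have e := wordProd_apply_of_forall_ne C ht (C.wordProd y (simpleRoot c))
    rw [(hroot.wordProd t).nonneg_iff_of_ne_zero (k := m) (by rwa [e]),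
      hroot.nonneg_iff_of_ne_zero hm, e]
    simp only [ne_eq, iff_self_and]
    intro _ hlo
    rw [hlo] at hm
    simp [simpleRoot, hml] at hm

/-- Sums over the letters of a window that give simple roots. -/
theorem IsWindow.splitSum_ite {C : SimpleCartanDatum I} {u v t y : List I} {g l o : I}
    (h : C.IsWindow u v t y g l o) (F : I → List I → I → List I → ℚ)
    [∀ a b : I → ℤ, Decidable (a = b)] :
    splitSum (fun a k b => ∑ c, if C.wordProd (b ++ y) (simpleRoot c) = simpleRoot k
      then F c a k b else 0) u =
    ∑ c, ((if C.wordProd y (simpleRoot c) = simpleRoot l then F c v l [] else 0) +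
      (if C.wordProd y (simpleRoot c) = simpleRoot o then F c [] g t else 0)) := by
  classical
  have h1 : ∀ a k b, u = a ++ k :: b →
      (∑ c, if C.wordProd (b ++ y) (simpleRoot c) = simpleRoot k then F c a k b else 0) =
      (if b = [] then (∑ c, if C.wordProd y (simpleRoot c) = simpleRoot l then F c a k b else 0)
        else 0) + (if a = [] then
          (∑ c, if C.wordProd y (simpleRoot c) = simpleRoot o then F c a k b else 0) else 0) := by
    intro a k b hu
    have e : ∀ c, (if C.wordProd (b ++ y) (simpleRoot c) = simpleRoot k then F c a k b else 0) =
        (if b = [] then (if C.wordProd y (simpleRoot c) = simpleRoot l then F c a k b else 0)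
          else 0) + (if a = [] then
            (if C.wordProd y (simpleRoot c) = simpleRoot o then F c a k b else 0) else 0) := by
      intro c
      rw [if_congr (h.wordProd_eq_iff hu c) rfl rfl]
      by_cases hl : C.wordProd y (simpleRoot c) = simpleRoot l
      · have ho : (simpleRoot l : I → ℤ) ≠ simpleRoot o := fun h' =>
          h.ne (simpleRoot_injective h')
        simp [hl, ho]
      · simp [hl, ← ite_and]
    rw [Finset.sum_congr rfl fun c _ => e c, Finset.sum_add_distrib]
    congr 1
    · by_cases hb : b = [] <;> simp [hb]
    · by_cases ha : a = [] <;> simp [ha]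
  rw [splitSum_congr h1, splitSum_add]
  conv_lhs =>
    enter [1, 2]
    rw [h.eq_append]
  rw [splitSum_ite_right_nil]
  conv_lhs =>
    enter [2, 2]
    rw [h.eq_cons]
  rw [splitSum_ite_left_nil, Finset.sum_add_distrib]

/-- The two windows of a change of words; each of them provides the last letter which shows that the
other simple root is positive to the right of the window. -/
theorem isWindow_and_isWindow {C : SimpleCartanDatum I} {x y u u' v v' t t' : List I} {g g' l o : I}
    (hne : l ≠ o) (hm : ∀ k ∈ u, k = l ∨ k = o) (hm' : ∀ k ∈ u', k = o ∨ k = l)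
    (hv : u = v ++ [l]) (hv' : u' = v' ++ [o]) (ht : u = g :: t) (ht' : u' = g' :: t')
    (h2 : 2 ≤ u.length) (h2' : 2 ≤ u'.length)
    (hp : C.wordProd t (simpleRoot o) = simpleRoot g)
    (hp' : C.wordProd t' (simpleRoot l) = simpleRoot g')
    (hw : C.IsReduced (x ++ u ++ y)) (hw' : C.IsReduced (x ++ u' ++ y)) :
    C.IsWindow u v t y g l o ∧ C.IsWindow u' v' t' y g' o l := by
  rw [List.append_assoc] at hw hw'
  refine ⟨⟨hne, hm, hv, ht, h2, hp, hw.right, ?_⟩,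
    ⟨hne.symm, hm', hv', ht', h2', hp', hw'.right, ?_⟩⟩
  · have h3 := hw'.right
    rw [hv', List.append_assoc] at h3
    exact h3.right.nonneg_reverse
  · have h3 := hw.right
    rw [hv, List.append_assoc] at h3
    exact h3.right.nonneg_reverse

theorem isWindow_swap {C : SimpleCartanDatum I} {x y : List I} {i j : I} (hij : i ≠ j)
    (h : C.a i j = 0)
    (hw : C.IsReduced (x ++ [i, j] ++ y)) (hw' : C.IsReduced (x ++ [j, i] ++ y)) :
    C.IsWindow [i, j] [i] [j] y i j i ∧
      C.IsWindow [j, i] [j] [i] y j i j := by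
  refine isWindow_and_isWindow hij.symm (by simp [or_comm]) (by simp [or_comm]) rfl rfl rfl rfl
    (by simp)
    (by simp) ?_ ?_ hw hw' <;>
  simp [simpleRoot_eq_comb_left i j, simpleRoot_eq_comb_right i j, reflection_comb_left,
    reflection_comb_right, h, C.a_eq_zero_comm h]

theorem isWindow_simply {C : SimpleCartanDatum I} {x y : List I} {i j : I} (hij : i ≠ j)
    (h : C.a i j = -1) (h' : C.a j i = -1)
    (hw : C.IsReduced (x ++ [i, j, i] ++ y)) (hw' : C.IsReduced (x ++ [j, i, j] ++ y)) :
    C.IsWindow [i, j, i] [i, j] [j, i] y i i j ∧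
      C.IsWindow [j, i, j] [j, i] [i, j] y j j i := by
  refine isWindow_and_isWindow hij (by simp [or_comm]) (by simp [or_comm]) rfl rfl rfl rfl
    (by simp)
    (by simp) ?_ ?_ hw hw' <;>
  simp [simpleRoot_eq_comb_left i j, simpleRoot_eq_comb_right i j, reflection_comb_left,
    reflection_comb_right, h, h']

theorem isWindow_doubly {C : SimpleCartanDatum I} {x y : List I} {i j : I} (hij : i ≠ j)
    (h : C.a i j = -1) (h' : C.a j i = -2)
    (hw : C.IsReduced (x ++ [i, j, i, j] ++ y)) (hw' : C.IsReduced (x ++ [j, i, j, i] ++ y)) :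
    C.IsWindow [i, j, i, j] [i, j, i] [j, i, j] y i j i ∧
      C.IsWindow [j, i, j, i] [j, i, j] [i, j, i] y j i j := by
  refine isWindow_and_isWindow hij.symm (by simp [or_comm]) (by simp [or_comm]) rfl rfl rfl rfl
    (by simp)
    (by simp) ?_ ?_ hw hw' <;>
  simp [simpleRoot_eq_comb_left i j, simpleRoot_eq_comb_right i j, reflection_comb_left,
    reflection_comb_right, h, h']

theorem isWindow_triply {C : SimpleCartanDatum I} {x y : List I} {i j : I} (hij : i ≠ j)
    (h : C.a i j = -1) (h' : C.a j i = -3)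
    (hw : C.IsReduced (x ++ [j, i, j, i, j, i] ++ y))
    (hw' : C.IsReduced (x ++ [i, j, i, j, i, j] ++ y)) :
    C.IsWindow [j, i, j, i, j, i] [j, i, j, i, j] [i, j, i, j, i] y j i j ∧
      C.IsWindow [i, j, i, j, i, j] [i, j, i, j, i] [j, i, j, i, j] y i j i := by
  refine isWindow_and_isWindow hij (by simp [or_comm]) (by simp [or_comm]) rfl rfl rfl rfl
    (by simp)
    (by simp) ?_ ?_ hw hw' <;>
  simp [simpleRoot_eq_comb_left i j, simpleRoot_eq_comb_right i j, reflection_comb_left,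
    reflection_comb_right, h, h']

/-- Every change of words replaces a window ending in a letter `l` by one ending in the other letter
`o`, and interchanges the first and the last position of the window. -/
theorem Move.exists_isWindow {C : SimpleCartanDatum I} {w w' : List I} (m : C.Move w w')
    (hw : C.IsReduced w) : ∃ (x u u' y v v' t t' : List I) (g g' l o : I),
      w = x ++ u ++ y ∧ w' = x ++ u' ++ y ∧ u.length = u'.length ∧
      C.IsWindow u v t y g l o ∧ C.IsWindow u' v' t' y g' o l ∧
      m.trace = reflectWindow x.length u.length := by
  have hw' := m.isReduced hw
  cases m with
  | swap x y i j hij h =>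
    obtain ⟨h1, h2⟩ := isWindow_swap hij h hw hw'
    exact ⟨_, _, _, _, _, _, _, _, _, _, _, _, rfl, rfl, rfl, h1, h2, rfl⟩
  | simply x y i j hij h h' =>
    obtain ⟨h1, h2⟩ := isWindow_simply hij h h' hw hw'
    exact ⟨_, _, _, _, _, _, _, _, _, _, _, _, rfl, rfl, rfl, h1, h2, rfl⟩
  | doubly x y i j hij h h' =>
    obtain ⟨h1, h2⟩ := isWindow_doubly hij h h' hw hw'
    exact ⟨_, _, _, _, _, _, _, _, _, _, _, _, rfl, rfl, rfl, h1, h2, rfl⟩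
  | doublyInv x y i j hij h h' =>
    obtain ⟨h1, h2⟩ := isWindow_doubly hij h h' hw' hw
    exact ⟨_, _, _, _, _, _, _, _, _, _, _, _, rfl, rfl, rfl, h2, h1, rfl⟩
  | triply x y i j hij h h' =>
    obtain ⟨h1, h2⟩ := isWindow_triply hij h h' hw hw'
    exact ⟨_, _, _, _, _, _, _, _, _, _, _, _, rfl, rfl, rfl, h1, h2, rfl⟩
  | triplyInv x y i j hij h h' =>
    obtain ⟨h1, h2⟩ := isWindow_triply hij h h' hw' hw
    exact ⟨_, _, _, _, _, _, _, _, _, _, _, _, rfl, rfl, rfl, h2, h1, rfl⟩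

/-- A change of words moves the letter which gives `α_i` as it moves initial terms. -/
theorem SimplePos.move {C : SimpleCartanDatum I} {w w' : List I} (m : C.Move w w')
    (hw : C.IsReduced w) {i : I} {p : ℕ} (hp : C.SimplePos w i p) :
    C.SimplePos w' i (m.trace p) := by
  have hprod := m.wordProd_eq
  obtain ⟨x, u, u', y, v, v', t, t', g, g', l, o, rfl, rfl, hlen, hu, hu', htr⟩ :=
    m.exists_isWindow hw
  have huu : ∀ z, C.wordProd u z = C.wordProd u' z := by
    intro z
    rw [List.append_assoc, List.append_assoc, wordProd_append, wordProd_append C x] at hprod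
    have h1 := LinearMap.congr_fun hprod (C.wordProd y.reverse z)
    have h2 := C.wordProd_injective x h1
    simpa [wordProd_append_apply, wordProd_mul_reverse] using h2
  rw [htr]
  obtain ⟨a, b, k, hab, rfl, hk⟩ := hp
  unfold reflectWindow
  rcases List.append_eq_append_iff.mp hab with ⟨c, hc, hd⟩ | ⟨c, hc, hd⟩
  · -- the letter lies to the right of the window
    rw [if_neg (by rw [hc]; simp)]
    refine ⟨x ++ u' ++ c, b, k, by rw [hd]; simp, ?_, hk⟩
    rw [hc]
    simp [hlen]
  · cases c with
    | nil =>
      rw [if_neg (by rw [← List.append_nil a, ← hc]; simp)]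
      refine ⟨x ++ u', b, k, by rw [hd]; simp, ?_, hk⟩
      rw [← List.append_nil a, ← hc]
      simp [hlen]
    | cons k' c =>
      rw [List.cons_append, List.cons.injEq] at hd
      obtain ⟨rfl, rfl⟩ := hd
      rcases List.append_eq_append_iff.mp hc with ⟨d, hd, he⟩ | ⟨d, hd, he⟩
      · -- the letter lies in the window
        have hlu := congrArg List.length he
        simp only [List.length_append, List.length_cons] at hlu
        rw [if_pos (by rw [hd]; simp; omega)]
        rcases (hu.wordProd_eq_iff he i).mp hk with ⟨rfl, hl⟩ | ⟨rfl, ho⟩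
        · refine ⟨x, t' ++ y, g', by rw [hu'.eq_cons]; simp, ?_, ?_⟩
          · rw [hd]
            simp at hlu ⊢
            omega
          · rw [wordProd_append_apply, hl, hu'.wordProd_tail]
        · refine ⟨x ++ v', y, o, by rw [hu'.eq_append]; simp, ?_, ho⟩
          have e1 := congrArg List.length hu'.eq_append
          rw [hd]
          simp at hlu e1 ⊢
          omega
      · cases d with
        | nil =>
          simp only [List.nil_append] at he
          have he' := he.symm
          have hlu := congrArg List.length he'
          simp only [List.length_cons] at hlu
          rw [if_pos (by rw [hd]; simp; omega)]
          rcases (hu.wordProd_eq_iff (a := []) he' i).mp hk with ⟨rfl, hl⟩ | ⟨-, ho⟩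
          · have := hu.two_le
            simp at hlu
            omega
          · refine ⟨x ++ v', y, o, by rw [hu'.eq_append]; simp, ?_, ho⟩
            have e1 := congrArg List.length hu'.eq_append
            rw [hd]
            simp at hlu e1 ⊢
            omega
        | cons k'' d =>
          -- the letter lies to the left of the window
          rw [List.cons_append, List.cons.injEq] at he
          obtain ⟨rfl, rfl⟩ := he
          rw [if_neg (by rw [hd]; simp)]
          refine ⟨a, d ++ u' ++ y, k, by rw [hd]; simp, rfl, ?_⟩
          rw [← hk]
          simp only [wordProd_append_apply, huu]

theorem InitialPos.simplePos {C : SimpleCartanDatum I} {w : List I} {i : I} {p : ℕ}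
    (h : C.InitialPos w i p) (hw : C.IsReduced w) : C.SimplePos w i p := by
  induction h with
  | last x i => exact ⟨x, [], i, rfl, rfl, rfl⟩
  | move m i p _ ih => exact (ih (m.isReduced_left hw)).move m (m.isReduced_left hw)

theorem InitialPos.exists_of_wordChange {C : SimpleCartanDatum I} {w w' : List I}
    (M : C.WordChange w w') {i : I} {p : ℕ} (h : C.InitialPos w i p) :
    ∃ q, C.InitialPos w' i q := by
  induction M generalizing p with
  | nil w => exact ⟨p, h⟩
  | cons m M ih => exact ih (.move m i p h)

/-- In a reduced word whose element makes `α_i` negative, the initial term of `𝐞_i` is the letter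
which gives the simple root `α_i`. -/
theorem initialPos_iff {C : SimpleCartanDatum I} {w : List I} (hw : C.IsReduced w) {i : I}
    (hi : ¬ 0 ≤ C.wordProd w (simpleRoot i)) {p : ℕ} :
    C.InitialPos w i p ↔ C.SimplePos w i p := by
  refine ⟨fun h => h.simplePos hw, fun h => ?_⟩
  obtain ⟨u, hu, hp, -⟩ := hw.exists_descent hi
  obtain ⟨M⟩ := C.nonempty_wordChange hu hw hp
  obtain ⟨q, hq⟩ := (InitialPos.last u i).exists_of_wordChange M
  rwa [(hq.simplePos hw).unique hw h] at hq

end SimpleCartanDatum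

/-! ### Mutations in a finite part of a quiver -/

section Local

variable {V : Type*} {n : ℕ}

/-- The mutation rule at `k` relating two integer weight functions, where `m` is the multiplier
of `k`. -/
def IsMutation (k : Fin n) (m : ℤ) (W W' : Fin n → Fin n → ℤ) : Prop :=
  ∀ u v, if u = k ∨ v = k then W' u v = -W u v
    else 2 * m * (W' u v - W u v) = W u k * |W k v| + |W u k| * W k v

instance (k : Fin n) (m : ℤ) (W W' : Fin n → Fin n → ℤ) : Decidable (IsMutation k m W W') := by
  unfold IsMutation
  infer_instance

/-- A quiver has, up to the scale `s`, the weights `W` pulled back along a map `τ` of its vertices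
to a finite set, plus some further weights `D`. -/
def HasLocalWeight (Q : WeightedQuiver V) (s : ℚ) (τ : V → Fin n) (W : Fin n → Fin n → ℤ)
    (D : V → V → ℚ) : Prop :=
  ∀ u v, Q.weight u v = s * W (τ u) (τ v) + D u v

/-- A mutation at a vertex which the further weights do not involve changes the finite part only.
-/
theorem HasLocalWeight.mutate {Q : WeightedQuiver V} {s : ℚ} {τ : V → Fin n}
    {W W' : Fin n → Fin n → ℤ} {D : V → V → ℚ} (h : HasLocalWeight Q s τ W D) (hs : 0 < s)
    {x : V} {k : Fin n} {m : ℤ} (hx : ∀ u, τ u = k ↔ u = x) (hm : 0 < m)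
    (hmult : Q.mult x = s * m) (hD : ∀ u, D x u = 0) (hD' : ∀ u, D u x = 0)
    (hW : IsMutation k m W W') : HasLocalWeight (Q.mutate x) s τ W' D := by
  intro u v
  have hk : τ x = k := (hx x).mpr rfl
  have h1 := hW (τ u) (τ v)
  simp only [WeightedQuiver.mutate]
  by_cases huv : u = x ∨ v = x
  · rw [if_pos (huv.imp (hx u).mpr (hx v).mpr)] at h1
    rw [if_pos huv, h, h1]
    rcases huv with rfl | rfl
    · rw [hD]
      push_cast
      ring
    · rw [hD']
      push_cast
      ring
  · rw [if_neg fun h => huv (h.imp (hx u).mp (hx v).mp)] at h1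
    rw [if_neg huv]
    have h2 : (2 * m * (W' (τ u) (τ v) - W (τ u) (τ v)) : ℚ) =
        W (τ u) k * |(W k (τ v) : ℚ)| + |(W (τ u) k : ℚ)| * W k (τ v) := by
      exact_mod_cast h1
    rw [h u v, h u x, h x v, hD, hD', hmult, hk, add_zero, add_zero, abs_mul, abs_mul,
      abs_of_pos hs]
    have hm' : (m : ℚ) ≠ 0 := by exact_mod_cast hm.ne'
    have hs' := hs.ne'
    field_simp
    linear_combination (-s) * h2

end Local

/-! ### Mutations, renamings and single arrows -/

namespace WeightedQuiver

variable {V : Type*}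

theorem mutate_mutate (Q : WeightedQuiver V) (k : V) : (Q.mutate k).mutate k = Q := by
  ext1
  · rfl
  · rfl
  · rfl
  · funext u v
    simp only [mutate]
    by_cases h : u = k ∨ v = k
    · simp [h]
    · simp only [h, or_true, true_or, if_true, if_false, abs_neg]
      ring

theorem relabel_relabel (Q : WeightedQuiver V) {σ τ : Equiv.Perm V} (h : ∀ v, σ (τ v) = v) :
    (Q.relabel σ).relabel τ = Q := by
  ext1
  · simp only [relabel]
    ext v
    simp [h]
  · simp only [relabel]
    ext v
    simp [h]
  · simp [relabel, h]
  · simp [relabel, h]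

end WeightedQuiver

namespace SimpleCartanDatum

open Node

theorem mutateAt_reverse_mutateAt {I : Type*} (l : List (Node I))
    (Q : WeightedQuiver (Node I)) : mutateAt l.reverse (mutateAt l Q) = Q := by
  induction l generalizing Q with
  | nil => rfl
  | cons k l ih =>
    have h : mutateAt (k :: l).reverse (mutateAt (k :: l) Q) =
        (mutateAt l.reverse (mutateAt l (Q.mutate k))).mutate k := by
      simp [mutateAt]
    rw [h, ih, WeightedQuiver.mutate_mutate]

end SimpleCartanDatum

namespace Node

variable {I : Type*}

theorem arrow_map (σ : Equiv.Perm (Node I)) (u v s t : Node I) (c : ℚ) :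
    arrow (σ u) (σ v) c (σ s) (σ t) = arrow u v c s t := by
  classical
  unfold arrow
  congr 1 <;> exact if_congr (by simp) rfl rfl

theorem arrow_self (u s t : Node I) (c : ℚ) : arrow u u c s t = 0 := by
  simp [arrow, and_comm]

theorem arrow_swap (u v : Node I) (c : ℚ) (s t : Node I) :
    arrow u v c s t = -arrow v u c s t := by
  simp [arrow]

theorem arrow_neg (u v : Node I) (c : ℚ) (s t : Node I) :
    arrow u v (-c) s t = -arrow u v c s t := by
  unfold arrow
  split_ifs <;> ring

end Node

namespace SimpleCartanDatum

open Node

variable {I : Type*} [Fintype I] [DecidableEq I]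

/-! ### The quiver of a triangle -/

/-- The elementary quiver of the letter `j` that follows the word `x`, where the `k`-th node of row
`i` is placed at `P i k`. -/
noncomputable def rowPart (C : SimpleCartanDatum I) (P : I → ℤ → Node I) (x : List I) (j : I)
    (s t : Node I) : ℚ :=
  C.elementary j (P j (x.count j)) (P j (x.count j + 1)) (fun c => P c (x.count c)) s t

open Classical in
/-- The arrows at `e_i^0`, where the letter `j` between the words `x` and `y` gives the simple root
`α_i`: they are `f_j^k → e_i^0 → f_j^{k-1}` if `j` is the `k`-th letter `j`. -/
noncomputable def attachPart (C : SimpleCartanDatum I) (P : I → ℤ → Node I) (x : List I) (j : I)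
    (y : List I) (s t : Node I) : ℚ :=
  ∑ i, if C.wordProd y (simpleRoot i) = simpleRoot j then
    arrow (P j (x.count j + 1)) (e i) (C.d i) s t + arrow (e i) (P j (x.count j)) (C.d i) s t
  else 0

open Classical in
/-- The arrows between the nodes `e_i^0`: each pair contributes half of its arrow at either of its
two letters.  The arrow leads from the earlier letter to the later one: the letter of `e_k^0` is in
`y` if and only if `y` makes `α_k` negative. -/
noncomputable def sidePart (C : SimpleCartanDatum I) (j : I) (y : List I) (s t : Node I) : ℚ :=
  ∑ i, if C.wordProd y (simpleRoot i) = simpleRoot j then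
    ∑ k, arrow (e i) (e k)
      ((if 0 ≤ C.wordProd y (simpleRoot k) then -1 else 1) * (|C.d i * C.a i k| / 4)) s t
  else 0

/-- The weights of the quiver of a triangle, with the `k`-th node of row `i` placed at `P i k`. -/
noncomputable def triangleWeight (C : SimpleCartanDatum I) (P : I → ℤ → Node I) (w : List I)
    (s t : Node I) : ℚ :=
  splitSum (fun x j y => C.rowPart P x j s t + C.attachPart P x j y s t + C.sidePart j y s t) w

theorem elementary_skew (C : SimpleCartanDatum I) (i : I) (u v : Node I) (nb : I → Node I)
    (s t : Node I) : C.elementary i u v nb s t = -C.elementary i u v nb t s := by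
  simp only [elementary]
  rw [arrow_skew _ _ _ s t,
    Finset.sum_congr rfl fun j _ => by rw [arrow_skew _ _ _ s t, arrow_skew _ _ _ s t, ← neg_add],
    Finset.sum_neg_distrib]
  ring

theorem elementary_off (C : SimpleCartanDatum I) {i : I} {u v : Node I} {nb : I → Node I}
    {s : Node I} (t : Node I) (hu : s ≠ u) (hv : s ≠ v) (hn : ∀ c, s ≠ nb c) :
    C.elementary i u v nb s t = 0 := by
  rw [elementary, arrow_off t hu hv, Finset.sum_eq_zero fun j _ => by
    rw [arrow_off t hv (hn j), arrow_off t (hn j) hu, add_zero], add_zero]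

theorem attachPart_skew (C : SimpleCartanDatum I) (P : I → ℤ → Node I) (x : List I) (j : I)
    (y : List I) (s t : Node I) : C.attachPart P x j y s t = -C.attachPart P x j y t s := by
  unfold attachPart
  rw [← Finset.sum_neg_distrib]
  refine Finset.sum_congr rfl fun i _ => ?_
  split_ifs
  · rw [arrow_skew _ _ _ s t, arrow_skew _ _ _ s t]
    ring
  · simp

theorem sidePart_skew (C : SimpleCartanDatum I) (j : I)
    (y : List I) (s t : Node I) : C.sidePart j y s t = -C.sidePart j y t s := by
  unfold sidePart
  rw [← Finset.sum_neg_distrib]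
  refine Finset.sum_congr rfl fun i _ => ?_
  split_ifs
  · rw [← Finset.sum_neg_distrib]
    exact Finset.sum_congr rfl fun k _ => arrow_skew _ _ _ s t
  · simp

theorem triangleWeight_skew (C : SimpleCartanDatum I) (P : I → ℤ → Node I) (w : List I)
    (s t : Node I) : C.triangleWeight P w s t = -C.triangleWeight P w t s := by
  rw [triangleWeight, triangleWeight, ← splitSum_neg]
  refine splitSum_congr fun x j y _ => ?_
  rw [rowPart, elementary_skew, attachPart_skew, sidePart_skew, rowPart]
  ring

theorem sidePart_off (C : SimpleCartanDatum I) {j : I} {y : List I} {s : Node I} (t : Node I)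
    (hs : ∀ i, s ≠ e i) : C.sidePart j y s t = 0 := by
  refine Finset.sum_eq_zero fun i _ => ?_
  split_ifs
  · exact Finset.sum_eq_zero fun k _ => arrow_off t (hs i) (hs k)
  · rfl

/-- The weights vanish away from the nodes `e_i^0` and the nodes of the rows that belong to `w`,
where `z` is the word to the left of `w`. -/
theorem splitSum_off (C : SimpleCartanDatum I) {P : I → ℤ → Node I} {w : List I} (z y : List I)
    {s : Node I} (t : Node I) (hs : ∀ i, s ≠ e i)
    (hP : ∀ c k, (z.count c : ℤ) ≤ k → k ≤ z.count c + w.count c → s ≠ P c k) :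
    splitSum (fun x j y' => C.rowPart P (z ++ x) j s t + C.attachPart P (z ++ x) j (y' ++ y) s t +
      C.sidePart j (y' ++ y) s t) w = 0 := by
  refine splitSum_eq_zero ?_
  rintro x j y' rfl
  have h0 : ∀ c, s ≠ P c ((z ++ x).count c) := by
    intro c
    refine hP c _ ?_ ?_ <;> rw [List.count_append] <;> push_cast
    · omega
    · rw [List.count_append]
      push_cast
      omega
  have h1 : s ≠ P j ((z ++ x).count j + 1) := by
    refine hP j _ ?_ ?_ <;> rw [List.count_append] <;> push_cast
    · omega
    · rw [List.count_append, List.count_cons_self]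
      push_cast
      omega
  rw [rowPart, elementary_off C t (h0 j) h1 h0, sidePart_off C t hs, attachPart]
  rw [Finset.sum_eq_zero]
  · simp
  · intro i _
    split_ifs
    · rw [arrow_off t h1 (hs i), arrow_off t (hs i) (h0 j), add_zero]
    · rfl

/-- The vertices of the quiver of a triangle. -/
def triangleVerts (w : List I) : Set (Node I) :=
  {v | (∃ i k, v = f i k ∧ 0 ≤ k ∧ k ≤ w.count i) ∨ ∃ i, v = e i}

theorem f_mem_triangleVerts {w : List I} {i : I} {k : ℤ} :
    f i k ∈ triangleVerts w ↔ 0 ≤ k ∧ k ≤ w.count i := by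
  constructor
  · rintro (⟨i', k', h, h1, h2⟩ | ⟨i', h⟩)
    · cases h
      exact ⟨h1, h2⟩
    · cases h
  · rintro ⟨h1, h2⟩
    exact Or.inl ⟨i, k, rfl, h1, h2⟩

theorem e_mem_triangleVerts (w : List I) (i : I) : e i ∈ triangleVerts w := Or.inr ⟨i, rfl⟩

/-- The multipliers of the quiver of a triangle. -/
def triangleMult (C : SimpleCartanDatum I) (w : List I) : Node I → ℚ
  | f i k => if 0 ≤ k ∧ k ≤ w.count i then C.d i else 0
  | e i => C.d i

/-- The quiver attached to a triangle by a word `w`. -/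
noncomputable def triangleQuiver (C : SimpleCartanDatum I) (w : List I) :
    WeightedQuiver (Node I) where
  verts := triangleVerts w
  frozen := {v | ∃ i, v = e i ∨ v = f i 0 ∨ v = f i (w.count i)}
  mult := C.triangleMult w
  weight := C.triangleWeight f w
  frozen_subset := by
    rintro v ⟨i, rfl | rfl | rfl⟩
    · exact e_mem_triangleVerts w i
    · exact f_mem_triangleVerts.mpr ⟨le_rfl, by omega⟩
    · exact f_mem_triangleVerts.mpr ⟨by omega, le_rfl⟩
  mult_pos v hv := by
    cases v with
    | f i k =>
      have h : C.triangleMult w (f i k) = C.d i := if_pos (f_mem_triangleVerts.mp hv)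
      exact h ▸ C.d_pos i
    | e i => exact C.d_pos i
  mult_off v hv := by
    cases v with
    | f i k => exact if_neg fun h => hv (f_mem_triangleVerts.mpr h)
    | e i => exact absurd (e_mem_triangleVerts w i) hv
  weight_skew := C.triangleWeight_skew f w
  weight_off s t hs := by
    have h := C.splitSum_off (P := f) (w := w) [] [] (s := s) t
      (fun i hi => hs (hi ▸ e_mem_triangleVerts w i)) (fun c k h1 h2 hk => hs (by
        rw [hk]
        exact f_mem_triangleVerts.mpr ⟨by simpa using h1, by simpa using h2⟩))
    simpa [triangleWeight] using h

end SimpleCartanDatum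

/-! ### The finite quiver of a window -/

section Window

/-- The weights of a single arrow `A → B` of weight `c`. -/
def localArrow (A B : Fin 11) (c : ℤ) (u v : Fin 11) : ℤ :=
  (if u = A ∧ v = B then c else 0) - (if u = B ∧ v = A then c else 0)

/-- The standard positions of the nodes in a window with the letters `i` (`true`) and `j`
(`false`): the nodes of row `i` are `0, …, 3` and those of row `j` are `4, …, 7`. -/
def stdPlace (b : Bool) (m : ℕ) : Fin 11 := Fin.ofNat 11 (if b then m else 4 + m)

/-- The position of the node `e_c^0` whose simple root appears in the window: it is `9` or `8`,
according to whether the root is `α_i` or `α_j` at the right end of the window. -/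
def sidePlace (b : Bool) : Fin 11 := if b then 9 else 8

/-- The elementary quivers of the letters of a window, without the arrows to the rows of other
letters, where `d` are the multipliers and `r` is the weight of the arrows between the rows. -/
def localRow (place : Bool → ℕ → Fin 11) (d : Bool → ℤ) (r : ℤ) :
    List Bool → (Bool → ℕ) → Fin 11 → Fin 11 → ℤ
  | [], _, _, _ => 0
  | b :: w, n, u, v =>
    localArrow (place b (n b)) (place b (n b + 1)) (d b) u v
      + localArrow (place b (n b + 1)) (place (!b) (n (!b))) r u v
      + localArrow (place (!b) (n (!b))) (place b (n b)) r u v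
      + localRow place d r w (Function.update n b (n b + 1)) u v

/-- The arrows at the nodes `e_c^0` which belong to the first letter `g` and to the last letter
`l` of the window `w`. -/
def localSide (place : Bool → ℕ → Fin 11) (d : Bool → ℤ) (r : ℤ) (w : List Bool) (g l : Bool)
    (u v : Fin 11) : ℤ :=
  localArrow (place l (w.count l)) (sidePlace l) (d l) u v
    + localArrow (sidePlace l) (place l (w.count l - 1)) (d l) u v
    + localArrow (place g 1) (sidePlace (!l)) (d (!l)) u v
    + localArrow (sidePlace (!l)) (place g 0) (d (!l)) u v
    + localArrow (sidePlace (!l)) (sidePlace l) r u v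

/-- The weights of the finite quiver of a window `w`. -/
def localWeight (place : Bool → ℕ → Fin 11) (d : Bool → ℤ) (r : ℤ) (w : List Bool) (g l : Bool)
    (u v : Fin 11) : ℤ :=
  localRow place d r w (fun _ => 0) u v + localSide place d r w g l u v

end Window

namespace Node

variable {I : Type*}

theorem localArrow_pull {τ : Node I → Fin 11} {A B : Fin 11} {a b : Node I}
    (hA : ∀ u, τ u = A ↔ u = a) (hB : ∀ u, τ u = B ↔ u = b) (S : ℚ) (c : ℤ) (u v : Node I) :
    arrow a b (S * c) u v = S * localArrow A B c (τ u) (τ v) := by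
  classical
  unfold arrow localArrow
  rw [Int.cast_sub, mul_sub]
  congr 1
  · by_cases h : u = a ∧ v = b
    · rw [if_pos h, if_pos ⟨(hA u).mpr h.1, (hB v).mpr h.2⟩]
    · rw [if_neg h, if_neg fun h' => h ⟨(hA u).mp h'.1, (hB v).mp h'.2⟩]
      simp
  · by_cases h : u = b ∧ v = a
    · rw [if_pos h, if_pos ⟨(hB u).mpr h.1, (hA v).mpr h.2⟩]
    · rw [if_neg h, if_neg fun h' => h ⟨(hB u).mp h'.1, (hA v).mp h'.2⟩]
      simp

theorem sum_ite_e [Fintype I] (p : I → Prop) [DecidablePred p] (q : Prop) (x : Node I) (r : ℚ)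
    [∀ c, Decidable (q ∧ x = e c)] [Decidable (q ∧ ∃ c, p c ∧ x = e c)] :
    (∑ c, if p c then (if q ∧ x = e c then r else 0) else 0) =
      if q ∧ ∃ c, p c ∧ x = e c then r else 0 := by
  cases x with
  | f c k => simp
  | e c =>
    rw [Finset.sum_eq_single c]
    · by_cases h : p c <;> by_cases h' : q <;> simp [h, h']
    · intro b _ hb
      simp [hb.symm]
    · simp

/-- Pulling back an arrow to a node `B` that stands for the `e_c^0` with the property `p`. -/
theorem localArrow_pull_sum [Fintype I] {τ : Node I → Fin 11} {A B : Fin 11} {a : Node I}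
    {p : I → Prop} [DecidablePred p]
    (hA : ∀ u, τ u = A ↔ u = a) (hB : ∀ u, τ u = B ↔ ∃ c, p c ∧ u = e c) (S : ℚ) (m : ℤ)
    (u v : Node I) :
    (∑ c, if p c then arrow a (e c) (S * m) u v else 0) = S * localArrow A B m (τ u) (τ v) := by
  classical
  have h1 : ∀ c, (if p c then arrow a (e c) (S * m) u v else 0) =
      (if p c then (if u = a ∧ v = e c then S * m else 0) else 0) -
        (if p c then (if v = a ∧ u = e c then S * m else 0) else 0) := by
    intro c
    unfold arrow
    by_cases h : p c
    · simp only [h, if_true]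
      congr 1
      exact if_congr and_comm rfl rfl
    · simp [h]
  rw [Finset.sum_congr rfl fun c _ => h1 c, Finset.sum_sub_distrib, sum_ite_e, sum_ite_e]
  unfold localArrow
  rw [Int.cast_sub, mul_sub]
  congr 1
  · rw [← if_congr (and_congr (hA u) (hB v)) rfl rfl]
    split_ifs <;> simp
  · rw [← if_congr (and_congr (hA v) (hB u)) rfl rfl, if_congr and_comm rfl rfl]
    split_ifs <;> simp

/-- Pulling back an arrow between nodes that stand for the `e_c^0` with the properties `p` and `q`.
-/
theorem localArrow_pull_sum_sum [Fintype I] {τ : Node I → Fin 11} {A B : Fin 11}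
    {p q : I → Prop} [DecidablePred p] [DecidablePred q]
    (hA : ∀ u, τ u = A ↔ ∃ c, p c ∧ u = e c) (hB : ∀ u, τ u = B ↔ ∃ c, q c ∧ u = e c)
    (S : ℚ) (m : ℤ) (u v : Node I) :
    (∑ c, if p c then (∑ k, if q k then arrow (e c) (e k) (S * m) u v else 0) else 0) =
      S * localArrow A B m (τ u) (τ v) := by
  classical
  have h1 : ∀ c, (∑ k, if q k then arrow (e c) (e k) (S * m) u v else 0) =
      (if (∃ k, q k ∧ v = e k) ∧ u = e c then S * m else 0) -
        (if (∃ k, q k ∧ u = e k) ∧ v = e c then S * m else 0) := by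
    intro c
    have h2 : ∀ k, (if q k then arrow (e c) (e k) (S * m) u v else 0) =
      (if q k then (if u = e c ∧ v = e k then S * m else 0) else 0) -
        (if q k then (if v = e c ∧ u = e k then S * m else 0) else 0) := by
      intro k
      unfold arrow
      by_cases h : q k
      · simp only [h, if_true]
        congr 1
        exact if_congr and_comm rfl rfl
      · simp [h]
    rw [Finset.sum_congr rfl fun c _ => h2 c, Finset.sum_sub_distrib, sum_ite_e, sum_ite_e]
    congr 1 <;> exact if_congr and_comm rfl rfl
  have h3 : ∀ c, (if p c then (∑ k, if q k then arrow (e c) (e k) (S * m) u v else 0) else 0) =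
      (if p c then (if (∃ k, q k ∧ v = e k) ∧ u = e c then S * m else 0) else 0) -
        (if p c then (if (∃ k, q k ∧ u = e k) ∧ v = e c then S * m else 0) else 0) := by
    intro c
    rw [h1]
    by_cases h : p c <;> simp [h]
  rw [Finset.sum_congr rfl fun c _ => h3 c, Finset.sum_sub_distrib, sum_ite_e, sum_ite_e]
  unfold localArrow
  rw [Int.cast_sub, mul_sub]
  congr 1
  · rw [← if_congr (and_congr (hB v) (hA u)) rfl rfl, if_congr and_comm rfl rfl]
    split_ifs <;> simp
  · rw [← if_congr (and_congr (hB u) (hA v)) rfl rfl]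
    split_ifs <;> simp

end Node

namespace SimpleCartanDatum

open Node

variable {I : Type*} [Fintype I] [DecidableEq I]

open Classical in
/-- The position of a node in the finite quiver of a window to the left of the word `y`, where the
window has the letters `L true`, `L false` and its nodes are counted from `n`.  All nodes that do
not appear in the window are sent to `10`. -/
noncomputable def localIndex (C : SimpleCartanDatum I) (y : List I) (L : Bool → I)
    (n : Bool → ℤ) : Node I → Fin 11
  | f c t =>
    if c = L true then
      if t = n true then 0 else if t = n true + 1 then 1 else if t = n true + 2 then 2
      else if t = n true + 3 then 3 else 10
    else if c = L false then
      if t = n false then 4 else if t = n false + 1 then 5 else if t = n false + 2 then 6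
      else if t = n false + 3 then 7 else 10
    else 10
  | e c =>
    if C.wordProd y (simpleRoot c) = simpleRoot (L false) then 8
    else if C.wordProd y (simpleRoot c) = simpleRoot (L true) then 9 else 10

theorem localIndex_eq_stdPlace (C : SimpleCartanDatum I) (y : List I) {L : Bool → I}
    (hL : L true ≠ L false) (n : Bool → ℤ) (b : Bool) {m : ℕ} (hm : m ≤ 3) (u : Node I) :
    C.localIndex y L n u = stdPlace b m ↔ u = f (L b) (n b + m) := by
  have hL' := hL.symm
  cases u with
  | e c =>
    simp only [reduceCtorEq, iff_false, localIndex, stdPlace]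
    cases b <;> interval_cases m <;> split_ifs <;> decide
  | f c t =>
    by_cases h1 : c = L true
    · subst h1
      simp only [localIndex, if_true, stdPlace]
      cases b <;> interval_cases m <;> split_ifs <;> simp_all <;> first | omega | decide
    · by_cases h2 : c = L false
      · subst h2
        simp only [localIndex, if_true, stdPlace, h1, if_false]
        cases b <;> interval_cases m <;> split_ifs <;> simp_all <;> first | omega | decide
      · simp only [localIndex, stdPlace, h1, h2, if_false]
        cases b <;> interval_cases m <;> simp_all <;> decide

theorem localIndex_eq_sidePlace (C : SimpleCartanDatum I) (y : List I) {L : Bool → I}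
    (hL : L true ≠ L false) (n : Bool → ℤ) (b : Bool) (u : Node I) :
    C.localIndex y L n u = sidePlace b ↔
      ∃ c, C.wordProd y (simpleRoot c) = simpleRoot (L b) ∧ u = e c := by
  have h0 : (simpleRoot (L true) : I → ℤ) ≠ simpleRoot (L false) :=
    fun h => hL (simpleRoot_injective h)
  cases u with
  | f c t =>
    simp only [reduceCtorEq, and_false, exists_false, iff_false, localIndex, sidePlace]
    cases b <;> split_ifs <;> simp_all
  | e c =>
    simp only [localIndex, sidePlace, e.injEq, exists_eq_right_right']
    by_cases h1 : C.wordProd y (simpleRoot c) = simpleRoot (L false)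
    · cases b <;> simp [h1, h0.symm]
    · by_cases h2 : C.wordProd y (simpleRoot c) = simpleRoot (L true)
      · cases b <;> simp [h1, h2, h0]
      · cases b <;> simp [h1, h2]

/-- The arrows between the node `v` of a row `k` in a window and the current nodes of the rows
which do not change in the window. -/
noncomputable def outerPart (C : SimpleCartanDatum I) (P : I → ℤ → Node I) (x : List I)
    (L : Bool → I) (k : I) (v s t : Node I) : ℚ :=
  ∑ c with c ≠ L true ∧ c ≠ L false, arrow v (P c (x.count c)) (|C.d k * C.a k c| / 2) s t

theorem rowPart_eq (C : SimpleCartanDatum I) (P : I → ℤ → Node I) (x z : List I) {L : Bool → I}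
    (hL : L true ≠ L false) (b : Bool)
    (hz : ∀ c, c ≠ L true → c ≠ L false → z.count c = x.count c) (s t : Node I) :
    C.rowPart P z (L b) s t =
      arrow (P (L b) (z.count (L b))) (P (L b) (z.count (L b) + 1)) (C.d (L b)) s t
      + arrow (P (L b) (z.count (L b) + 1)) (P (L !b) (z.count (L !b)))
          (|C.d (L b) * C.a (L b) (L !b)| / 2) s t
      + arrow (P (L !b) (z.count (L !b))) (P (L b) (z.count (L b)))
          (|C.d (L b) * C.a (L b) (L !b)| / 2) s t
      + (C.outerPart P x L (L b) (P (L b) (z.count (L b) + 1)) s t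
        - C.outerPart P x L (L b) (P (L b) (z.count (L b))) s t) := by
  have hb : L (!b) ∈ Finset.univ.erase (L b) := by
    cases b <;> simp [hL, hL.symm]
  have he : (Finset.univ.erase (L b)).erase (L !b) =
      Finset.univ.filter fun c => c ≠ L true ∧ c ≠ L false := by
    ext c
    cases b <;> simp [and_comm]
  rw [rowPart, elementary, ← Finset.add_sum_erase _ _ hb, he, outerPart, outerPart,
    ← Finset.sum_sub_distrib]
  rw [Finset.sum_congr rfl (g := fun c =>
    arrow (P (L b) (z.count (L b) + 1)) (P c (x.count c)) (|C.d (L b) * C.a (L b) c| / 2) s t -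
      arrow (P (L b) (z.count (L b))) (P c (x.count c)) (|C.d (L b) * C.a (L b) c| / 2) s t)]
  · ring
  · intro c hc
    obtain ⟨h1, h2⟩ := (Finset.mem_filter.mp hc).2
    rw [hz c h1 h2, arrow_swap (P c _) (P (L b) _)]
    ring

/-- In the sum of the elementary quivers of the letters of a window, the arrows to the rows of other
letters telescope. -/
theorem splitSum_rowPart (C : SimpleCartanDatum I) (P : I → ℤ → Node I) (x : List I)
    {L : Bool → I} (hL : L true ≠ L false) {τ : Node I → Fin 11} {place : Bool → ℕ → Fin 11}
    {d : Bool → ℤ} {r : ℤ} {S : ℚ} (hd : ∀ b, C.d (L b) = S * d b)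
    (hr : ∀ b, |C.d (L b) * C.a (L b) (L !b)| / 2 = S * r) (w : List Bool) (z : List I)
    (n : Bool → ℕ) (hz : ∀ c, c ≠ L true → c ≠ L false → z.count c = x.count c)
    (hn : ∀ b, z.count (L b) = x.count (L b) + n b)
    (hplace : ∀ b m, m ≤ n b + w.count b →
      ∀ u, τ u = place b m ↔ u = P (L b) (x.count (L b) + m)) (s t : Node I) :
    splitSum (fun a k _ => C.rowPart P (z ++ a) k s t) (w.map L) =
      S * localRow place d r w n (τ s) (τ t)
      + (C.outerPart P x L (L true) (P (L true) (x.count (L true) + (n true + w.count true))) s t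
        - C.outerPart P x L (L true) (P (L true) (x.count (L true) + n true)) s t)
      + (C.outerPart P x L (L false) (P (L false) (x.count (L false) + (n false + w.count false)))
          s t - C.outerPart P x L (L false) (P (L false) (x.count (L false) + n false)) s t) := by
  induction w generalizing z n with
  | nil => simp [splitSum, localRow]
  | cons b w ih =>
    have hLb : ∀ b' : Bool, L b' = L b ↔ b' = b := by
      intro b'
      cases b <;> cases b' <;> simp [hL, hL.symm]
    have hz' : ∀ c, c ≠ L true → c ≠ L false → (z ++ [L b]).count c = x.count c := by
      intro c h1 h2
      have : L b ≠ c := by cases b <;> simp [h1.symm, h2.symm]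
      simp [List.count_append, List.count_cons, hz c h1 h2, this]
    have hn' : ∀ b', (z ++ [L b]).count (L b') =
        x.count (L b') + Function.update n b (n b + 1) b' := by
      intro b'
      by_cases h : b' = b
      · subst h
        simp [List.count_append, hn]
        omega
      · have : L b ≠ L b' := fun h' => h ((hLb b').mp h'.symm)
        simp [List.count_append, List.count_cons, hn, this, h]
    have hp' : ∀ b' m, m ≤ Function.update n b (n b + 1) b' + w.count b' →
        ∀ u, τ u = place b' m ↔ u = P (L b') (x.count (L b') + m) := by
      intro b' m hm
      refine hplace b' m ?_
      by_cases h : b' = b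
      · subst h
        rw [Function.update_self] at hm
        rw [List.count_cons_self]
        omega
      · rw [Function.update_of_ne h] at hm
        rw [List.count_cons_of_ne (Ne.symm h)]
        exact hm
    have e := ih (z ++ [L b]) (Function.update n b (n b + 1)) hz' hn' hp'
    simp only [List.append_assoc, List.singleton_append] at e
    rw [List.map_cons, splitSum, e, List.append_nil, C.rowPart_eq P x z hL b hz s t, hr, hd,
      localRow]
    have hc : (b :: w).count b = w.count b + 1 := List.count_cons_self
    have hc' : (b :: w).count (!b) = w.count (!b) :=
      List.count_cons_of_ne (by cases b <;> simp)
    have p0 := hplace b (n b) (by omega)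
    have p1 := hplace b (n b + 1) (by omega)
    have p2 := hplace (!b) (n (!b)) (by omega)
    push_cast at p1
    rw [← add_assoc] at p1
    rw [hn b, hn (!b)]
    push_cast
    rw [localArrow_pull p0 p1, localArrow_pull p1 p2, localArrow_pull p2 p0]
    cases b
    · simp only [Function.update_self, Bool.not_false,
        Function.update_of_ne (by decide : (true : Bool) ≠ false)] at *
      rw [hc, hc']
      push_cast
      ring_nf
    · simp only [Function.update_self, Bool.not_true,
        Function.update_of_ne (by decide : (false : Bool) ≠ true)] at *
      rw [hc, hc']
      push_cast
      ring_nf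

end SimpleCartanDatum

/-! ### A window in the quiver of a triangle -/

theorem Node.arrow_add {I : Type*} (u v : Node I) (c c' : ℚ) (s t : Node I) :
    Node.arrow u v (c + c') s t = Node.arrow u v c s t + Node.arrow u v c' s t := by
  unfold Node.arrow
  split_ifs <;> ring

namespace SimpleCartanDatum

open Node

variable {I : Type*} [Fintype I] [DecidableEq I]

theorem form_eq_of_wordProd (C : SimpleCartanDatum I) {y : List I} {c k o l : I}
    (hc : C.wordProd y (simpleRoot c) = simpleRoot o)
    (hk : C.wordProd y (simpleRoot k) = simpleRoot l) : C.d c * C.a c k = C.d o * C.a o l := by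
  rw [← form_simpleRoot, ← form_simpleRoot, ← hc, ← hk, form_wordProd]

/-- The letters of a window give the arrows at their nodes `e_c^0` with the signs determined by `y`,
except that the arrow between the two nodes of the window changes its sign at the first letter. -/
theorem IsWindow.splitSum_sidePart {C : SimpleCartanDatum I} {u v t y : List I} {g l o : I}
    (h : C.IsWindow u v t y g l o) {τ : Node I → Fin 11} {A B : Fin 11} {S : ℚ} {r : ℤ}
    (hr : |C.d o * C.a o l| / 2 = S * r)
    (hA : ∀ u, τ u = A ↔ ∃ c, C.wordProd y (simpleRoot c) = simpleRoot o ∧ u = e c)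
    (hB : ∀ u, τ u = B ↔ ∃ c, C.wordProd y (simpleRoot c) = simpleRoot l ∧ u = e c)
    (s s' : Node I) :
    splitSum (fun _ k b => C.sidePart k (b ++ y) s s') u =
      S * localArrow A B r (τ s) (τ s') + C.sidePart l y s s' + C.sidePart o y s s' := by
  classical
  unfold sidePart
  rw [h.splitSum_ite (fun c _ _ b => ∑ k, arrow (e c) (e k)
      ((if 0 ≤ C.wordProd (b ++ y) (simpleRoot k) then -1 else 1) * (|C.d c * C.a c k| / 4)) s s'),
    Finset.sum_add_distrib]
  have e1 : ∀ c, (if C.wordProd y (simpleRoot c) = simpleRoot o then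
      ∑ k, arrow (e c) (e k) ((if 0 ≤ C.wordProd (t ++ y) (simpleRoot k) then -1 else 1) *
        (|C.d c * C.a c k| / 4)) s s' else 0) =
      (if C.wordProd y (simpleRoot c) = simpleRoot o then
        ∑ k, (if C.wordProd y (simpleRoot k) = simpleRoot l then
          arrow (e c) (e k) (S * r) s s' else 0) else 0) +
      (if C.wordProd y (simpleRoot c) = simpleRoot o then
        ∑ k, arrow (e c) (e k) ((if 0 ≤ C.wordProd y (simpleRoot k) then -1 else 1) *
        (|C.d c * C.a c k| / 4)) s s' else 0) := by
    intro c
    by_cases hc : C.wordProd y (simpleRoot c) = simpleRoot o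
    · simp only [hc, if_true]
      rw [← Finset.sum_add_distrib]
      refine Finset.sum_congr rfl fun k _ => ?_
      rw [if_congr (h.nonneg_tail_iff k) rfl rfl]
      by_cases hk : C.wordProd y (simpleRoot k) = simpleRoot l
      · have hkn : 0 ≤ C.wordProd y (simpleRoot k) := hk ▸ simpleRoot_nonneg l
        rw [if_neg (fun h' => h'.2 hk), if_pos hk, if_pos hkn, ← arrow_add, ← hr,
          C.form_eq_of_wordProd hc hk]
        congr 1
        ring
      · simp only [hk, ne_eq, not_false_eq_true, and_true, if_false, zero_add]
    · simp [hc]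
  rw [Finset.sum_congr (g := fun c => _) rfl fun c _ => e1 c, Finset.sum_add_distrib,
    localArrow_pull_sum_sum hA hB]
  simp only [List.nil_append]
  ring

theorem IsWindow.splitSum_attachPart {C : SimpleCartanDatum I} {u v t y : List I} {g l o : I}
    (h : C.IsWindow u v t y g l o) (P : I → ℤ → Node I) (x : List I) {τ : Node I → Fin 11}
    {A B l₀ l₁ g₀ g₁ : Fin 11} {S : ℚ} {dl do' : ℤ} (hdl : C.d l = S * dl) (hdo : C.d o = S * do')
    (hA : ∀ u, τ u = A ↔ ∃ c, C.wordProd y (simpleRoot c) = simpleRoot o ∧ u = e c)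
    (hB : ∀ u, τ u = B ↔ ∃ c, C.wordProd y (simpleRoot c) = simpleRoot l ∧ u = e c)
    (hl₁ : ∀ z, τ z = l₁ ↔ z = P l ((x ++ v).count l + 1))
    (hl₀ : ∀ z, τ z = l₀ ↔ z = P l ((x ++ v).count l))
    (hg₁ : ∀ z, τ z = g₁ ↔ z = P g (x.count g + 1)) (hg₀ : ∀ z, τ z = g₀ ↔ z = P g (x.count g))
    (s s' : Node I) :
    splitSum (fun a k b => C.attachPart P (x ++ a) k (b ++ y) s s') u =
      S * (localArrow l₁ B dl (τ s) (τ s') + localArrow B l₀ dl (τ s) (τ s')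
        + localArrow g₁ A do' (τ s) (τ s') + localArrow A g₀ do' (τ s) (τ s')) := by
  classical
  have flip : ∀ (X Y : Fin 11) (c : ℤ) (a b : Fin 11),
      localArrow X Y c a b = -localArrow Y X c a b := by
    intro X Y c a b
    simp [localArrow]
  unfold attachPart
  rw [h.splitSum_ite (fun c a k _ => arrow (P k ((x ++ a).count k + 1)) (e c) (C.d c) s s' +
    arrow (e c) (P k ((x ++ a).count k)) (C.d c) s s'), Finset.sum_add_distrib]
  have e1 : ∀ (q m : I) (n₁ n₀ : Node I) (Q : Fin 11) (X₁ X₀ : Fin 11) (D : ℤ), C.d q = S * D →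
      (∀ u, τ u = Q ↔ ∃ c, C.wordProd y (simpleRoot c) = simpleRoot q ∧ u = e c) →
      (∀ z, τ z = X₁ ↔ z = n₁) → (∀ z, τ z = X₀ ↔ z = n₀) →
      (∑ c, if C.wordProd y (simpleRoot c) = simpleRoot q then
        arrow n₁ (e c) (C.d c) s s' + arrow (e c) n₀ (C.d c) s s' else 0) =
      S * (localArrow X₁ Q D (τ s) (τ s') + localArrow Q X₀ D (τ s) (τ s')) := by
    intro q m n₁ n₀ Q X₁ X₀ D hD hQ h₁ h₀
    rw [flip Q X₀, Int.cast_neg, mul_add, mul_neg, ← sub_eq_add_neg,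
      ← localArrow_pull_sum h₁ hQ, ← localArrow_pull_sum h₀ hQ, ← Finset.sum_sub_distrib]
    refine Finset.sum_congr rfl fun c _ => ?_
    by_cases hc : C.wordProd y (simpleRoot c) = simpleRoot q
    · simp only [hc, if_true]
      rw [C.d_eq_of_wordProd hc, hD, arrow_swap (e c) n₀]
      ring
    · simp [hc]
  rw [e1 l l _ _ B l₁ l₀ dl hdl hB hl₁ hl₀, e1 o g _ _ A g₁ g₀ do' hdo hA
    (by simpa using hg₁) (by simpa using hg₀)]
  ring

/-- The part of the quiver of a triangle for the word `x ++ u ++ y` which a change of the window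
`u` does not affect. -/
noncomputable def restWeight (C : SimpleCartanDatum I) (P : I → ℤ → Node I) (x u y : List I)
    (L : Bool → I) (s t : Node I) : ℚ :=
  splitSum (fun a k b => C.rowPart P a k s t + C.attachPart P a k (b ++ (u ++ y)) s t +
      C.sidePart k (b ++ (u ++ y)) s t) x
  + (C.outerPart P x L (L true) (P (L true) ((x ++ u).count (L true))) s t
    - C.outerPart P x L (L true) (P (L true) (x.count (L true))) s t)
  + (C.outerPart P x L (L false) (P (L false) ((x ++ u).count (L false))) s t
    - C.outerPart P x L (L false) (P (L false) (x.count (L false))) s t)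
  + (C.sidePart (L true) y s t + C.sidePart (L false) y s t)
  + splitSum (fun a k b => C.rowPart P (x ++ u ++ a) k s t + C.attachPart P (x ++ u ++ a) k b s t +
      C.sidePart k b s t) y

/-- The quiver of a triangle is the finite quiver of a window and the rest. -/
theorem triangleWeight_eq (C : SimpleCartanDatum I) (P : I → ℤ → Node I) (x y : List I)
    {L : Bool → I} (hL : L true ≠ L false) {τ : Node I → Fin 11} {place : Bool → ℕ → Fin 11}
    {d : Bool → ℤ} {r : ℤ} {S : ℚ} (hd : ∀ b, C.d (L b) = S * d b)
    (hr : ∀ b, |C.d (L b) * C.a (L b) (L !b)| / 2 = S * r) {w : List Bool} {v t : List I}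
    {g l : Bool} (h : C.IsWindow (w.map L) v t y (L g) (L l) (L !l))
    (hside : ∀ b u, τ u = sidePlace b ↔
      ∃ c, C.wordProd y (simpleRoot c) = simpleRoot (L b) ∧ u = e c)
    (hplace : ∀ b m, m ≤ w.count b →
      ∀ u, τ u = place b m ↔ u = P (L b) (x.count (L b) + m)) (s s' : Node I) :
    C.triangleWeight P (x ++ w.map L ++ y) s s' =
      S * localWeight place d r w g l (τ s) (τ s') + C.restWeight P x (w.map L) y L s s' := by
  have hLi : Function.Injective L := by
    intro a b hab
    cases a <;> cases b <;> simp_all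
  have hcount : ∀ b, (w.map L).count (L b) = w.count b := fun b =>
    List.count_map_of_injective w L hLi b
  have hvl : v.count (L l) + 1 = w.count l := by
    rw [← hcount, h.eq_append]
    simp
  have hg : 0 < w.count g := by
    rw [← hcount, h.eq_cons, List.count_cons_self]
    omega
  have hrow := C.splitSum_rowPart P x hL hd hr w x (fun _ => 0) (fun _ _ _ => rfl) (by simp)
    (by simpa using hplace) s s'
  have hatt := h.splitSum_attachPart P x (hd l) (hd (!l)) (hside (!l)) (hside l)
    (l₁ := place l (w.count l)) (l₀ := place l (w.count l - 1)) (g₁ := place g 1)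
    (g₀ := place g 0) (by
      intro z
      rw [hplace l _ le_rfl z, List.count_append, ← hvl]
      push_cast
      rw [add_assoc]) (by
      intro z
      rw [hplace l _ (by omega) z, List.count_append, ← hvl]
      push_cast
      simp) (by simpa using hplace g 1 (by omega)) (by simpa using hplace g 0 (by omega)) s s'
  have hr' : |C.d (L !l) * C.a (L !l) (L l)| / 2 = S * r := by
    have := hr (!l)
    rwa [Bool.not_not] at this
  have hsid := h.splitSum_sidePart hr' (hside (!l)) (hside l) s s'
  have hsum : C.sidePart (L l) y s s' + C.sidePart (L !l) y s s' =
      C.sidePart (L true) y s s' + C.sidePart (L false) y s s' := by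
    cases l
    · exact add_comm _ _
    · rfl
  have hwin : splitSum (fun a k b => C.rowPart P (x ++ a) k s s' +
      C.attachPart P (x ++ a) k (b ++ y) s s' + C.sidePart k (b ++ y) s s') (w.map L) =
      splitSum (fun a k _ => C.rowPart P (x ++ a) k s s') (w.map L) +
      splitSum (fun a k b => C.attachPart P (x ++ a) k (b ++ y) s s') (w.map L) +
      splitSum (fun _ k b => C.sidePart k (b ++ y) s s') (w.map L) := by
    rw [splitSum_add, splitSum_add]
  rw [triangleWeight, splitSum_append, splitSum_append]
  simp only [List.append_assoc]
  rw [hwin, hrow, hatt, hsid, restWeight, localWeight, localSide,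
    List.count_append, List.count_append, hcount, hcount, ← hsum]
  simp only [List.append_assoc]
  push_cast
  simp only [Nat.cast_zero, add_zero, zero_add]
  ring

/-- The rest depends on the window only through its Weyl group element and the names of the nodes
outside of its interior. -/
theorem restWeight_congr (C : SimpleCartanDatum I) {P P' : I → ℤ → Node I} {x u u' y : List I}
    {L : Bool → I} (hprod : C.wordProd u = C.wordProd u')
    (hx : ∀ c (k : ℤ), 0 ≤ k → k ≤ x.count c → P' c k = P c k)
    (hy : ∀ c k, 0 ≤ k → P' c ((x ++ u').count c + k) = P c ((x ++ u).count c + k))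
    (s t : Node I) : C.restWeight P' x u' y L s t = C.restWeight P x u y L s t := by
  have hx0 : ∀ c, P' c (x.count c) = P c (x.count c) := fun c => hx c _ (by omega) le_rfl
  have hy0 : ∀ c, P' c ((x ++ u').count c) = P c ((x ++ u).count c) := fun c => by
    simpa using hy c 0 le_rfl
  have hprod' : ∀ b, C.wordProd (b ++ (u' ++ y)) = C.wordProd (b ++ (u ++ y)) := by
    intro b
    simp only [wordProd_append, hprod]
  unfold restWeight
  have h1 : ∀ k v, C.outerPart P' x L k v s t = C.outerPart P x L k v s t := by
    intro k v
    simp only [outerPart, hx0]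
  simp only [h1, hx0, hy0]
  congr 1
  · congr 3
    refine splitSum_congr ?_
    rintro a k b rfl
    have e0 : ∀ c, P' c (a.count c) = P c (a.count c) := fun c => by
      refine hx c _ (by omega) ?_
      rw [List.count_append]
      push_cast
      omega
    have e1 : P' k (a.count k + 1) = P k (a.count k + 1) := by
      refine hx k _ (by omega) ?_
      rw [List.count_append, List.count_cons_self]
      push_cast
      omega
    simp only [rowPart, attachPart, sidePart, e0, e1]
    rw [hprod']
  · refine splitSum_congr fun a k b _ => ?_
    have e0 : ∀ c, P' c ((x ++ u' ++ a).count c) = P c ((x ++ u ++ a).count c) := fun c => by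
      rw [List.count_append, List.count_append (l₁ := x ++ u)]
      push_cast
      exact hy c _ (by omega)
    have e1 : P' k ((x ++ u' ++ a).count k + 1) = P k ((x ++ u ++ a).count k + 1) := by
      rw [List.count_append, List.count_append (l₁ := x ++ u)]
      push_cast
      rw [add_assoc, add_assoc]
      exact hy k _ (by omega)
    simp only [rowPart, attachPart, e0, e1]

theorem outerPart_off (C : SimpleCartanDatum I) {P : I → ℤ → Node I} {x : List I} {L : Bool → I}
    {k : I} {v s : Node I} (t : Node I) (hv : s ≠ v)
    (hs : ∀ c, c ≠ L true → c ≠ L false → s ≠ P c (x.count c)) :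
    C.outerPart P x L k v s t = 0 := by
  refine Finset.sum_eq_zero fun c hc => ?_
  obtain ⟨h1, h2⟩ := (Finset.mem_filter.mp hc).2
  exact arrow_off t hv (hs c h1 h2)

theorem outerPart_skew (C : SimpleCartanDatum I) (P : I → ℤ → Node I) (x : List I) (L : Bool → I)
    (k : I) (v s t : Node I) : C.outerPart P x L k v s t = -C.outerPart P x L k v t s := by
  unfold outerPart
  rw [← Finset.sum_neg_distrib]
  exact Finset.sum_congr rfl fun c _ => arrow_skew _ _ _ s t

theorem restWeight_skew (C : SimpleCartanDatum I) (P : I → ℤ → Node I) (x u y : List I)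
    (L : Bool → I) (s t : Node I) :
    C.restWeight P x u y L s t = -C.restWeight P x u y L t s := by
  have h : ∀ z b w, splitSum (fun a k b' => C.rowPart P (z ++ a) k s t +
      C.attachPart P (z ++ a) k (b' ++ b) s t + C.sidePart k (b' ++ b) s t) w =
      -splitSum (fun a k b' => C.rowPart P (z ++ a) k t s +
      C.attachPart P (z ++ a) k (b' ++ b) t s + C.sidePart k (b' ++ b) t s) w := by
    intro z b w
    rw [← splitSum_neg]
    refine splitSum_congr fun x j y _ => ?_
    rw [rowPart, elementary_skew, attachPart_skew, sidePart_skew, rowPart]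
    ring
  have h1 := h [] (u ++ y) x
  have h2 := h (x ++ u) [] y
  simp only [List.nil_append] at h1
  simp only [List.append_nil] at h2
  unfold restWeight
  rw [h1, h2]
  simp only [outerPart_skew C P x L _ _ s t, sidePart_skew C _ y s t]
  ring

/-- The nodes in the interior of a window have arrows only inside of the window. -/
theorem restWeight_off (C : SimpleCartanDatum I) (x u y : List I) (L : Bool → I) (b : Bool)
    {m : ℤ} (h0 : 0 < m) (h1 : m < u.count (L b)) (t : Node I) :
    C.restWeight f x u y L (f (L b) (x.count (L b) + m)) t = 0 := by
  have hs : ∀ i, f (L b) (x.count (L b) + m) ≠ e i := fun i h => by cases h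
  have hcur : ∀ c, f (L b) (x.count (L b) + m) ≠ f c (x.count c) := by
    intro c h
    rw [f.injEq] at h
    obtain ⟨rfl, h⟩ := h
    omega
  have hend : ∀ c, f (L b) (x.count (L b) + m) ≠ f c ((x ++ u).count c) := by
    intro c h
    rw [f.injEq] at h
    obtain ⟨rfl, h⟩ := h
    rw [List.count_append] at h
    push_cast at h
    omega
  have hA := C.splitSum_off (P := f) (w := x) [] (u ++ y) t hs (by
    intro c k _ hk h
    rw [f.injEq] at h
    obtain ⟨rfl, h⟩ := h
    simp at hk
    omega)
  have hY := C.splitSum_off (P := f) (w := y) (x ++ u) [] t hs (by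
    intro c k hk _ h
    rw [f.injEq] at h
    obtain ⟨rfl, h⟩ := h
    rw [List.count_append] at hk
    push_cast at hk
    omega)
  simp only [List.nil_append] at hA
  simp only [List.append_nil] at hY
  rw [restWeight, hA, hY, outerPart_off C t (hend _) (fun c _ _ => hcur c),
    outerPart_off C t (hcur _) (fun c _ _ => hcur c),
    outerPart_off C t (hend _) (fun c _ _ => hcur c),
    outerPart_off C t (hcur _) (fun c _ _ => hcur c), sidePart_off C t hs, sidePart_off C t hs]
  simp

/-- A renaming of the nodes that keeps the nodes `e_i^0`. -/
theorem triangleWeight_map (C : SimpleCartanDatum I) (P : I → ℤ → Node I) (w : List I)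
    {σ : Equiv.Perm (Node I)} (hσ : ∀ i, σ (e i) = e i) (s t : Node I) :
    C.triangleWeight (fun c k => σ (P c k)) w (σ s) (σ t) = C.triangleWeight P w s t := by
  unfold triangleWeight
  refine splitSum_congr fun x j y _ => ?_
  have h1 : ∀ (a : Node I) i c, arrow (σ a) (e i) c (σ s) (σ t) = arrow a (e i) c s t := by
    intro a i c
    rw [← arrow_map σ a (e i), hσ]
  have h2 : ∀ (a : Node I) i c, arrow (e i) (σ a) c (σ s) (σ t) = arrow (e i) a c s t := by
    intro a i c
    rw [← arrow_map σ (e i) a, hσ]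
  have h3 : ∀ i k c, arrow (e i) (e k) c (σ s) (σ t) = arrow (e i : Node I) (e k) c s t := by
    intro i k c
    have h := arrow_map σ (e i) (e k) s t c
    rwa [hσ, hσ] at h
  simp only [rowPart, attachPart, sidePart, elementary, h1, h2, h3, arrow_map]

end SimpleCartanDatum

/-! ### Changes of words act on the quivers of triangles -/

/-- The weights of a finite quiver given by a list of arrows `(A, B, c)` of weight `c` from `A` to
`B`. -/
def localQuiver (l : List (Fin 11 × Fin 11 × ℤ)) (u v : Fin 11) : ℤ :=
  (l.map fun a => localArrow a.1 a.2.1 a.2.2 u v).sum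

/-- The arrows of the finite quivers which arise between the three mutations of the change of words
`i j i j → j i j i`. -/
def doublyArrows : ℕ → List (Fin 11 × Fin 11 × ℤ)
  | 0 => [(0, 1, 4), (1, 5, 4), (1, 9, 4), (2, 1, 4), (2, 6, 2), (4, 0, 2), (4, 6, 2), (5, 2, 4),
   (5, 4, 2), (5, 8, 2), (6, 5, 2), (8, 1, 4), (9, 0, 4), (9, 8, 2)]
  | 1 => [(0, 5, 4), (1, 0, 4), (1, 2, 4), (1, 8, 4), (2, 6, 2), (2, 9, 4), (4, 0, 2), (4, 6, 2),
   (5, 1, 4), (5, 4, 2), (6, 5, 2), (8, 5, 2), (8, 9, 2), (9, 1, 4)]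
  | _ => []

/-- The arrows of the finite quivers which arise between the eleven mutations of the change of words
`j i j i j i → i j i j i j`. -/
def triplyArrows : ℕ → List (Fin 11 × Fin 11 × ℤ)
  | 0 => [(0, 1, 6), (0, 4, 3), (1, 3, 6), (1, 5, 6), (2, 1, 6), (2, 7, 6), (2, 9, 6), (3, 2, 6),
   (4, 5, 2), (5, 0, 6), (5, 6, 2), (5, 8, 2), (6, 2, 6), (7, 3, 3), (7, 6, 4), (8, 4, 2),
   (8, 9, 3), (9, 6, 6)]
  | 1 => [(0, 3, 6), (0, 4, 3), (1, 0, 6), (1, 2, 6), (2, 5, 6), (2, 7, 6), (2, 9, 6), (3, 1, 6),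
   (4, 5, 2), (5, 1, 6), (5, 6, 2), (5, 8, 2), (6, 2, 6), (7, 3, 3), (7, 6, 4), (8, 4, 2),
   (8, 9, 3), (9, 6, 6)]
  | 2 => [(0, 3, 6), (0, 4, 3), (1, 0, 6), (1, 2, 6), (2, 6, 6), (3, 1, 6), (4, 5, 2), (5, 1, 6),
   (5, 8, 2), (6, 5, 2), (6, 7, 4), (6, 9, 6), (7, 2, 6), (7, 3, 3), (8, 4, 2), (8, 9, 3),
   (9, 2, 12)]
  | 3 => [(0, 3, 6), (0, 4, 3), (1, 0, 6), (1, 6, 6), (2, 1, 6), (2, 7, 6), (2, 9, 12), (3, 1, 6),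
   (4, 5, 2), (5, 1, 6), (5, 8, 2), (6, 2, 6), (6, 5, 2), (7, 3, 3), (7, 6, 2), (8, 4, 2),
   (8, 9, 3), (9, 6, 6)]
  | 4 => [(0, 3, 6), (0, 4, 3), (1, 0, 6), (1, 2, 12), (2, 6, 6), (3, 1, 6), (4, 5, 2), (5, 6, 2),
   (5, 8, 2), (6, 1, 6), (6, 7, 2), (6, 9, 6), (7, 3, 3), (7, 5, 2), (8, 4, 2), (8, 9, 3),
   (9, 2, 6), (9, 5, 6)]
  | 5 => [(0, 3, 6), (0, 4, 3), (1, 0, 6), (1, 2, 12), (2, 6, 6), (3, 1, 6), (4, 6, 2), (5, 4, 2),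
   (5, 7, 2), (5, 9, 6), (6, 1, 6), (6, 5, 2), (7, 3, 3), (7, 8, 2), (8, 5, 2), (9, 2, 6),
   (9, 8, 3)]
  | 6 => [(0, 3, 6), (0, 4, 3), (1, 0, 6), (1, 6, 6), (2, 1, 6), (2, 5, 6), (3, 1, 6), (4, 1, 6),
   (5, 6, 2), (5, 7, 2), (5, 9, 6), (6, 2, 6), (6, 4, 2), (7, 3, 3), (7, 8, 2), (8, 5, 2),
   (9, 2, 6), (9, 8, 3)]
  | 7 => [(0, 3, 6), (0, 4, 3), (1, 0, 6), (1, 2, 6), (2, 6, 6), (2, 9, 6), (3, 1, 6), (4, 1, 6),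
   (5, 2, 6), (5, 7, 2), (6, 4, 2), (6, 5, 4), (7, 3, 3), (7, 8, 2), (8, 5, 2), (9, 1, 6),
   (9, 8, 3)]
  | 8 => [(0, 1, 6), (1, 3, 6), (1, 4, 6), (1, 9, 6), (2, 1, 6), (2, 6, 6), (3, 2, 6), (4, 0, 3),
   (4, 2, 6), (5, 2, 6), (5, 7, 2), (6, 4, 2), (6, 5, 4), (7, 3, 3), (7, 8, 2), (8, 5, 2),
   (9, 0, 6), (9, 8, 3)]
  | 9 => [(0, 1, 6), (1, 3, 6), (1, 4, 6), (1, 9, 6), (2, 1, 6), (2, 5, 6), (3, 2, 6), (4, 0, 3),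
   (4, 6, 2), (5, 6, 4), (5, 7, 2), (6, 2, 6), (7, 3, 3), (7, 8, 2), (8, 5, 2), (9, 0, 6),
   (9, 8, 3)]
  | _ => []

/-- The positions of the nodes of the window `j i j` with the names which they have before the
change of words `i j i → j i j`. -/
def shiftPlace : Bool → ℕ → Fin 11
  | true, 0 => 0
  | true, _ => 2
  | false, 0 => 4
  | false, 1 => 1
  | false, _ => 5

/-- The positions of the nodes of the window `i j i j i j` with the names which they have before
the change of words `j i j i j i → i j i j i j`. -/
def exchangePlace : Bool → ℕ → Fin 11
  | false, 1 => 6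
  | false, 2 => 5
  | b, m => stdPlace b m

namespace SimpleCartanDatum

open Node

variable {I : Type*} [Fintype I] [DecidableEq I]

/-- The two letters of a window. -/
abbrev letters (i j : I) (b : Bool) : I := cond b i j

section WindowMove

variable (C : SimpleCartanDatum I) (x y : List I) {i j : I}

/-- The position of a node in the window between `x` and `y`. -/
noncomputable abbrev windowIndex (i j : I) : Node I → Fin 11 :=
  C.localIndex y (letters i j) fun b => x.count (letters i j b)

theorem hasLocalWeight_triangleQuiver (hij : i ≠ j) {d : Bool → ℤ} {r : ℤ} {S : ℚ}
    (hd : ∀ b, C.d (letters i j b) = S * d b)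
    (hr : ∀ b, |C.d (letters i j b) * C.a (letters i j b) (letters i j !b)| / 2 = S * r)
    {w : List Bool} {v t : List I} {g l : Bool}
    (h : C.IsWindow (w.map (letters i j)) v t y (letters i j g) (letters i j l) (letters i j !l))
    (hw : ∀ b, w.count b ≤ 3) :
    HasLocalWeight (C.triangleQuiver (x ++ w.map (letters i j) ++ y)) S (C.windowIndex x y i j)
      (localWeight stdPlace d r w g l)
      (C.restWeight f x (w.map (letters i j)) y (letters i j)) := by
  intro s s'
  exact C.triangleWeight_eq f x y (L := letters i j) hij hd hr h
    (fun b u => C.localIndex_eq_sidePlace y hij _ b u)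
    (fun b m hm u => C.localIndex_eq_stdPlace y hij _ b (hm.trans (hw b)) u) s s'

theorem count_window (hij : i ≠ j) (w : List Bool) (b : Bool) :
    (w.map (letters i j)).count (letters i j b) = w.count b := by
  refine List.count_map_of_injective w (letters i j) ?_ b
  intro b b' hb
  cases b <;> cases b' <;> simp_all

/-- A mutation at a node in the interior of a window, computed in the finite quiver. -/
theorem hasLocalWeight_mutate (hij : i ≠ j) {d : Bool → ℤ} {S : ℚ} (hS : 0 < S)
    (hd : ∀ b, C.d (letters i j b) = S * d b) {w : List Bool} (hw : ∀ b, w.count b ≤ 3)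
    {Q : WeightedQuiver (Node I)}
    (hQ : Q.mult = C.triangleMult (x ++ w.map (letters i j) ++ y)) {W : Fin 11 → Fin 11 → ℤ}
    (h : HasLocalWeight Q S (C.windowIndex x y i j) W
      (C.restWeight f x (w.map (letters i j)) y (letters i j)))
    (b : Bool) (m : ℕ) (h0 : 0 < m) (h1 : m < w.count b) {W' : Fin 11 → Fin 11 → ℤ}
    (hW : IsMutation (stdPlace b m) (d b) W W') {k : Node I}
    (hk : k = f (letters i j b) (x.count (letters i j b) + m)) :
    HasLocalWeight (Q.mutate k) S
      (C.windowIndex x y i j) W'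
      (C.restWeight f x (w.map (letters i j)) y (letters i j)) := by
  subst hk
  have hoff := C.restWeight_off x (w.map (letters i j)) y (letters i j) b (m := m)
    (by omega) (by rw [count_window hij]; omega)
  refine h.mutate hS (fun u => C.localIndex_eq_stdPlace y hij _ b (by have := hw b; omega) u)
    (m := d b) ?_ ?_ hoff (fun u => by rw [restWeight_skew, hoff, neg_zero]) hW
  · have h2 := C.d_pos (letters i j b)
    rw [hd] at h2
    exact_mod_cast pos_of_mul_pos_right h2 hS.le
  · rw [hQ, triangleMult, if_pos, hd]
    rw [List.count_append, List.count_append, count_window hij]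
    push_cast
    omega

/-- The quiver after a change of words, in terms of the names `σ v` which its nodes `v` have
before. -/
theorem triangleWeight_change (hij : i ≠ j) {d : Bool → ℤ} {r : ℤ} {S : ℚ}
    (hd : ∀ b, C.d (letters i j b) = S * d b)
    (hr : ∀ b, |C.d (letters i j b) * C.a (letters i j b) (letters i j !b)| / 2 = S * r)
    {w w' : List Bool} {v t : List I} {g l : Bool}
    (h : C.IsWindow (w'.map (letters i j)) v t y (letters i j g) (letters i j l) (letters i j !l))
    (hprod : C.wordProd (w.map (letters i j)) = C.wordProd (w'.map (letters i j)))
    {place : Bool → ℕ → Fin 11} {σ : Equiv.Perm (Node I)} (hσ : ∀ c, σ (e c) = e c)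
    (hplace : ∀ b m, m ≤ w'.count b → ∃ b' m', m' ≤ 3 ∧ place b m = stdPlace b' m' ∧
      σ (f (letters i j b) (x.count (letters i j b) + m)) =
        f (letters i j b') (x.count (letters i j b') + m'))
    (hx : ∀ c (k : ℤ), 0 ≤ k → k ≤ x.count c → σ (f c k) = f c k)
    (hy : ∀ c (k : ℤ), 0 ≤ k → σ (f c ((x ++ w'.map (letters i j)).count c + k)) =
      f c ((x ++ w.map (letters i j)).count c + k)) (s s' : Node I) :
    C.triangleWeight f (x ++ w'.map (letters i j) ++ y) s s' =
      S * localWeight place d r w' g l (C.windowIndex x y i j (σ s)) (C.windowIndex x y i j (σ s'))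
        + C.restWeight f x (w.map (letters i j)) y (letters i j) (σ s) (σ s') := by
  rw [← C.triangleWeight_map f _ hσ, C.triangleWeight_eq (fun c k => σ (f c k)) x y
    (L := letters i j) hij hd hr h (fun b u => C.localIndex_eq_sidePlace y hij _ b u)
    (place := place), C.restWeight_congr (P := f) hprod hx hy]
  intro b m hm u
  obtain ⟨b', m', hm', hp, hs⟩ := hplace b m hm
  rw [hp, hs]
  exact C.localIndex_eq_stdPlace y hij _ b' hm' u

end WindowMove

theorem wordProd_eq_of_append {C : SimpleCartanDatum I} {x u u' y : List I}
    (h : C.wordProd (x ++ u ++ y) = C.wordProd (x ++ u' ++ y)) : C.wordProd u = C.wordProd u' := by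
  refine LinearMap.ext fun z => ?_
  have h1 := LinearMap.congr_fun h (C.wordProd y.reverse z)
  simp only [wordProd_append_apply, wordProd_mul_reverse] at h1
  exact C.wordProd_injective x h1

theorem triangleQuiver_ext (C : SimpleCartanDatum I) {Q : WeightedQuiver (Node I)} {w : List I}
    (h1 : Q.verts = triangleVerts w)
    (h2 : Q.frozen = {v | ∃ i, v = e i ∨ v = f i 0 ∨ v = f i (w.count i)})
    (h3 : Q.mult = C.triangleMult w) (h4 : Q.weight = C.triangleWeight f w) :
    Q = C.triangleQuiver w :=
  WeightedQuiver.ext h1 h2 h3 h4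

theorem f_mem_frozen (C : SimpleCartanDatum I) {w : List I} {c : I} {t : ℤ} :
    f c t ∈ (C.triangleQuiver w).frozen ↔ t = 0 ∨ t = w.count c := by
  simp only [triangleQuiver, Set.mem_setOf_eq, reduceCtorEq, false_or, f.injEq]
  constructor
  · rintro ⟨i, ⟨rfl, h⟩ | ⟨rfl, h⟩⟩
    · exact Or.inl h
    · exact Or.inr h
  · rintro (h | h)
    · exact ⟨c, Or.inl ⟨rfl, h⟩⟩
    · exact ⟨c, Or.inr ⟨rfl, h⟩⟩

theorem e_mem_frozen (C : SimpleCartanDatum I) (w : List I) (c : I) :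
    e c ∈ (C.triangleQuiver w).frozen := ⟨c, Or.inl rfl⟩

theorem act_swap (C : SimpleCartanDatum I) (x y : List I) (i j : I) (hij : i ≠ j)
    (h : C.a i j = 0) (hw : C.IsReduced (x ++ [i, j] ++ y)) :
    C.triangleQuiver (x ++ [i, j] ++ y) = C.triangleQuiver (x ++ [j, i] ++ y) := by
  have m := Move.swap (C := C) x y i j hij h
  obtain ⟨h1, h2⟩ := isWindow_swap hij h hw (m.isReduced hw)
  have hcount : ∀ c, (x ++ [i, j] ++ y).count c = (x ++ [j, i] ++ y).count c := fun c => by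
    simp only [List.count_append, List.count_cons, List.count_nil]
    omega
  -- a common denominator of the two multipliers
  set S : ℚ := 1 / ((C.d i).den * (C.d j).den) with hS
  have hi0 : ((C.d i).den : ℚ) ≠ 0 := by exact_mod_cast (C.d i).den_nz
  have hj0 : ((C.d j).den : ℚ) ≠ 0 := by exact_mod_cast (C.d j).den_nz
  set d : Bool → ℤ := fun b =>
    cond b ((C.d i).num * (C.d j).den) ((C.d j).num * (C.d i).den) with hd'
  have hd : ∀ b, C.d (letters i j b) = S * d b := by
    intro b
    cases b
    · simp only [letters, cond_false, hd', hS]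
      push_cast
      field_simp
      exact (Rat.mul_den_eq_num _).symm ▸ rfl
    · simp only [letters, cond_true, hd', hS]
      push_cast
      field_simp
      exact (Rat.mul_den_eq_num _).symm ▸ rfl
  have hr : ∀ b, |C.d (letters i j b) * C.a (letters i j b) (letters i j !b)| / 2 =
      S * (0 : ℤ) := by
    intro b
    cases b <;> simp [letters, h, C.a_eq_zero_comm h]
  have e1 := C.hasLocalWeight_triangleQuiver x y hij hd hr (w := [true, false]) (g := true)
    (l := false) h1 (by decide)
  have e2 := C.triangleWeight_change x y hij hd hr (w := [true, false]) (w' := [false, true])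
    (g := false) (l := true) h2 (wordProd_eq_of_append m.wordProd_eq) (place := stdPlace)
    (σ := Equiv.refl _) (fun _ => rfl)
    (fun b m hm => ⟨b, m, hm.trans (by cases b <;> decide), rfl, rfl⟩) (fun _ _ _ _ => rfl)
    (fun c k _ => by
      simp only [List.map_cons, List.map_nil, letters, cond_true, cond_false, Equiv.refl_apply,
        List.count_append, List.count_cons, List.count_nil, f.injEq, true_and]
      omega)
  refine C.triangleQuiver_ext ?_ ?_ ?_ ?_
  · simp only [triangleQuiver, triangleVerts, hcount]
  · simp only [triangleQuiver, hcount]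
  · funext v
    cases v <;> simp only [triangleQuiver, triangleMult, hcount]
  · funext s s'
    refine (e1 s s').trans ((e2 s s').trans ?_).symm
    congr 3
    simp only [localWeight, localRow, localSide, Equiv.refl_apply]
    simp [localArrow]
    ring

theorem shift_of_lt (i j : I) (hij : i ≠ j) (k l : ℤ) {c : I} {t : ℤ} (hi : c = i → t < k)
    (hj : c = j → t < l) : shift i j hij k l (f c t) = f c t := by
  simp only [shift, Equiv.coe_fn_mk]
  grind

/-- The new names of the nodes in the window are accounted for by `shiftPlace`. -/
theorem act_simply (C : SimpleCartanDatum I) (x y : List I) (i j : I) (hij : i ≠ j)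
    (h : C.a i j = -1) (h' : C.a j i = -1) (hw : C.IsReduced (x ++ [i, j, i] ++ y)) :
    (Move.simply x y i j hij h h').act (C.triangleQuiver (x ++ [i, j, i] ++ y)) =
      C.triangleQuiver (x ++ [j, i, j] ++ y) := by
  have m := Move.simply (C := C) x y i j hij h h'
  obtain ⟨h1, h2⟩ := isWindow_simply hij h h' hw (m.isReduced hw)
  have hij' := hij.symm
  have hdd : C.d j = C.d i := by
    have := C.symm i j
    rw [h, h'] at this
    push_cast at this
    linarith
  have hdi := C.d_pos i
  have hci : ((x ++ [j, i, j] ++ y).count i : ℤ) = (x ++ [i, j, i] ++ y).count i - 1 := by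
    simp [List.count_append, List.count_cons, hij, hij']
    ring
  have hcj : ((x ++ [j, i, j] ++ y).count j : ℤ) = (x ++ [i, j, i] ++ y).count j + 1 := by
    simp [List.count_append, List.count_cons, hij, hij']
    ring
  have hcc : ∀ c, c ≠ i → c ≠ j →
      (x ++ [j, i, j] ++ y).count c = (x ++ [i, j, i] ++ y).count c := by
    intro c hi hj
    simp [List.count_append, List.count_cons, hi.symm, hj.symm]
  have hki : (x.count i : ℤ) + 2 ≤ (x ++ [i, j, i] ++ y).count i := by
    simp [List.count_append, List.count_cons, hij, hij']
    omega
  have hkj : (x.count j : ℤ) + 1 ≤ (x ++ [i, j, i] ++ y).count j := by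
    simp [List.count_append, List.count_cons, hij, hij']
  set S : ℚ := C.d i / 2 with hS'
  have hS : 0 < S := by positivity
  have hd : ∀ b, C.d (letters i j b) = S * ((fun _ => 2 : Bool → ℤ) b) := by
    intro b
    cases b
    · simp [letters, hS', hdd]
    · simp [letters, hS']
  have hr : ∀ b, |C.d (letters i j b) * C.a (letters i j b) (letters i j !b)| / 2 =
      S * (1 : ℤ) := by
    intro b
    cases b <;> simp [letters, h, h', hS', hdd, abs_of_pos hdi]
  have hcw : ∀ b : Bool, [true, false, true].count b ≤ 3 := by decide
  have q0 := C.hasLocalWeight_triangleQuiver x y hij hd hr (w := [true, false, true]) (g := true)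
    (l := true) h1 hcw
  have q1 := C.hasLocalWeight_mutate x y hij hS hd hcw rfl q0 true 1 (by decide) (by decide)
    (W' := localWeight shiftPlace (fun _ => 2) 1 [false, true, false] false false)
    (by decide +kernel)
    (k := f i (x.count i + 1)) rfl
  have e2 := C.triangleWeight_change x y hij hd hr (w := [true, false, true])
    (w' := [false, true, false]) (g := false) (l := false) h2 (wordProd_eq_of_append m.wordProd_eq)
    (place := shiftPlace) (σ := shift i j hij (x.count i + 1) (x.count j + 1)) (fun _ => rfl)
    (by
      intro b m hm
      cases b
      · have hm' : m ≤ 2 := hm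
        interval_cases m
        · exact ⟨false, 0, by decide, by decide, shift_of_lt i j hij _ _
            (fun hc => absurd hc hij') (fun _ => by simp)⟩
        · refine ⟨true, 1, by decide, by decide, ?_⟩
          simp [shift, letters, hij']
        · refine ⟨false, 1, by decide, by decide, ?_⟩
          simp [shift, letters, hij']
          ring
      · have hm' : m ≤ 1 := hm
        interval_cases m
        · exact ⟨true, 0, by decide, by decide, shift_of_lt i j hij _ _
            (fun _ => by simp) (fun hc => absurd hc hij)⟩
        · refine ⟨true, 2, by decide, by decide, ?_⟩
          simp [shift, letters]
          ring)
    (fun c k _ hk => shift_of_lt i j hij _ _ (fun hc => by subst hc; omega)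
      (fun hc => by subst hc; omega))
    (by
      intro c k hk
      simp only [List.map_cons, List.map_nil, letters, cond_true, cond_false, List.count_append,
        List.count_cons, List.count_nil, shift, Equiv.coe_fn_mk]
      grind)
  have hmem : ∀ v, shift i j hij (x.count i + 1) (x.count j + 1) v ∈
      triangleVerts (x ++ [i, j, i] ++ y) ↔ v ∈ triangleVerts (x ++ [j, i, j] ++ y) := by
    intro v
    cases v with
    | e c => exact iff_of_true (e_mem_triangleVerts _ c) (e_mem_triangleVerts _ c)
    | f c t =>
      rw [f_mem_triangleVerts]
      simp only [shift, Equiv.coe_fn_mk]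
      by_cases hi : c = i
      · subst hi
        rw [hci]
        simp only [↓reduceIte]
        split_ifs <;> rw [f_mem_triangleVerts] <;> omega
      · by_cases hj : c = j
        · subst hj
          rw [hcj]
          simp only [hi, if_false, if_true]
          split_ifs <;> rw [f_mem_triangleVerts] <;> omega
        · simp only [hi, hj, if_false]
          rw [hcc c hi hj, f_mem_triangleVerts]
  refine C.triangleQuiver_ext ?_ ?_ ?_ ?_
  · ext v
    exact hmem v
  · ext v
    change shift i j hij (x.count i + 1) (x.count j + 1) v ∈ (C.triangleQuiver _).frozen ↔
      v ∈ (C.triangleQuiver _).frozen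
    cases v with
    | e c => exact iff_of_true (C.e_mem_frozen _ c) (C.e_mem_frozen _ c)
    | f c t =>
      rw [f_mem_frozen]
      simp only [shift, Equiv.coe_fn_mk]
      by_cases hi : c = i
      · subst hi
        rw [hci]
        simp only [↓reduceIte]
        split_ifs <;> rw [f_mem_frozen] <;> omega
      · by_cases hj : c = j
        · subst hj
          rw [hcj]
          simp only [hi, if_false, if_true]
          split_ifs <;> rw [f_mem_frozen] <;> omega
        · simp only [hi, hj, if_false]
          rw [hcc c hi hj, f_mem_frozen]
  · funext v
    change C.triangleMult _ (shift i j hij (x.count i + 1) (x.count j + 1) v) = _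
    cases v with
    | e c => rfl
    | f c t =>
      simp only [shift, Equiv.coe_fn_mk]
      by_cases hi : c = i
      · subst hi
        simp only [↓reduceIte]
        split_ifs <;> simp only [triangleMult] <;> rw [hci] <;> split_ifs <;> first | rfl | omega
      · by_cases hj : c = j
        · subst hj
          simp only [hi, if_false, if_true]
          split_ifs <;> simp only [triangleMult] <;> rw [hcj] <;> split_ifs <;>
            first | rfl | omega | exact hdd.symm
        · simp only [hi, hj, if_false, triangleMult]
          rw [hcc c hi hj]
  · funext s s'
    refine (q1 _ _).trans (e2 s s').symm

theorem triangleQuiver_props (C : SimpleCartanDatum I) {w w' : List I}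
    (hc : ∀ c, w.count c = w'.count c) : triangleVerts w = triangleVerts w' ∧
      (C.triangleQuiver w).frozen = (C.triangleQuiver w').frozen ∧
      C.triangleMult w = C.triangleMult w' := by
  refine ⟨?_, ?_, ?_⟩
  · simp only [triangleVerts, hc]
  · simp only [triangleQuiver, hc]
  · funext v
    cases v <;> simp only [triangleMult, hc]

theorem act_doubly (C : SimpleCartanDatum I) (x y : List I) (i j : I) (hij : i ≠ j)
    (h : C.a i j = -1) (h' : C.a j i = -2) (hw : C.IsReduced (x ++ [i, j, i, j] ++ y)) :
    (Move.doubly x y i j hij h h').act (C.triangleQuiver (x ++ [i, j, i, j] ++ y)) =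
      C.triangleQuiver (x ++ [j, i, j, i] ++ y) := by
  have m := Move.doubly (C := C) x y i j hij h h'
  obtain ⟨h1, h2⟩ := isWindow_doubly hij h h' hw (m.isReduced hw)
  have hdd : C.d i = 2 * C.d j := by
    have := C.symm i j
    rw [h, h'] at this
    push_cast at this
    linarith
  have hdj := C.d_pos j
  have hcount : ∀ c, (x ++ [i, j, i, j] ++ y).count c = (x ++ [j, i, j, i] ++ y).count c :=
    fun c => by
      simp only [List.count_append, List.count_cons, List.count_nil]
      omega
  obtain ⟨p1, p2, p3⟩ := C.triangleQuiver_props hcount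
  set S : ℚ := C.d j / 2 with hS'
  have hS : 0 < S := by positivity
  have hd : ∀ b, C.d (letters i j b) = S * ((fun b => cond b 4 2 : Bool → ℤ) b) := by
    intro b
    cases b
    · simp [letters, hS']
    · simp [letters, hS', hdd]
      ring
  have hr : ∀ b, |C.d (letters i j b) * C.a (letters i j b) (letters i j !b)| / 2 =
      S * (2 : ℤ) := by
    intro b
    cases b <;> simp [letters, h, h', hS', hdd, abs_of_pos hdj] <;> ring
  have hcw : ∀ b : Bool, [true, false, true, false].count b ≤ 3 := by decide
  have q0 := C.hasLocalWeight_triangleQuiver x y hij hd hr (w := [true, false, true, false])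
    (g := true) (l := false) h1 hcw
  have q1 := C.hasLocalWeight_mutate x y hij hS hd hcw rfl q0 false 1 (by decide) (by decide)
    (W' := localQuiver (doublyArrows 0)) (by decide +kernel)
    (k := f j (x.count j + 1)) rfl
  have q2 := C.hasLocalWeight_mutate x y hij hS hd hcw rfl q1 true 1 (by decide) (by decide)
    (W' := localQuiver (doublyArrows 1)) (by decide +kernel)
    (k := f i (x.count i + 1)) rfl
  have q3 := C.hasLocalWeight_mutate x y hij hS hd hcw rfl q2 false 1 (by decide) (by decide)
    (W' := localWeight stdPlace (fun b => cond b 4 2) 2 [false, true, false, true] false true)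
    (by decide +kernel)
    (k := f j (x.count j + 1)) rfl
  have e2 := C.triangleWeight_change x y hij hd hr (w := [true, false, true, false])
    (w' := [false, true, false, true]) (g := false) (l := true) h2
    (wordProd_eq_of_append m.wordProd_eq) (place := stdPlace)
    (σ := Equiv.refl _) (fun _ => rfl)
    (fun b m hm => ⟨b, m, hm.trans (by cases b <;> decide), rfl, rfl⟩) (fun _ _ _ _ => rfl)
    (fun c k _ => by
      simp only [List.map_cons, List.map_nil, letters, cond_true, cond_false, Equiv.refl_apply,
        List.count_append, List.count_cons, List.count_nil, f.injEq, true_and]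
      omega)
  refine C.triangleQuiver_ext p1 p2 p3 ?_
  funext s s'
  exact (q3 s s').trans (e2 s s').symm

theorem relabel_weight {V : Type*} (σ : Equiv.Perm V) (Q : WeightedQuiver V) (u v : V) :
    (Q.relabel σ).weight u v = Q.weight (σ u) (σ v) := rfl

theorem exchange_left (j : I) (l : ℤ) : exchange j l (f j l) = f j (l + 1) := by
  unfold exchange
  exact @Equiv.swap_apply_left _ (_) _ _

theorem exchange_right (j : I) (l : ℤ) : exchange j l (f j (l + 1)) = f j l := by
  unfold exchange
  exact @Equiv.swap_apply_right _ (_) _ _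

theorem exchange_of_ne {j : I} {l : ℤ} {v : Node I} (h : v ≠ f j l) (h' : v ≠ f j (l + 1)) :
    exchange j l v = v := by
  unfold exchange
  exact @Equiv.swap_apply_of_ne_of_ne _ (_) _ _ _ h h'

theorem exchange_exchange (j : I) (l : ℤ) (v : Node I) :
    exchange j l (exchange j l v) = v := by
  unfold exchange
  exact @Equiv.swap_apply_self _ (_) _ _ v

theorem act_triply (C : SimpleCartanDatum I) (x y : List I) (i j : I) (hij : i ≠ j)
    (h : C.a i j = -1) (h' : C.a j i = -3) (hw : C.IsReduced (x ++ [j, i, j, i, j, i] ++ y)) :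
    (Move.triply x y i j hij h h').act (C.triangleQuiver (x ++ [j, i, j, i, j, i] ++ y)) =
      C.triangleQuiver (x ++ [i, j, i, j, i, j] ++ y) := by
  have m := Move.triply (C := C) x y i j hij h h'
  obtain ⟨h1, h2⟩ := isWindow_triply hij h h' hw (m.isReduced hw)
  have hdd : C.d i = 3 * C.d j := by
    have := C.symm i j
    rw [h, h'] at this
    push_cast at this
    linarith
  have hdj := C.d_pos j
  have hcount : ∀ c, (x ++ [j, i, j, i, j, i] ++ y).count c =
      (x ++ [i, j, i, j, i, j] ++ y).count c := fun c => by
    simp only [List.count_append, List.count_cons, List.count_nil]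
    omega
  obtain ⟨p1, p2, p3⟩ := C.triangleQuiver_props hcount
  set S : ℚ := C.d j / 2 with hS'
  have hS : 0 < S := by positivity
  have hd : ∀ b, C.d (letters i j b) = S * ((fun b => cond b 6 2 : Bool → ℤ) b) := by
    intro b
    cases b
    · simp [letters, hS']
    · simp [letters, hS', hdd]
      ring
  have hr : ∀ b, |C.d (letters i j b) * C.a (letters i j b) (letters i j !b)| / 2 =
      S * (3 : ℤ) := by
    intro b
    cases b <;> simp [letters, h, h', hS', hdd, abs_of_pos hdj] <;> ring
  have hcw : ∀ b : Bool, [false, true, false, true, false, true].count b ≤ 3 := by decide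
  have q0 := C.hasLocalWeight_triangleQuiver x y hij hd hr
    (w := [false, true, false, true, false, true]) (g := false) (l := true) h1 hcw
  have q1 := C.hasLocalWeight_mutate x y hij hS hd hcw rfl q0 true 2 (by decide) (by decide)
    (W' := localQuiver (triplyArrows 0)) (by decide +kernel)
    (k := f i (x.count i + 2)) rfl
  have q2 := C.hasLocalWeight_mutate x y hij hS hd hcw rfl q1 true 1 (by decide) (by decide)
    (W' := localQuiver (triplyArrows 1)) (by decide +kernel)
    (k := f i (x.count i + 1)) rfl
  have q3 := C.hasLocalWeight_mutate x y hij hS hd hcw rfl q2 false 2 (by decide) (by decide)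
    (W' := localQuiver (triplyArrows 2)) (by decide +kernel)
    (k := f j (x.count j + 2)) rfl
  have q4 := C.hasLocalWeight_mutate x y hij hS hd hcw rfl q3 true 2 (by decide) (by decide)
    (W' := localQuiver (triplyArrows 3)) (by decide +kernel)
    (k := f i (x.count i + 2)) rfl
  have q5 := C.hasLocalWeight_mutate x y hij hS hd hcw rfl q4 false 2 (by decide) (by decide)
    (W' := localQuiver (triplyArrows 4)) (by decide +kernel)
    (k := f j (x.count j + 2)) rfl
  have q6 := C.hasLocalWeight_mutate x y hij hS hd hcw rfl q5 false 1 (by decide) (by decide)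
    (W' := localQuiver (triplyArrows 5)) (by decide +kernel)
    (k := f j (x.count j + 1)) rfl
  have q7 := C.hasLocalWeight_mutate x y hij hS hd hcw rfl q6 false 2 (by decide) (by decide)
    (W' := localQuiver (triplyArrows 6)) (by decide +kernel)
    (k := f j (x.count j + 2)) rfl
  have q8 := C.hasLocalWeight_mutate x y hij hS hd hcw rfl q7 true 2 (by decide) (by decide)
    (W' := localQuiver (triplyArrows 7)) (by decide +kernel)
    (k := f i (x.count i + 2)) rfl
  have q9 := C.hasLocalWeight_mutate x y hij hS hd hcw rfl q8 true 1 (by decide) (by decide)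
    (W' := localQuiver (triplyArrows 8)) (by decide +kernel)
    (k := f i (x.count i + 1)) rfl
  have q10 := C.hasLocalWeight_mutate x y hij hS hd hcw rfl q9 false 2 (by decide) (by decide)
    (W' := localQuiver (triplyArrows 9)) (by decide +kernel)
    (k := f j (x.count j + 2)) rfl
  have q11 := C.hasLocalWeight_mutate x y hij hS hd hcw rfl q10 true 2 (by decide) (by decide)
    (W' := localWeight exchangePlace (fun b => cond b 6 2) 3
      [true, false, true, false, true, false] true false) (by decide +kernel)
    (k := f i (x.count i + 2)) rfl
  have hex : ∀ (c : I) (k : ℤ), ¬ (c = j ∧ k = x.count j + 1) →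
      ¬ (c = j ∧ k = x.count j + 1 + 1) → exchange j (x.count j + 1) (f c k) = f c k := by
    intro c k ha hb
    exact exchange_of_ne (by simpa using ha) (by simpa using hb)
  have e2 := C.triangleWeight_change x y hij hd hr (w := [false, true, false, true, false, true])
    (w' := [true, false, true, false, true, false]) (g := true) (l := false) h2
    (wordProd_eq_of_append m.wordProd_eq) (place := exchangePlace)
    (σ := exchange j (x.count j + 1)) (fun _ => exchange_of_ne (by simp) (by simp))
    (by
      intro b m hm
      cases b
      · have hm' : m ≤ 3 := hm
        interval_cases m
        · exact ⟨false, 0, by decide, by decide, hex _ _ (by simp) (by simp; omega)⟩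
        · exact ⟨false, 2, by decide, by decide, (exchange_left _ _).trans
            (by rw [add_assoc, one_add_one_eq_two]; rfl)⟩
        · exact ⟨false, 1, by decide, by decide, (congrArg _
            (by rw [add_assoc, one_add_one_eq_two]; rfl)).trans (exchange_right _ _)⟩
        · exact ⟨false, 3, by decide, by decide, hex _ _
            (fun q => by have : (x.count j : ℤ) + (3 : ℕ) = x.count j + 1 := q.2; omega)
            (fun q => by have : (x.count j : ℤ) + (3 : ℕ) = x.count j + 1 + 1 := q.2; omega)⟩
      · have hm' : m ≤ 3 := hm
        exact ⟨true, m, hm', by interval_cases m <;> decide, hex _ _ (by simp [letters, hij])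
          (by simp [letters, hij])⟩)
    (fun c k _ hk => hex _ _ (by rintro ⟨rfl, rfl⟩; omega) (by rintro ⟨rfl, rfl⟩; omega))
    (by
      intro c k hk
      have hcx : (x ++ [false, true, false, true, false, true].map (letters i j)).count c =
          (x ++ [true, false, true, false, true, false].map (letters i j)).count c := by
        simp only [List.map_cons, List.map_nil, letters, cond_true, cond_false,
          List.count_append, List.count_cons, List.count_nil]
        omega
      rw [hcx]
      have hj3 : c = j → (x.count j : ℤ) + 3 ≤
          (x ++ [true, false, true, false, true, false].map (letters i j)).count c := by
        rintro rfl
        rw [List.count_append]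
        simp [List.count_cons]
        omega
      exact hex _ _ (by rintro ⟨h1, h2⟩; have := hj3 h1; omega)
        (by rintro ⟨h1, h2⟩; have := hj3 h1; omega))
  have hqj : (x.count j : ℤ) + 3 ≤ (x ++ [j, i, j, i, j, i] ++ y).count j := by
    simp [List.count_append, List.count_cons]
    omega
  have hcases : ∀ {p : Node I → Node I → Prop}, (∀ v, p v v) →
      p (f j (x.count j + 2)) (f j (x.count j + 1)) →
      p (f j (x.count j + 1)) (f j (x.count j + 2)) →
      ∀ v, p (exchange j (x.count j + 1) v) v := by
    intro p h0 ha hb v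
    by_cases h1 : v = f j (x.count j + 1)
    · rw [h1, exchange_left, add_assoc]
      exact ha
    · by_cases h2 : v = f j (x.count j + 1 + 1)
      · rw [h2, exchange_right, add_assoc]
        exact hb
      · rw [exchange_of_ne h1 h2]
        exact h0 v
  refine C.triangleQuiver_ext ?_ ?_ ?_ ?_
  · rw [← p1]
    ext v
    refine hcases (p := fun a b => a ∈ triangleVerts _ ↔ b ∈ triangleVerts _) (fun _ => Iff.rfl)
      ?_ ?_ v <;> simp only [f_mem_triangleVerts] <;> omega
  · refine Eq.trans ?_ p2
    ext v
    refine hcases (p := fun a b => a ∈ (C.triangleQuiver _).frozen ↔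
      b ∈ (C.triangleQuiver _).frozen) (fun _ => Iff.rfl) ?_ ?_ v <;>
    simp only [f_mem_frozen] <;> omega
  · rw [← p3]
    funext v
    refine hcases (p := fun a b => C.triangleMult _ a = C.triangleMult _ b) (fun _ => rfl)
      ?_ ?_ v <;> simp only [triangleMult] <;> split_ifs <;> first | rfl | omega
  · funext s s'
    have hl : [false, true, false, true, false, true].map (letters i j) = [j, i, j, i, j, i] := rfl
    rw [hl] at q11
    simp only [Move.act, mutateAt, triplySequence, List.foldl, relabel_weight]
    exact (q11 _ _).trans (e2 s s').symm

theorem Move.act_triangleQuiver {C : SimpleCartanDatum I} {w w' : List I} (m : C.Move w w')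
    (hw : C.IsReduced w) : m.act (C.triangleQuiver w) = C.triangleQuiver w' := by
  cases m with
  | swap x y i j hij h => exact C.act_swap x y i j hij h hw
  | simply x y i j hij h h' => exact C.act_simply x y i j hij h h' hw
  | doubly x y i j hij h h' => exact C.act_doubly x y i j hij h h' hw
  | doublyInv x y i j hij h h' =>
    have hw' := (Move.doubly x y i j hij h h').isReduced_left hw
    rw [← C.act_doubly x y i j hij h h' hw']
    -- the list of mutated nodes is a palindrome
    exact mutateAt_reverse_mutateAt [f j (x.count j + 1), f i (x.count i + 1),
      f j (x.count j + 1)] _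
  | triply x y i j hij h h' => exact C.act_triply x y i j hij h h' hw
  | triplyInv x y i j hij h h' =>
    have hw' := (Move.triply x y i j hij h h').isReduced_left hw
    rw [← C.act_triply x y i j hij h h' hw']
    simp only [Move.act]
    rw [WeightedQuiver.relabel_relabel _ (exchange_exchange _ _), mutateAt_reverse_mutateAt]

/-- Changes of words carry the quivers of triangles to one another. -/
theorem WordChange.act_triangleQuiver {C : SimpleCartanDatum I} {w w' : List I}
    (M : C.WordChange w w') (hw : C.IsReduced w) :
    M.act (C.triangleQuiver w) = C.triangleQuiver w' := by
  induction M with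
  | nil => rfl
  | cons m M ih => exact (congrArg M.act (m.act_triangleQuiver hw)).trans (ih (m.isReduced hw))

/-! ### The Dynkin involution -/

theorem exists_isReduced (C : SimpleCartanDatum I) (w : List I) :
    ∃ u, C.IsReduced u ∧ C.wordProd u = C.wordProd w := by
  classical
  have h : ∃ n, ∃ u : List I, C.wordProd u = C.wordProd w ∧ u.length = n := ⟨_, w, rfl, rfl⟩
  obtain ⟨u, hu, hl⟩ := Nat.find_spec h
  exact ⟨u, fun z hz => hl ▸ Nat.find_min' h ⟨z, hz.trans hu, rfl⟩, hu⟩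

/-- A Weyl group element that makes no simple root negative is the identity. -/
theorem wordProd_eq_one_of_nonneg (C : SimpleCartanDatum I) {w : List I}
    (h : ∀ i, 0 ≤ C.wordProd w (simpleRoot i)) : C.wordProd w = 1 := by
  obtain ⟨u, hu, he⟩ := C.exists_isReduced w
  rw [← he] at h ⊢
  obtain rfl | ⟨u, i, rfl⟩ := u.eq_nil_or_concat'
  · rfl
  · have h1 := h i
    have h2 := hu.nonneg
    rw [wordProd_append_apply, wordProd_cons_apply, wordProd_nil_apply, reflection_simpleRoot,
      map_neg, Left.nonneg_neg_iff] at h1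
    exact absurd (le_antisymm h1 h2) (C.isRoot_wordProd u i).ne_zero

theorem linearMap_ext_simpleRoot {f g : Module.End ℤ (I → ℤ)}
    (h : ∀ i, f (simpleRoot i) = g (simpleRoot i)) : f = g :=
  LinearMap.pi_ext' fun i => LinearMap.ext_ring (h i)

theorem simpleRoot_comp_symm (η : Equiv.Perm I) (i : I) :
    simpleRoot i ∘ η.symm = simpleRoot (η i) := by
  funext k
  by_cases h : k = η i
  · subst h
    simp
  · have h' : η.symm k ≠ i := fun hk => h (by rw [← hk, Equiv.apply_symm_apply])
    simp [h, h']

namespace IsDynkinInvolution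

variable {C : SimpleCartanDatum I} {w : List I} {η : Equiv.Perm I}

theorem not_nonneg (hη : C.IsDynkinInvolution w η) (i : I) :
    ¬ 0 ≤ C.wordProd w (simpleRoot i) := by
  refine (C.isRoot_wordProd w i).not_nonneg_of_nonpos ?_
  rw [hη i]
  exact neg_nonpos.mpr (simpleRoot_nonneg _)

theorem count_pos (hη : C.IsDynkinInvolution w η) (k : I) : 0 < w.count k := by
  rw [List.count_pos_iff]
  by_contra hk
  have h := C.wordProd_apply_of_forall_ne (u := w) (k := k) (fun l hl h => hk (h ▸ hl))
    (simpleRoot k)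
  rw [hη k] at h
  have h2 : (0 : ℤ) ≤ (Pi.single (η k) 1 : I → ℤ) k := simpleRoot_nonneg (η k) k
  have h3 : (simpleRoot k : I → ℤ) k = 1 := Pi.single_eq_same k 1
  rw [Pi.neg_apply, h3] at h
  omega

theorem d_eq (hη : C.IsDynkinInvolution w η) (i : I) : C.d (η i) = C.d i := by
  have h := C.form_wordProd w (simpleRoot i) (simpleRoot i)
  rw [hη i, form_neg_left, form_neg_right, neg_neg, form_simpleRoot, form_simpleRoot, C.diag,
    C.diag] at h
  push_cast at h
  linarith

theorem a_eq (hη : C.IsDynkinInvolution w η) (i j : I) : C.a (η i) (η j) = C.a i j := by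
  have h := C.form_wordProd w (simpleRoot i) (simpleRoot j)
  rw [hη i, hη j, form_neg_left, form_neg_right, neg_neg, form_simpleRoot, form_simpleRoot,
    hη.d_eq] at h
  exact_mod_cast mul_left_cancel₀ (C.d_pos i).ne' h

theorem pairing_comp (hη : C.IsDynkinInvolution w η) (i : I) (v : I → ℤ) :
    C.pairing (η i) (v ∘ η.symm) = C.pairing i v := by
  unfold pairing
  rw [← Equiv.sum_comp η]
  simp [hη.a_eq]

/-- The action of the Weyl group is compatible with the diagram automorphism `η`. -/
theorem wordProd_map (hη : C.IsDynkinInvolution w η) (y : List I) (v : I → ℤ) :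
    C.wordProd (y.map η) (v ∘ η.symm) = C.wordProd y v ∘ η.symm := by
  induction y with
  | nil => rfl
  | cons j y ih =>
    rw [List.map_cons, wordProd_cons_apply, wordProd_cons_apply, ih, reflection_apply,
      hη.pairing_comp, reflection_apply, ← simpleRoot_comp_symm]
    rfl

theorem wordProd_map_simpleRoot (hη : C.IsDynkinInvolution w η) (y : List I) (i : I) :
    C.wordProd (y.map η) (simpleRoot (η i)) = C.wordProd y (simpleRoot i) ∘ η.symm := by
  rw [← simpleRoot_comp_symm, hη.wordProd_map]

theorem wordProd_map_eq_iff (hη : C.IsDynkinInvolution w η) (y : List I) (i j : I) :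
    C.wordProd (y.map η) (simpleRoot (η i)) = simpleRoot (η j) ↔
      C.wordProd y (simpleRoot i) = simpleRoot j := by
  rw [hη.wordProd_map_simpleRoot, ← simpleRoot_comp_symm]
  exact η.symm.surjective.injective_comp_right.eq_iff

theorem wordProd_map_nonneg_iff (hη : C.IsDynkinInvolution w η) (y : List I) (i : I) :
    0 ≤ C.wordProd (y.map η) (simpleRoot (η i)) ↔ 0 ≤ C.wordProd y (simpleRoot i) := by
  rw [hη.wordProd_map_simpleRoot]
  exact ⟨fun h k => by simpa using h (η k), fun h k => h (η.symm k)⟩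

theorem map_wordProd (hη : C.IsDynkinInvolution w η) : C.wordProd (w.map η) = C.wordProd w := by
  refine linearMap_ext_simpleRoot fun i => ?_
  obtain ⟨i, rfl⟩ := η.surjective i
  rw [hη.wordProd_map_simpleRoot, hη i, hη (η i)]
  exact congrArg Neg.neg (simpleRoot_comp_symm η (η i))

theorem wordProd_wordProd (hη : C.IsDynkinInvolution w η) (v : I → ℤ) :
    C.wordProd w (C.wordProd w v) = v := by
  rw [← wordProd_append_apply, C.wordProd_eq_one_of_nonneg fun i => ?_]
  · rfl
  · rw [wordProd_append_apply, hη i, map_neg, hη (η i), neg_neg]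
    exact simpleRoot_nonneg _

theorem apply_apply (hη : C.IsDynkinInvolution w η) (i : I) : η (η i) = i := by
  have h := hη.wordProd_wordProd (simpleRoot i)
  rw [hη i, map_neg, hη (η i), neg_neg] at h
  exact simpleRoot_injective h

theorem reverse_wordProd (hη : C.IsDynkinInvolution w η) :
    C.wordProd w.reverse = C.wordProd w := by
  refine LinearMap.ext fun v => C.wordProd_injective w ?_
  rw [wordProd_mul_reverse, hη.wordProd_wordProd]

theorem isReduced_map (hη : C.IsDynkinInvolution w η) (hw : C.IsReduced w) :
    C.IsReduced (w.map η) := hw.congr hη.map_wordProd (List.length_map _)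

/-! ### The Dynkin involution acts on the quiver of a triangle -/

theorem triangleWeight_map_involution (hη : C.IsDynkinInvolution w η) (s t : Node I) :
    C.triangleWeight f (w.map η) (involution η s) (involution η t) =
      C.triangleWeight f w s t := by
  have hcount : ∀ (x : List I) c, (x.map η).count (η c) = x.count c := fun x c =>
    List.count_map_of_injective x η η.injective c
  have hf : ∀ c k, f (η c) k = involution η (f c k) := fun _ _ => rfl
  have he : ∀ c, e (η c) = involution η (e c) := fun _ => rfl
  rw [triangleWeight, splitSum_map]
  refine splitSum_congr fun x j y _ => ?_
  congr 1
  · congr 1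
    · simp only [rowPart, elementary, hcount, hη.d_eq]
      rw [hf, hf, arrow_map]
      congr 1
      refine (Finset.sum_equiv η (fun c => by simp) fun c _ => ?_).symm
      rw [hcount, hf, arrow_map, arrow_map, hη.a_eq]
    · unfold attachPart
      rw [← Equiv.sum_comp η]
      refine Finset.sum_congr rfl fun i _ => if_congr (hη.wordProd_map_eq_iff y i j) ?_ rfl
      rw [hcount, hf, hf, he, arrow_map, arrow_map, hη.d_eq]
  · unfold sidePart
    rw [← Equiv.sum_comp η]
    refine Finset.sum_congr rfl fun i _ => if_congr (hη.wordProd_map_eq_iff y i j) ?_ rfl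
    rw [← Equiv.sum_comp η]
    refine Finset.sum_congr rfl fun k _ => ?_
    rw [he, he, arrow_map, hη.d_eq, hη.a_eq]
    congr 2
    by_cases h : 0 ≤ C.wordProd y (simpleRoot k)
    · rw [if_pos h, if_pos ((hη.wordProd_map_nonneg_iff y k).mpr h)]
    · rw [if_neg h, if_neg fun h' => h ((hη.wordProd_map_nonneg_iff y k).mp h')]

theorem triangleQuiver_map_relabel (hη : C.IsDynkinInvolution w η) :
    (C.triangleQuiver (w.map η)).relabel (involution η) = C.triangleQuiver w := by
  have hcount : ∀ c, (w.map η).count (η c) = w.count c := fun c =>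
    List.count_map_of_injective w η η.injective c
  ext1
  · ext v
    cases v with
    | e c => exact iff_of_true (e_mem_triangleVerts _ _) (e_mem_triangleVerts _ _)
    | f c k =>
      change f (η c) k ∈ triangleVerts _ ↔ f c k ∈ triangleVerts _
      rw [f_mem_triangleVerts, f_mem_triangleVerts, hcount]
  · ext v
    cases v with
    | e c => exact iff_of_true (C.e_mem_frozen _ _) (C.e_mem_frozen _ _)
    | f c k =>
      change f (η c) k ∈ (C.triangleQuiver _).frozen ↔ _
      rw [f_mem_frozen, f_mem_frozen, hcount]
  · funext v
    cases v with
    | e c => exact hη.d_eq c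
    | f c k =>
      change C.triangleMult _ (f (η c) k) = C.triangleMult _ (f c k)
      simp only [triangleMult, hcount, hη.d_eq]
  · funext s t
    exact hη.triangleWeight_map_involution s t

/-! ### Reversal of the word and of the arrows -/

theorem wordProd_split (hη : C.IsDynkinInvolution w η) {x y : List I} {j : I}
    (hw : w = x ++ j :: y) (i : I) :
    C.reflection j (C.wordProd y (simpleRoot (η i))) = -C.wordProd x.reverse (simpleRoot i) := by
  refine C.wordProd_injective x ?_
  rw [map_neg, wordProd_mul_reverse, ← wordProd_cons_apply, ← wordProd_append_apply, ← hw,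
    hη (η i), hη.apply_apply]

theorem wordProd_reverse_eq_iff (hη : C.IsDynkinInvolution w η) {x y : List I} {j : I}
    (hw : w = x ++ j :: y) (i : I) :
    C.wordProd x.reverse (simpleRoot i) = simpleRoot j ↔
      C.wordProd y (simpleRoot (η i)) = simpleRoot j := by
  have h := hη.wordProd_split hw i
  constructor <;> intro h1
  · rw [h1, ← reflection_simpleRoot] at h
    exact C.wordProd_injective [j] (by simpa using h)
  · rw [h1, reflection_simpleRoot] at h
    exact (neg_injective h).symm

/-- The two halves of a word of the longest element make complementary sets of simple roots
negative, apart from the simple root attached to the letter between them. -/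
theorem nonneg_reverse_iff (hη : C.IsDynkinInvolution w η) {x y : List I} {i j k : I}
    (hw : w = x ++ j :: y) (hi : C.wordProd y (simpleRoot (η i)) = simpleRoot j) (hk : k ≠ i) :
    0 ≤ C.wordProd x.reverse (simpleRoot k) ↔ ¬ 0 ≤ C.wordProd y (simpleRoot (η k)) := by
  have h := hη.wordProd_split hw k
  have hr := C.isRoot_wordProd x.reverse k
  have hs := C.isRoot_wordProd y (η k)
  constructor
  · intro h0 h1
    have h2 := hs.eq_simpleRoot j h1 (by
      rw [h]
      exact hr.neg.not_nonneg_of_nonpos (neg_nonpos.mpr h0))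
    rw [← hi] at h2
    exact hk (η.injective (simpleRoot_injective (C.wordProd_injective y h2)))
  · intro h1
    by_contra h0
    have h2 := hs.neg.eq_simpleRoot j (neg_nonneg.mpr (hs.nonpos h1)) (by
      rw [map_neg, h, neg_neg]
      exact h0)
    rw [← hi, ← map_neg] at h2
    have h3 := C.wordProd_injective y h2
    have h4 := simpleRoot_nonneg (η i)
    rw [← h3] at h4
    exact (C.isRoot_simpleRoot (η k)).neg.not_nonneg_of_nonpos
      (neg_nonpos.mpr (simpleRoot_nonneg _)) h4

end IsDynkinInvolution

/-- The elementary quiver with its two main nodes interchanged has all arrows reversed. -/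
theorem elementary_opposite (C : SimpleCartanDatum I) (σ : Equiv.Perm (Node I)) {j : I}
    {u v u' v' : Node I} {nb nb' : I → Node I} (hu : σ u' = v) (hv : σ v' = u)
    (hn : ∀ c, c ≠ j → σ (nb' c) = nb c) (s t : Node I) :
    C.elementary j u' v' nb' s t = -C.elementary j u v nb (σ s) (σ t) := by
  simp only [elementary]
  rw [neg_add, ← Finset.sum_neg_distrib, ← arrow_map σ, hu, hv, arrow_swap]
  congr 1
  refine Finset.sum_congr rfl fun c hc => ?_
  rw [← arrow_map σ v', ← arrow_map σ _ u', hu, hv, hn c (Finset.ne_of_mem_erase hc), arrow_swap u,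
    arrow_swap _ v]
  ring

namespace IsDynkinInvolution

variable {C : SimpleCartanDatum I} {w : List I} {η : Equiv.Perm I}

theorem triangleWeight_reverse (hη : C.IsDynkinInvolution w η) (s t : Node I) :
    C.triangleWeight f w.reverse s t = -C.triangleWeight f w
      (reflect (reversal η (fun i => w.count i) s))
        (reflect (reversal η (fun i => w.count i) t)) := by
  set σ : Equiv.Perm (Node I) := (reversal η fun i => (w.count i : ℤ)).trans reflect with hσ
  have hf : ∀ c k, σ (f c k) = f c (w.count c - k) := fun c k => by
    change f c (-(k - w.count c)) = _
    rw [neg_sub]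
  have he : ∀ c, e (η c) = σ (e c) := fun _ => rfl
  change _ = -C.triangleWeight f w (σ s) (σ t)
  rw [triangleWeight, triangleWeight, splitSum_reverse, ← splitSum_neg]
  refine splitSum_congr fun x j y hw => ?_
  have hc : ∀ c, c ≠ j → (w.count c : ℤ) - y.count c = x.count c := fun c hcj => by
    rw [hw, List.count_append, List.count_cons_of_ne (Ne.symm hcj)]
    push_cast
    ring
  have hj : (w.count j : ℤ) - y.count j = x.count j + 1 := by
    rw [hw, List.count_append, List.count_cons_self]
    push_cast
    ring
  have h0 : σ (f j (y.count j)) = f j (x.count j + 1) := by rw [hf, hj]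
  have h1 : σ (f j (y.count j + 1)) = f j (x.count j) := by
    rw [hf]
    congr 1
    omega
  rw [neg_add, neg_add]
  congr 1
  · congr 1
    · refine C.elementary_opposite σ (by rw [List.count_reverse, h0])
        (by rw [List.count_reverse, h1]) (fun c hcj => ?_) s t
      rw [List.count_reverse, hf, hc c hcj]
    · unfold attachPart
      rw [← Finset.sum_neg_distrib]
      refine (Finset.sum_congr rfl fun i _ => ?_).trans (Equiv.sum_comp η _)
      rw [neg_ite, neg_zero]
      refine if_congr (hη.wordProd_reverse_eq_iff hw i) ?_ rfl
      rw [List.count_reverse, ← h0, ← h1, he, arrow_map, arrow_map, hη.d_eq, arrow_swap,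
        arrow_swap (e i) (f j (y.count j))]
      ring
  · unfold sidePart
    rw [← Finset.sum_neg_distrib]
    refine (Finset.sum_congr rfl fun i _ => ?_).trans (Equiv.sum_comp η _)
    rw [neg_ite, neg_zero]
    by_cases hi : C.wordProd y (simpleRoot (η i)) = simpleRoot j
    · rw [if_pos hi, if_pos ((hη.wordProd_reverse_eq_iff hw i).mpr hi),
        ← Finset.sum_neg_distrib]
      refine (Finset.sum_congr rfl fun k _ => ?_).trans (Equiv.sum_comp η _)
      by_cases hk : k = i
      · rw [hk, arrow_self, arrow_self, neg_zero]
      · rw [he, he, arrow_map, hη.d_eq, hη.a_eq, ← arrow_neg]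
        congr 1
        by_cases h : 0 ≤ C.wordProd y (simpleRoot (η k))
        · rw [if_pos h, if_neg fun h2 => (hη.nonneg_reverse_iff hw hi hk).mp h2 h]
          ring
        · rw [if_neg h, if_pos ((hη.nonneg_reverse_iff hw hi hk).mpr h)]
          ring
    · rw [if_neg hi, if_neg fun h => hi ((hη.wordProd_reverse_eq_iff hw i).mp h)]

theorem triangleQuiver_reverse (hη : C.IsDynkinInvolution w η) :
    C.triangleQuiver w.reverse =
      (mirror (C.triangleQuiver w)).relabel (reversal η fun i => w.count i) := by
  ext1
  · ext v
    cases v with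
    | e c => exact iff_of_true (e_mem_triangleVerts _ _) (e_mem_triangleVerts _ _)
    | f c k =>
      change f c k ∈ triangleVerts _ ↔ f c (-(k - w.count c)) ∈ triangleVerts _
      rw [f_mem_triangleVerts, f_mem_triangleVerts, List.count_reverse]
      omega
  · ext v
    cases v with
    | e c => exact iff_of_true (C.e_mem_frozen _ _) (C.e_mem_frozen _ _)
    | f c k =>
      change _ ↔ f c (-(k - w.count c)) ∈ (C.triangleQuiver _).frozen
      rw [f_mem_frozen, f_mem_frozen, List.count_reverse]
      omega
  · funext v
    cases v with
    | e c => exact (hη.d_eq c).symm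
    | f c k =>
      change C.triangleMult _ (f c k) = C.triangleMult _ (f c (-(k - w.count c)))
      simp only [triangleMult, List.count_reverse]
      exact if_congr (by omega) rfl rfl
  · funext s t
    exact hη.triangleWeight_reverse s t

end IsDynkinInvolution

/-! ### Amalgamation with the mirror image -/

theorem wordWeight_eq_splitSum (C : SimpleCartanDatum I) (w : List I) (r : I → ℤ) (s t : Node I) :
    C.wordWeight w r s t = splitSum (fun x j _ => C.elementary j (f j (r j + x.count j))
      (f j (r j + x.count j + 1)) (fun c => f c (r c + x.count c)) s t) w := by
  induction w generalizing r with
  | nil => rfl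
  | cons i w ih =>
    have hc : ∀ (x : List I) (c : I), Function.update r i (r i + 1) c + (x.count c : ℤ) =
        r c + (i :: x).count c := by
      intro x c
      by_cases h : c = i
      · subst h
        rw [Function.update_self, List.count_cons_self]
        push_cast
        ring
      · rw [Function.update_of_ne h, List.count_cons_of_ne (Ne.symm h)]
    rw [wordWeight, ih, splitSum]
    simp only [hc, List.count_nil, Nat.cast_zero, add_zero]

theorem wordWeight_zero (C : SimpleCartanDatum I) (w : List I) (s t : Node I) :
    C.wordWeight w (fun _ => 0) s t = splitSum (fun x j _ => C.rowPart f x j s t) w := by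
  rw [wordWeight_eq_splitSum]
  simp only [zero_add, rowPart]

theorem wordWeight_reverse (C : SimpleCartanDatum I) (w : List I) (s t : Node I) :
    C.wordWeight w.reverse (fun i => -(w.count i : ℤ)) s t =
      -splitSum (fun x j _ => C.rowPart f x j (reflect s) (reflect t)) w := by
  have hf : ∀ c (k : ℤ), reflect (f c k : Node I) = f c (-k) := fun _ _ => rfl
  rw [wordWeight_eq_splitSum, splitSum_reverse, ← splitSum_neg]
  refine splitSum_congr fun x j y hw => ?_
  refine C.elementary_opposite reflect ?_ ?_ (fun c hcj => ?_) s t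
  · rw [hf, hw, List.count_append, List.count_cons_self, List.count_reverse]
    congr 1
    push_cast
    ring
  · rw [hf, hw, List.count_append, List.count_cons_self, List.count_reverse]
    congr 1
    push_cast
    ring
  · rw [hf, hw, List.count_append, List.count_cons_of_ne (Ne.symm hcj), List.count_reverse]
    congr 1
    push_cast
    ring

namespace IsDynkinInvolution

variable {C : SimpleCartanDatum I} {w : List I} {η : Equiv.Perm I}

/-- The arrows at a single node `e_i^0`: there is exactly one letter `j` which gives `α_i`. -/
theorem splitSum_attach (hη : C.IsDynkinInvolution w η) (hw : C.IsReduced w) (i : I)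
    [∀ (y : List I) (j : I),
      Decidable (C.wordProd y (simpleRoot i) = simpleRoot j)] [∀ j k,
      Decidable (C.IsInitialTerm w i j k)] (B : I → ℤ → ℚ) :
    splitSum (fun x j y => if C.wordProd y (simpleRoot i) = simpleRoot j then
      B j (x.count j + 1) else 0) w =
    ∑ j, ∑ k ∈ Finset.Icc (1 : ℤ) (w.count j), if C.IsInitialTerm w i j k then B j k else 0 := by
  obtain ⟨x, y, j, hxy, hj⟩ := C.exists_split_of_not_nonneg w (C.isRoot_simpleRoot i)
    (simpleRoot_nonneg i) (hη.not_nonneg i)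
  have key : ∀ j' k, C.IsInitialTerm w i j' k ↔ j' = j ∧ k = x.count j + 1 := by
    intro j' k
    constructor
    · rintro ⟨x', y', hx', hk, hp⟩
      obtain ⟨x'', y'', j'', hx'', hl, hj''⟩ := (initialPos_iff hw (hη.not_nonneg i)).mp hp
      rw [hxy] at hx' hx'' hw
      have h1 := split_length_unique hw hx'' hj hj''
      obtain ⟨rfl, h2⟩ := List.append_inj hx' (h1.trans hl)
      obtain ⟨rfl, -⟩ := List.cons.inj h2
      exact ⟨rfl, hk⟩
    · rintro ⟨rfl, rfl⟩
      exact ⟨x, y, hxy, rfl, (initialPos_iff hw (hη.not_nonneg i)).mpr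
        ⟨x, y, j', hxy, rfl, hj⟩⟩
  have hcount : x.count j + 1 ≤ w.count j := by
    rw [hxy, List.count_append, List.count_cons_self]
    omega
  rw [Finset.sum_eq_single j (fun j' _ hj' => Finset.sum_eq_zero fun k _ =>
    if_neg fun h => hj' ((key j' k).mp h).1) (by simp),
    Finset.sum_eq_single ((x.count j : ℤ) + 1) (fun k _ hk => if_neg fun h =>
      hk ((key j k).mp h).2) (fun h => absurd (Finset.mem_Icc.mpr ⟨by omega, by omega⟩) h),
    if_pos ((key j _).mpr ⟨rfl, rfl⟩), hxy, splitSum_eq_single, if_pos hj]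
  intro x' j' y' h hl
  refine if_neg fun hj' => hl ?_
  rw [hxy] at hw
  exact (split_length_unique hw h hj hj').symm

theorem initialWeight_eq (hη : C.IsDynkinInvolution w η) (hw : C.IsReduced w) (s t : Node I) :
    C.initialWeight w s t = splitSum (fun x j y => C.attachPart f x j y s t) w -
      splitSum (fun x j y => C.attachPart f x j y (reflect s) (reflect t)) w := by
  classical
  have hf : ∀ c (k : ℤ), f c k = reflect (f c (-k) : Node I) := fun c k => by
    change _ = f c (- -k)
    rw [neg_neg]
  have he : ∀ c, e c = reflect (e c : Node I) := fun _ => rfl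
  rw [sub_eq_add_neg, ← splitSum_neg, ← splitSum_add]
  have h : ∀ x j y, C.attachPart f x j y s t + -C.attachPart f x j y (reflect s) (reflect t) =
      ∑ i, if C.wordProd y (simpleRoot i) = simpleRoot j then
        (fun j k => arrow (f j k) (e i) (C.d i) s t + arrow (e i) (f j (-k)) (C.d i) s t
          + (if k = 1 then 0 else
            arrow (f j (-(k - 1))) (e i) (C.d i) s t + arrow (e i) (f j (k - 1)) (C.d i) s t))
          j ((x.count j : ℤ) + 1)
      else 0 := by
    intro x j y
    unfold attachPart
    rw [← Finset.sum_neg_distrib, ← Finset.sum_add_distrib]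
    refine Finset.sum_congr rfl fun i _ => ?_
    by_cases hy : C.wordProd y (simpleRoot i) = simpleRoot j
    · rw [if_pos hy, if_pos hy, if_pos hy]
      have h1 : arrow (f j ((x.count j : ℤ) + 1)) (e i) (C.d i) (reflect s) (reflect t) =
          -arrow (e i) (f j (-((x.count j : ℤ) + 1))) (C.d i) s t := by
        rw [hf, he, arrow_map, arrow_swap]
        rfl
      have h2 : arrow (e i) (f j (x.count j : ℤ)) (C.d i) (reflect s) (reflect t) =
          -arrow (f j (-(x.count j : ℤ))) (e i) (C.d i) s t := by
        rw [hf, he, arrow_map, arrow_swap]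
        rfl
      rw [h1, h2]
      simp only [add_sub_cancel_right]
      by_cases hx : (x.count j : ℤ) = 0
      · -- the two arrows between `e_i^0` and `f_j^0` cancel
        rw [hx, if_pos (zero_add _), neg_zero, arrow_swap (e i) (f j 0)]
        ring
      · rw [if_neg (by omega)]
        ring
    · rw [if_neg hy, if_neg hy, if_neg hy, neg_zero, add_zero]
  simp only [h]
  rw [splitSum_sum]
  refine Finset.sum_congr rfl fun i _ => ?_
  exact (hη.splitSum_attach hw i _).symm

theorem amalgamate_triangleQuiver (hη : C.IsDynkinInvolution w η) (hw : C.IsReduced w) :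
    (C.triangleQuiver w).amalgamate (mirror (C.triangleQuiver w)) = C.dQuiver w := by
  classical
  have hm : ∀ c k, f c k ∈ (mirror (C.triangleQuiver w)).verts ↔
      f c (-k) ∈ triangleVerts w := fun _ _ => Iff.rfl
  have hm' : ∀ c k, f c k ∈ (mirror (C.triangleQuiver w)).frozen ↔
      f c (-k) ∈ (C.triangleQuiver w).frozen := fun _ _ => Iff.rfl
  ext1
  · ext v
    cases v with
    | e c => exact iff_of_true (Or.inl (e_mem_triangleVerts _ _)) trivial
    | f c k =>
      change f c k ∈ triangleVerts w ∨ _ ↔ -(w.count c : ℤ) ≤ k ∧ k ≤ w.count c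
      rw [hm, f_mem_triangleVerts, f_mem_triangleVerts]
      omega
  · ext v
    cases v with
    | e c =>
      refine iff_of_false (fun h => h.2 ⟨e_mem_triangleVerts _ _, e_mem_triangleVerts _ _⟩) ?_
      rintro ⟨i, h | h⟩ <;> cases h
    | f c k =>
      have h0 := hη.count_pos c
      change (f c k ∈ (C.triangleQuiver w).frozen ∨ _) ∧ ¬ (f c k ∈ triangleVerts w ∧ _) ↔ _
      rw [hm, hm', f_mem_triangleVerts, f_mem_triangleVerts, f_mem_frozen, f_mem_frozen]
      constructor
      · intro h
        refine ⟨c, ?_⟩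
        simp only [f.injEq, true_and]
        omega
      · rintro ⟨i, h | h⟩ <;> obtain ⟨rfl, rfl⟩ := h <;> omega
  · funext v
    cases v with
    | e c => exact if_pos (e_mem_triangleVerts _ _)
    | f c k =>
      have hQ : ((C.triangleQuiver w).amalgamate (mirror (C.triangleQuiver w))).mult (f c k) =
          if f c k ∈ triangleVerts w then C.triangleMult w (f c k) else
            C.triangleMult w (f c (-k)) := if_congr Iff.rfl rfl rfl
      change _ = C.nodeMult w (f c k)
      rw [hQ]
      simp only [f_mem_triangleVerts, triangleMult, nodeMult]
      split_ifs <;> first | rfl | omega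
  · funext s t
    change C.triangleWeight f w s t + -C.triangleWeight f w (reflect s) (reflect t) =
      C.wordWeight w _ s t + C.wordWeight w.reverse _ s t + C.initialWeight w s t
    have hs : ∀ j y, C.sidePart j y (reflect s) (reflect t) = C.sidePart j y s t := by
      intro j y
      unfold sidePart
      refine Finset.sum_congr rfl fun i _ => if_congr Iff.rfl
        (Finset.sum_congr rfl fun k _ => ?_) rfl
      exact arrow_map reflect (e i) (e k) s t _
    rw [wordWeight_zero, wordWeight_reverse, hη.initialWeight_eq hw]
    simp only [triangleWeight, splitSum_add, hs]
    ring

end IsDynkinInvolution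

end SimpleCartanDatum

/-! ### Uniqueness -/

/-- The nodes `e_i^0` and `f_i^0`, along which a triangle is glued to its mirror image. -/
def Node.IsGlued {I : Type*} : Node I → Prop
  | Node.f _ k => k = 0
  | Node.e _ => True

namespace SimpleCartanDatum

open Node

variable {I : Type*} [Fintype I] [DecidableEq I]

/-- The quivers `Q` and `R` have the same multipliers, and their weights differ by `δ`, which
vanishes except between glued nodes. -/
structure DiffersBy (δ : Node I → Node I → ℚ) (Q R : WeightedQuiver (Node I)) : Prop where
  mult_eq : R.mult = Q.mult
  weight_eq : ∀ s t, R.weight s t = Q.weight s t + δ s t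
  left_eq_zero : ∀ s t, ¬ s.IsGlued → δ s t = 0
  right_eq_zero : ∀ s t, ¬ t.IsGlued → δ s t = 0

namespace DiffersBy

variable {δ : Node I → Node I → ℚ} {Q R : WeightedQuiver (Node I)}

theorem mutate (h : DiffersBy δ Q R) {k : Node I} (hk : ¬ k.IsGlued) :
    DiffersBy δ (Q.mutate k) (R.mutate k) where
  mult_eq := h.mult_eq
  weight_eq s t := by
    have hl : ∀ t, R.weight k t = Q.weight k t := fun t => by
      rw [h.weight_eq, h.left_eq_zero k t hk, add_zero]
    have hr : ∀ s, R.weight s k = Q.weight s k := fun s => by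
      rw [h.weight_eq, h.right_eq_zero s k hk, add_zero]
    simp only [WeightedQuiver.mutate, hl, hr, h.mult_eq]
    split_ifs with hc
    · have h0 : δ s t = 0 := by
        rcases hc with rfl | rfl
        · exact h.left_eq_zero _ _ hk
        · exact h.right_eq_zero _ _ hk
      rw [h.weight_eq, h0, add_zero, add_zero]
    · rw [h.weight_eq]
      ring
  left_eq_zero := h.left_eq_zero
  right_eq_zero := h.right_eq_zero

theorem mutateAt (h : DiffersBy δ Q R) {l : List (Node I)} (hl : ∀ k ∈ l, ¬ k.IsGlued) :
    DiffersBy δ (mutateAt l Q) (mutateAt l R) := by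
  induction l generalizing Q R with
  | nil => exact h
  | cons k l ih =>
    exact ih (h.mutate (hl k List.mem_cons_self)) fun k' hk' => hl k' (List.mem_cons_of_mem _ hk')

theorem relabel (h : DiffersBy δ Q R) {σ : Equiv.Perm (Node I)}
    (hσ : ∀ s, s.IsGlued → σ s = s) : DiffersBy δ (Q.relabel σ) (R.relabel σ) where
  mult_eq := funext fun v => congrFun h.mult_eq (σ v)
  weight_eq s t := by
    -- a permutation that fixes all glued nodes maps the other nodes to one another
    have hn : ∀ s : Node I, ¬ s.IsGlued → ¬ (σ s).IsGlued := fun s hs h' =>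
      hs (σ.injective (hσ _ h') ▸ h')
    change R.weight (σ s) (σ t) = Q.weight (σ s) (σ t) + δ s t
    rw [h.weight_eq]
    congr 1
    by_cases hs : s.IsGlued
    · by_cases ht : t.IsGlued
      · rw [hσ s hs, hσ t ht]
      · rw [h.right_eq_zero _ _ ht, h.right_eq_zero _ _ (hn t ht)]
    · rw [h.left_eq_zero _ _ hs, h.left_eq_zero _ _ (hn s hs)]
  left_eq_zero := h.left_eq_zero
  right_eq_zero := h.right_eq_zero

theorem exchange (h : DiffersBy δ Q R) (j : I) (q : ℕ) :
    DiffersBy δ (Q.relabel (exchange j (q + 1))) (R.relabel (Node.exchange j (q + 1))) := by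
  refine h.relabel fun s hs => exchange_of_ne ?_ ?_ <;> rintro rfl <;> simp only [IsGlued] at hs <;>
    omega

theorem not_isGlued_triplySequence (i j : I) (p q : ℕ) :
    ∀ k ∈ triplySequence i j p q, ¬ k.IsGlued := by
  intro k hk
  simp only [triplySequence, List.mem_cons, List.not_mem_nil, or_false] at hk
  rcases hk with rfl | rfl | rfl | rfl | rfl | rfl | rfl | rfl | rfl | rfl | rfl <;>
    simp only [IsGlued] <;> omega

theorem doublySequence (h : DiffersBy δ Q R) (i j : I) (p q : ℕ) :
    DiffersBy δ (SimpleCartanDatum.mutateAt [f j (q + 1), f i (p + 1), f j (q + 1)] Q)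
      (SimpleCartanDatum.mutateAt [f j (q + 1), f i (p + 1), f j (q + 1)] R) := by
  refine h.mutateAt fun k hk => ?_
  simp only [List.mem_cons, List.not_mem_nil, or_false] at hk
  rcases hk with rfl | rfl | rfl <;> simp only [IsGlued] <;> omega

/-- No change of words mutates or renames a glued node. -/
theorem move {C : SimpleCartanDatum I} {w w' : List I} (h : DiffersBy δ Q R) (m : C.Move w w') :
    DiffersBy δ (m.act Q) (m.act R) := by
  cases m with
  | swap x y i j hij h0 => exact h
  | simply x y i j hij h0 h1 =>
    refine (h.mutate (by simp only [IsGlued]; omega)).relabel fun s hs => ?_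
    cases s with
    | e c => rfl
    | f c k =>
      obtain rfl : k = 0 := hs
      exact shift_of_lt i j hij _ _ (fun _ => by omega) (fun _ => by omega)
  | doubly x y i j hij h0 h1 => exact h.doublySequence i j _ _
  | doublyInv x y i j hij h0 h1 => exact h.doublySequence i j _ _
  | triply x y i j hij h0 h1 =>
    exact (h.mutateAt (not_isGlued_triplySequence i j _ _)).exchange j _
  | triplyInv x y i j hij h0 h1 =>
    exact (h.exchange j _).mutateAt fun k hk =>
      not_isGlued_triplySequence i j _ _ k (List.mem_reverse.mp hk)

theorem wordChange {C : SimpleCartanDatum I} {w w' : List I} (h : DiffersBy δ Q R)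
    (M : C.WordChange w w') : DiffersBy δ (M.act Q) (M.act R) := by
  induction M generalizing Q R with
  | nil => exact h
  | cons m M ih => exact ih (h.move m)

end DiffersBy

theorem isBasicQuiver_triangleQuiver {C : SimpleCartanDatum I} {w : List I} (hw : C.IsReduced w)
    {η : Equiv.Perm I} (hη : C.IsDynkinInvolution w η) (M : C.WordChange w w.reverse)
    (N : C.WordChange w (w.map η)) : C.IsBasicQuiver w η M N (C.triangleQuiver w) where
  verts_eq := rfl
  frozen_eq := rfl
  amalgam := hη.amalgamate_triangleQuiver hw
  reversal := (M.act_triangleQuiver hw).trans hη.triangleQuiver_reverse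
  involution := by rw [N.act_triangleQuiver hw, hη.triangleQuiver_map_relabel]

namespace IsBasicQuiver

variable {C : SimpleCartanDatum I} {w : List I} {η : Equiv.Perm I} {M : C.WordChange w w.reverse}
  {N : C.WordChange w (w.map η)} {Q R : WeightedQuiver (Node I)}

theorem mult_eq (hQ : C.IsBasicQuiver w η M N Q) (hR : C.IsBasicQuiver w η M N R) :
    R.mult = Q.mult := by
  funext v
  by_cases hv : v ∈ Q.verts
  · have hv' : v ∈ R.verts := by rwa [hR.verts_eq, ← hQ.verts_eq]
    have h := congrArg (fun S => S.mult v) (hQ.amalgam.trans hR.amalgam.symm)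
    simp only [WeightedQuiver.amalgamate, if_pos hv, if_pos hv'] at h
    exact h.symm
  · have hv' : v ∉ R.verts := by rwa [hR.verts_eq, ← hQ.verts_eq]
    rw [Q.mult_off v hv, R.mult_off v hv']

theorem differsBy (hQ : C.IsBasicQuiver w η M N Q) (hR : C.IsBasicQuiver w η M N R) :
    DiffersBy (fun s t => R.weight s t - Q.weight s t) Q R := by
  have hleft : ∀ s t : Node I, ¬ s.IsGlued → R.weight s t - Q.weight s t = 0 := by
    intro s t hs
    have hvQ : ∀ v, v ∉ Q.verts → R.weight v t - Q.weight v t = 0 ∧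
        R.weight v (reflect t) - Q.weight v (reflect t) = 0 := by
      intro v hv
      have hv' : v ∉ R.verts := by rwa [hR.verts_eq, ← hQ.verts_eq]
      simp only [Q.weight_off v _ hv, R.weight_off v _ hv', sub_zero, and_self]
    have h := congrArg (fun S => S.weight s t) (hQ.amalgam.trans hR.amalgam.symm)
    change Q.weight s t + -Q.weight (reflect s) (reflect t) =
      R.weight s t + -R.weight (reflect s) (reflect t) at h
    cases s with
    | e c => exact absurd trivial hs
    | f c k =>
      by_cases hk : f c k ∈ Q.verts
      · -- the reflected node is not a vertex
        have hk' : f c (-k) ∉ Q.verts := by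
          rw [hQ.verts_eq] at hk ⊢
          have h1 := (f_mem_triangleVerts.mp hk).1
          have h2 : k ≠ 0 := hs
          exact fun h' => h2 (by have := (f_mem_triangleVerts.mp h').1; omega)
        have h3 := (hvQ _ hk').2
        change Q.weight _ t + -Q.weight (f c (-k)) (reflect t) =
          R.weight _ t + -R.weight (f c (-k)) (reflect t) at h
        linarith
      · exact (hvQ _ hk).1
  exact
    { mult_eq := hQ.mult_eq hR
      weight_eq := fun s t => by ring
      left_eq_zero := hleft
      right_eq_zero := fun s t ht => by
        have := hleft t s ht
        rw [Q.weight_skew s t, R.weight_skew s t]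
        linarith }

/-- Two basic quivers differ by arrows between glued nodes only.  The mutations do not change these
arrows; reversal moves `f_i^0` to a node which is not glued, and reversal and involution determine
the arrows between the nodes `e_i^0` up to opposite signs. -/
theorem unique (hη : C.IsDynkinInvolution w η) (hQ : C.IsBasicQuiver w η M N Q)
    (hR : C.IsBasicQuiver w η M N R) : R = Q := by
  have h := hQ.differsBy hR
  have hM : ∀ s t, R.weight s t - Q.weight s t =
      -(R.weight (reflect (Node.reversal η (fun i => w.count i) s))
          (reflect (Node.reversal η (fun i => w.count i) t)) -
        Q.weight (reflect (Node.reversal η (fun i => w.count i) s))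
          (reflect (Node.reversal η (fun i => w.count i) t))) := by
    intro s t
    have h1 := (h.wordChange M).weight_eq s t
    rw [hQ.reversal, hR.reversal] at h1
    simp only [WeightedQuiver.relabel, mirror, WeightedQuiver.flip] at h1
    linarith
  have hN : ∀ s t, R.weight s t - Q.weight s t =
      R.weight (Node.involution η s) (Node.involution η t) -
        Q.weight (Node.involution η s) (Node.involution η t) := by
    intro s t
    have h1 := (h.wordChange N).weight_eq (Node.involution η s) (Node.involution η t)
    have hq : Q.weight s t = (N.act Q).weight (Node.involution η s) (Node.involution η t) :=
      congrArg (fun S => S.weight s t) hQ.involution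
    have hr : R.weight s t = (N.act R).weight (Node.involution η s) (Node.involution η t) :=
      congrArg (fun S => S.weight s t) hR.involution
    rw [hq, hr, h1]
    ring
  have hf : ∀ c t, R.weight (f c 0) t - Q.weight (f c 0) t = 0 := by
    intro c t
    have hc := hη.count_pos c
    rw [hM, h.left_eq_zero, neg_zero]
    change ¬ -((0 : ℤ) - w.count c) = 0
    omega
  ext1
  · rw [hQ.verts_eq, hR.verts_eq]
  · rw [hQ.frozen_eq, hR.frozen_eq]
  · exact h.mult_eq
  · funext s t
    refine sub_eq_zero.mp ?_
    by_cases hs : s.IsGlued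
    · by_cases ht : t.IsGlued
      · cases s with
        | f c k =>
          obtain rfl : k = 0 := hs
          exact hf c t
        | e c =>
          cases t with
          | f c' k =>
            obtain rfl : k = 0 := ht
            have := hf c' (e c)
            rw [Q.weight_skew, R.weight_skew]
            linarith
          | e c' =>
            have h1 := hM (e c) (e c')
            have h2 := hN (e c) (e c')
            change _ = -(R.weight (e (η c)) (e (η c')) - Q.weight (e (η c)) (e (η c'))) at h1
            change _ = R.weight (e (η c)) (e (η c')) - Q.weight (e (η c)) (e (η c')) at h2
            linarith
      · exact h.right_eq_zero s t ht
    · exact h.left_eq_zero s t hs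

end IsBasicQuiver

end SimpleCartanDatum

end BasicQuiver

theorem mainTheorem5 {I : Type*} [Fintype I] [DecidableEq I] (C : BasicQuiver.SimpleCartanDatum I)
    (w : List I) (hw : C.IsLongestWord w)
    (η : Equiv.Perm I) (hη : C.IsDynkinInvolution w η) :
    Nonempty (C.WordChange w w.reverse) ∧ Nonempty (C.WordChange w (w.map η)) ∧
      ∃ Q : BasicQuiver.WeightedQuiver (BasicQuiver.Node I),
        ∀ (M : C.WordChange w w.reverse) (N : C.WordChange w (w.map η)),
          C.IsBasicQuiver w η M N Q ∧
            ∀ Q' : BasicQuiver.WeightedQuiver (BasicQuiver.Node I),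
              C.IsBasicQuiver w η M N Q' → Q' = Q := by
  refine ⟨C.nonempty_wordChange hw.1 hw.1.reverse hη.reverse_wordProd.symm,
    C.nonempty_wordChange hw.1 (hη.isReduced_map hw.1) hη.map_wordProd.symm,
    C.triangleQuiver w, fun M N => ?_⟩
  have h := BasicQuiver.SimpleCartanDatum.isBasicQuiver_triangleQuiver hw.1 hη M N
  exact ⟨h, fun Q' hQ' => h.unique hη hQ'⟩
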